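/- Let $m\ge 1$. For $b\in\mathbb C$ put $(b)_t=b(b+1)\cdots(b+t-1)$, $(b)_0=1$, and for a partition $\tau=(t_1\ge\cdots\ge t_m\ge 0)$ of $t$ into at most $m$ parts put $(\beta)_\tau=\prod_{i=1}^m\bigl(\beta-\tfrac12(i-1)\bigr)_{t_i}$. Let $C_\tau$ denote the zonal polynomial of $\tau$ on complex symmetric $m\times m$ matrices: the component of $(\operatorname{tr}X)^t$ in the space $V_\tau$ spanned by the functions $X\mapsto\Delta_\tau(LXL^{\mathsf T})$, $L\in GL_m(\mathbb R)$, in the decomposition $\bigoplus_\tau V_\tau$ of the homogeneous polynomials of degree $t$, where $\Delta_\tau(X)=\prod_{i=1}^m(\det X_{[i]})^{t_i-t_{i+1}}$, $X_{[i]}$ is the leading $i\times i$ block and $t_{m+1}=0$; in particular $\sum_\tau C_\tau(X)=(\operatorname{tr}X)^t$. For a sequence $f(t)$ of complex numbers define $${}_1P_1(f(t):a;c;X)=\sum_{t=0}^\infty\frac{f(t)}{t!}\sum_{\tau}\frac{(a)_\tau}{(c)_\tau}C_\tau(X),$$ the inner sum being over all partitions $\tau$ of $t$ into at most $m$ parts.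 Let $X$ be a complex symmetric $m\times m$ matrix whose real part is positive definite, with eigenvalues $\lambda_1,\dots,\lambda_m$ (with multiplicity), and let $a,c\in\mathbb C$ with $\operatorname{Re}(a)>\frac12(m-1)$ and $\operatorname{Re}(c)>\frac12(m-1)$. Let $b,d\in\mathbb C$; non-integral powers are taken on the principal branch, $\arg\in(-\pi,\pi]$. 1. If $|d|>\sum_i|\lambda_i|$, the series ${}_1P_1\bigl((b)_t d^{-b-t}:a;c;X\bigr)$ converges absolutely (as a series in $t$). 2. If $|d-\operatorname{tr}X|>\sum_i|\lambda_i|$, the series ${}_1P_1\bigl((b)_t(d-\operatorname{tr}X)^{-t}:c-a;c;-X\bigr)$ converges absolutely (as a series in $t$). 3. Suppose that $d\ne0$, $d\neq\operatorname{tr}X$, that both series converge absolutely (as series in $t$), and that either $b$ is an integer or $\arg(d)+\arg\bigl(1-\operatorname{tr}(X)/d\bigr)\in(-\pi,\pi]$. Then the Kummer–Pearson VII relation holds: $${}_1P_1\bigl((b)_t d^{-b-t}:a;c;X\bigr)=(d-\operatorname{tr}X)^{-b}\,{}_1P_1\bigl((b)_t(d-\operatorname{tr}X)^{-t}:c-a;c;-X\bigr).$$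 -/

import Mathlib

open scoped Matrix MatrixGroups

noncomputable section

namespace KummerPearson

/-- The space of complex symmetric `m × m` matrices. -/
def SymMat (m : ℕ) : Submodule ℂ (Matrix (Fin m) (Fin m) ℂ) where
  carrier := {X | X.IsSymm}
  zero_mem' := Matrix.isSymm_zero
  add_mem' := fun hX hY => hX.add hY
  smul_mem' := fun k _ hX => hX.smul k

/-- The congruence action `X ↦ L X Lᵀ` of `GL(m, ℝ)` on complex symmetric matrices. -/
def congruence {m : ℕ} (L : GL (Fin m) ℝ) (X : SymMat m) : Matrix (Fin m) (Fin m) ℂ :=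
  (L : Matrix (Fin m) (Fin m) ℝ).map Complex.ofReal * (X : Matrix (Fin m) (Fin m) ℂ) *
    ((L : Matrix (Fin m) (Fin m) ℝ).map Complex.ofReal)ᵀ

/-- The partitions `τ = (t₁ ≥ t₂ ≥ ⋯ ≥ t_m ≥ 0)` of `t` into at most `m` (nonzero) parts. -/
def partitions (m t : ℕ) : Finset (Fin m → ℕ) :=
  open Classical in (Finset.univ.piAntidiag t).filter Antitone

/-- The leading principal minor on the rows and columns `0, …, i`. -/
def leadingMinor {m : ℕ} (X : Matrix (Fin m) (Fin m) ℂ) (i : Fin m) : ℂ :=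
  (X.submatrix (Fin.castLE (Nat.succ_le_of_lt i.isLt))
    (Fin.castLE (Nat.succ_le_of_lt i.isLt))).det

/-- The part following the `i`-th one, with `t_{m+1} = 0`. -/
def nextPart {m : ℕ} (τ : Fin m → ℕ) (i : Fin m) : ℕ :=
  if h : (i : ℕ) + 1 < m then τ ⟨(i : ℕ) + 1, h⟩ else 0

/-- The generalized power `Δ_τ(X) = ∏ᵢ (i-th leading principal minor) ^ (tᵢ - tᵢ₊₁)`, the highest
weight vector of type `2τ` in the polynomial functions on symmetric matrices. -/
def generalizedPower {m : ℕ} (τ : Fin m → ℕ) (X : Matrix (Fin m) (Fin m) ℂ) : ℂ :=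
  ∏ i, leadingMinor X i ^ (τ i - nextPart τ i)

/-- The irreducible `GL(m)`-invariant space `V_τ` of homogeneous polynomial functions on symmetric
matrices: the span of the translates of `Δ_τ`. -/
def zonalSpace {m : ℕ} (τ : Fin m → ℕ) : Submodule ℂ (SymMat m → ℂ) :=
  Submodule.span ℂ
    (Set.range fun L : GL (Fin m) ℝ => fun X : SymMat m => generalizedPower τ (congruence L X))

/-- `C` is the decomposition of `(tr X) ^ t` along the direct sum `⨁_τ V_τ` of all homogeneous
polynomial functions of degree `t` on symmetric matrices. -/
def IsZonalDecomposition (m t : ℕ) (C : (Fin m → ℕ) → SymMat m → ℂ) : Prop :=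
  (∀ τ ∈ partitions m t, C τ ∈ zonalSpace τ) ∧
    ∀ X : SymMat m,
      ∑ τ ∈ partitions m t, C τ X = (X : Matrix (Fin m) (Fin m) ℂ).trace ^ t

open Classical in
/-- The zonal polynomial `C_τ`: the component of `(tr X) ^ t` in `V_τ`, where `t = t₁ + ⋯ + t_m`.
In particular `∑_τ C_τ(X) = (tr X) ^ t`. -/
def zonal {m : ℕ} (τ : Fin m → ℕ) : SymMat m → ℂ :=
  if h : ∃ C, IsZonalDecomposition m (∑ i, τ i) C then h.choose τ else 0

/-- The rising factorial `(b)_t = b (b + 1) ⋯ (b + t - 1)`. -/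
def rising (b : ℂ) (t : ℕ) : ℂ := ∏ j ∈ Finset.range t, (b + j)

/-- `(β)_τ = ∏_{i=1}^m (β - (i - 1) / 2)_{tᵢ}`; here indices start at `0`. -/
def risingPartition {m : ℕ} (β : ℂ) (τ : Fin m → ℕ) : ℂ :=
  ∏ i : Fin m, rising (β - ((i : ℕ) : ℂ) / 2) (τ i)

/-- The `t`-th term of the series `₁P₁(f(t) : a; c; X)`. -/
def oneP1Term {m : ℕ} (f : ℕ → ℂ) (a c : ℂ) (X : SymMat m) (t : ℕ) : ℂ :=
  f t / (t.factorial : ℂ) *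
    ∑ τ ∈ partitions m t, risingPartition a τ / risingPartition c τ * zonal τ X

/-- The series `₁P₁(f(t) : a; c; X) = ∑_t f(t) / t! ∑_τ (a)_τ / (c)_τ C_τ(X)`. -/
def oneP1 {m : ℕ} (f : ℕ → ℂ) (a c : ℂ) (X : SymMat m) : ℂ :=
  ∑' t, oneP1Term f a c X t

/-- The sum of the absolute values of the eigenvalues of `X`, counted with multiplicity. -/
def absEigenvalueSum {m : ℕ} (X : SymMat m) : ℝ :=
  ((X : Matrix (Fin m) (Fin m) ℂ).charpoly.roots.map fun z => ‖z‖).sum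

end KummerPearson

end

/-!
Averaging `Δ_τ(Z X Zᵀ)` over a Gaussian matrix `Z` gives `C_τ(X)` up to a constant factor. The
average is an orthogonally invariant polynomial function of `X`, hence a symmetric polynomial in the
eigenvalues of `X`, and at diagonal matrices it has nonnegative coefficients. As the factors are
nonnegative too, `∑_τ |C_τ(X)| ≤ (∑ |λᵢ|) ^ t`. Together with `(a)_τ / (c)_τ = O(r ^ t)` for every
`r > 1`, this gives both convergence statements.

The linear map `C_τ ↦ (c)_τ C_τ` turns multiplication by `tr X` into the first order operator
`R_c = c (λ₁ + ⋯ + λ_m) + ∑ λᵢ² ∂ᵢ`, so that `∑_τ (a)_τ C_τ = R_a ^ t 1`. Since `R_c - R_{c - a}` is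
multiplication by `a (λ₁ + ⋯ + λ_m)` and `R_c` satisfies a Leibniz rule, expanding `R_a ^ t`
binomially expresses the degree `t` part of the left-hand series as a binomial transform of the
homogeneous parts of the right-hand one. For large `|d|` the resulting double series is summed by
the binomial series. Both sides continue analytically along a ray starting at `d` on which the
absolute values of both arguments increase, and are continuous at `d`.
-/

noncomputable section

namespace KummerPearson

open MeasureTheory ProbabilityTheory MvPolynomial

section PolynomialFunctions
variable {Ω σ R : Type*}

/-- The algebra of polynomial functions in a family of coordinate functions `v`. -/
def polyFunctions [CommSemiring R] (v : σ → Ω → R) : Subalgebra R (Ω → R) :=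
  Algebra.adjoin R (Set.range v)

lemma mem_polyFunctions [CommSemiring R] {v : σ → Ω → R} {f : Ω → R} :
    f ∈ polyFunctions v ↔ ∃ p : MvPolynomial σ R, ∀ ω, f ω = eval (fun i => v i ω) p := by
  have aeval_eq (p : MvPolynomial σ R) (ω : Ω) : aeval v p ω = eval (fun i => v i ω) p := by
    rw [← Pi.evalAlgHom_apply R (fun _ => R) ω (aeval v p), comp_aeval_apply, ← coe_aeval_eq_eval]
    rfl
  simp only [polyFunctions, Algebra.adjoin_range_eq_range_aeval, AlgHom.mem_range,
    _root_.funext_iff, aeval_eq, eq_comm]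

lemma coord_mem_polyFunctions [CommSemiring R] (v : σ → Ω → R) (i : σ) : v i ∈ polyFunctions v :=
  Algebra.subset_adjoin ⟨i, rfl⟩

section CommSemiring
variable [CommSemiring R] (A : Subalgebra R (Ω → R))

lemma fun_const_mem (c : R) : (fun _ => c) ∈ A := A.algebraMap_mem c

lemma fun_sum_mem {ι : Type*} (s : Finset ι) {f : ι → Ω → R} (h : ∀ i ∈ s, f i ∈ A) :
    (fun ω => ∑ i ∈ s, f i ω) ∈ A := by
  simpa only [Finset.sum_fn] using A.sum_mem h

lemma fun_prod_mem {ι : Type*} (s : Finset ι) {f : ι → Ω → R} (h : ∀ i ∈ s, f i ∈ A) :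
    (fun ω => ∏ i ∈ s, f i ω) ∈ A := by
  simpa only [Finset.prod_fn] using A.prod_mem h

lemma fun_matrix_mul_mem {l m n : Type*} [Fintype m] {M : Ω → Matrix l m R} {N : Ω → Matrix m n R}
    (hM : ∀ i j, (fun ω => M ω i j) ∈ A) (hN : ∀ i j, (fun ω => N ω i j) ∈ A) (i : l) (j : n) :
    (fun ω => (M ω * N ω) i j) ∈ A := by
  simp only [Matrix.mul_apply]
  exact fun_sum_mem A _ fun k _ => A.mul_mem (hM i k) (hN k j)

end CommSemiring

lemma fun_det_mem [CommRing R] (A : Subalgebra R (Ω → R)) {n : Type*} [Fintype n] [DecidableEq n]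
    {M : Ω → Matrix n n R} (hM : ∀ i j, (fun ω => M ω i j) ∈ A) : (fun ω => (M ω).det) ∈ A := by
  simp only [Matrix.det_apply']
  exact fun_sum_mem A _ fun σ _ =>
    A.mul_mem (fun_const_mem A _) (fun_prod_mem A _ fun i _ => hM (σ i) i)

lemma fun_generalizedPower_mem (A : Subalgebra ℂ (Ω → ℂ)) {m : ℕ} (τ : Fin m → ℕ)
    {M : Ω → Matrix (Fin m) (Fin m) ℂ} (hM : ∀ i j, (fun ω => M ω i j) ∈ A) :
    (fun ω => generalizedPower τ (M ω)) ∈ A :=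
  fun_prod_mem A _ fun _ _ => A.pow_mem (fun_det_mem A fun _ _ => hM _ _) _

lemma exists_eq_sum_mul_of_mem_polyFunctions [CommSemiring R] {σ' Ω' : Type*} {v : σ → Ω → R}
    {v' : σ' → Ω' → R} {F : Ω × Ω' → R}
    (hF : F ∈ polyFunctions
      (Sum.elim (fun i ω => v i ω.1) (fun j ω => v' j ω.2) : σ ⊕ σ' → Ω × Ω' → R)) :
    ∃ (s : Finset ((σ ⊕ σ') →₀ ℕ)) (u : ((σ ⊕ σ') →₀ ℕ) → Ω → R) (w : ((σ ⊕ σ') →₀ ℕ) → Ω' → R),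
      (∀ k, u k ∈ polyFunctions v) ∧ (∀ k, w k ∈ polyFunctions v') ∧
        ∀ x y, F (x, y) = ∑ k ∈ s, u k x * w k y := by
  classical
  obtain ⟨p, hp⟩ := mem_polyFunctions.1 hF
  refine ⟨p.support,
    fun k x => p.coeff k * ∏ i ∈ k.support.toLeft, v i x ^ k (Sum.inl i),
    fun k y => ∏ j ∈ k.support.toRight, v' j y ^ k (Sum.inr j), fun k => ?_, fun k => ?_, ?_⟩
  · exact Subalgebra.mul_mem _ (fun_const_mem _ _)
      (fun_prod_mem _ _ fun i _ => Subalgebra.pow_mem _ (coord_mem_polyFunctions _ _) _)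
  · exact fun_prod_mem _ _ fun i _ => Subalgebra.pow_mem _ (coord_mem_polyFunctions _ _) _
  · intro x y
    rw [hp, eval_eq]
    refine Finset.sum_congr rfl fun k _ => ?_
    rw [mul_assoc]
    congr 1
    conv_lhs => rw [← Finset.toLeft_disjSum_toRight (u := k.support), Finset.prod_disjSum]
    rfl

end PolynomialFunctions

/-! ### Gaussian expectations of polynomials -/

lemma hasDerivAt_gaussianPDFReal (μ : ℝ) (v : NNReal) (x : ℝ) :
    HasDerivAt (gaussianPDFReal μ v) (-(x - μ) / v * gaussianPDFReal μ v x) x := by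
  have hexponent : HasDerivAt (fun x : ℝ => -(x - μ) ^ 2 / (2 * v)) (-(x - μ) / v) x := by
    refine ((((hasDerivAt_id x).sub_const μ).pow 2).fun_neg.div_const (2 * (v : ℝ))).congr_deriv ?_
    rw [← mul_div_mul_left (-(x - μ)) (v : ℝ) two_ne_zero]
    simp only [id, Nat.cast_ofNat, Nat.add_one_sub_one, pow_one, mul_one]
    ring
  rw [gaussianPDFReal_def]
  exact (hexponent.exp.const_mul _).congr_deriv (by ring)

lemma integrable_pow_gaussianReal (μ : ℝ) (v : NNReal) (k : ℕ) :
    Integrable (fun x : ℝ => x ^ k) (gaussianReal μ v) := by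
  rw [← integrable_norm_iff (by fun_prop)]
  simpa using (memLp_id_gaussianReal (μ := μ) (v := v) k).integrable_norm_pow'

lemma integrable_pow_mul_gaussianPDFReal (μ : ℝ) {v : NNReal} (hv : v ≠ 0) (k : ℕ) :
    Integrable fun x : ℝ => x ^ k * gaussianPDFReal μ v x := by
  have h := integrable_pow_gaussianReal μ v k
  rw [gaussianReal_of_var_ne_zero _ hv, integrable_withDensity_iff_integrable_smul'
    (measurable_gaussianPDF _ _) (ae_of_all _ fun _ => gaussianPDF_lt_top)] at h
  exact h.congr (ae_of_all _ fun x => by simp [toReal_gaussianPDF, mul_comm])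

lemma integral_pow_succ_gaussianReal (k : ℕ) :
    ∫ x : ℝ, x ^ (k + 1) ∂(gaussianReal 0 1) = k * ∫ x : ℝ, x ^ (k - 1) ∂(gaussianReal 0 1) := by
  have integrable_pow := integrable_pow_mul_gaussianPDFReal 0 one_ne_zero
  have hderiv (x : ℝ) : HasDerivAt (gaussianPDFReal 0 1) (-x * gaussianPDFReal 0 1 x) x := by
    simpa using hasDerivAt_gaussianPDFReal 0 1 x
  have by_parts := integral_mul_deriv_eq_deriv_mul_of_integrable (u := fun x : ℝ => x ^ k)
    (u' := fun x => k * x ^ (k - 1)) (fun x _ => by simpa using hasDerivAt_pow k x)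
    (fun x _ => hderiv x)
    ((integrable_pow (k + 1)).neg.congr
      (ae_of_all _ fun x => by simp only [Pi.neg_apply, Pi.mul_apply]; ring))
    (((integrable_pow (k - 1)).const_mul (k : ℝ)).congr
      (ae_of_all _ fun x => by simp only [Pi.mul_apply]; ring))
    (integrable_pow k)
  have hleft : ∫ x : ℝ, x ^ k * (-x * gaussianPDFReal 0 1 x)
      = -∫ x, gaussianPDFReal 0 1 x • x ^ (k + 1) := by
    rw [← integral_neg]
    exact integral_congr_ae (ae_of_all _ fun x => by simp only [smul_eq_mul]; ring)
  have hright : ∫ x : ℝ, (k * x ^ (k - 1)) * gaussianPDFReal 0 1 x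
      = k * ∫ x, gaussianPDFReal 0 1 x • x ^ (k - 1) := by
    rw [← integral_const_mul]
    exact integral_congr_ae (ae_of_all _ fun x => by simp only [smul_eq_mul]; ring)
  rw [integral_gaussianReal_eq_integral_smul one_ne_zero,
    integral_gaussianReal_eq_integral_smul one_ne_zero]
  linarith

section Expectation
variable {ι : Type*} [Fintype ι]

/-- The standard Gaussian measure on `ι → ℝ`. -/
def gaussianPi (ι : Type*) [Fintype ι] : Measure (ι → ℝ) := Measure.pi fun _ => gaussianReal 0 1

instance : IsProbabilityMeasure (gaussianPi ι) := by
  unfold gaussianPi; infer_instance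

instance : (gaussianPi ι).IsOpenPosMeasure := by
  have : (gaussianReal 0 1).IsOpenPosMeasure :=
    (gaussianReal_absolutelyContinuous' 0 one_ne_zero).isOpenPosMeasure
  unfold gaussianPi; infer_instance

lemma eval_ofReal_monomial (α : ι →₀ ℕ) (c : ℂ) (z : ι → ℝ) :
    eval (fun i => (z i : ℂ)) (monomial α c) = c * ∏ i, ((z i ^ α i : ℝ) : ℂ) := by
  rw [eval_monomial, Finsupp.prod_fintype _ _ (by simp)]
  simp only [Complex.ofReal_pow]

lemma integrable_eval_gaussianPi (p : MvPolynomial ι ℂ) :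
    Integrable (fun z : ι → ℝ => eval (fun i => (z i : ℂ)) p) (gaussianPi ι) := by
  induction p using MvPolynomial.induction_on' with
  | monomial α c =>
    simp only [eval_ofReal_monomial]
    exact (Integrable.fintype_prod (f := fun i (x : ℝ) => ((x ^ α i : ℝ) : ℂ))
      fun i => (integrable_pow_gaussianReal 0 1 (α i)).ofReal).const_mul c
  | add p q hp hq =>
    simp only [map_add]
    exact hp.add hq

lemma integrable_of_mem_polyFunctions {f : (ι → ℝ) → ℂ}
    (hf : f ∈ polyFunctions fun i z => (z i : ℂ)) : Integrable f (gaussianPi ι) := by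
  obtain ⟨p, hp⟩ := mem_polyFunctions.1 hf
  exact (integrable_eval_gaussianPi p).congr (ae_of_all _ fun z => (hp z).symm)

/-- The expectation of a polynomial in independent standard Gaussian variables. -/
def gaussianExpect (ι : Type*) [Fintype ι] : MvPolynomial ι ℂ →ₗ[ℂ] ℂ where
  toFun p := ∫ z, eval (fun i => (z i : ℂ)) p ∂(gaussianPi ι)
  map_add' p q := by
    simp only [map_add]
    exact integral_add (integrable_eval_gaussianPi p) (integrable_eval_gaussianPi q)
  map_smul' c p := by
    simp only [smul_eval, RingHom.id_apply, smul_eq_mul]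
    exact integral_const_mul _ _

lemma gaussianExpect_apply (p : MvPolynomial ι ℂ) :
    gaussianExpect ι p = ∫ z, eval (fun i => (z i : ℂ)) p ∂(gaussianPi ι) := rfl

/-- The mixed moment of independent standard Gaussian variables, of order `α i` in the `i`-th. -/
def gaussianMoment (α : ι →₀ ℕ) : ℂ := ∏ i, ((∫ x : ℝ, x ^ α i ∂(gaussianReal 0 1) : ℝ) : ℂ)

lemma gaussianExpect_monomial (α : ι →₀ ℕ) (c : ℂ) :
    gaussianExpect ι (monomial α c) = c * gaussianMoment α := by
  rw [gaussianExpect_apply]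
  simp only [eval_ofReal_monomial]
  rw [integral_const_mul, gaussianPi,
    integral_fintype_prod_eq_prod (f := fun i (x : ℝ) => ((x ^ α i : ℝ) : ℂ))]
  simp only [integral_complex_ofReal, gaussianMoment]

lemma gaussianMoment_add_single (α : ι →₀ ℕ) (i : ι) :
    gaussianMoment (α + Finsupp.single i 1) = α i * gaussianMoment (α - Finsupp.single i 1) := by
  classical
  rw [gaussianMoment, gaussianMoment, ← Finset.mul_prod_erase _ _ (Finset.mem_univ i),
    ← Finset.mul_prod_erase _ _ (Finset.mem_univ i), ← mul_assoc]
  congr 1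
  · simp only [Finsupp.add_apply, Finsupp.single_eq_same, integral_pow_succ_gaussianReal,
      Finsupp.tsub_apply]
    push_cast; rfl
  · refine Finset.prod_congr rfl fun j hj => ?_
    simp [(Finset.ne_of_mem_erase hj).symm]

lemma gaussianExpect_X_mul (i : ι) (p : MvPolynomial ι ℂ) :
    gaussianExpect ι (X i * p) = gaussianExpect ι (pderiv i p) := by
  induction p using MvPolynomial.induction_on' with
  | monomial α c =>
    rw [pderiv_monomial, gaussianExpect_monomial, X, monomial_mul, gaussianExpect_monomial,
      add_comm, gaussianMoment_add_single]
    ring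
  | add p q hp hq => simp [mul_add, hp, hq]

lemma integral_comp_of_sum_sq_eq (A : (ι → ℝ) →ₗ[ℝ] (ι → ℝ))
    (hA : ∀ z, ∑ i, A z i ^ 2 = ∑ i, z i ^ 2) (f : (ι → ℝ) → ℂ) :
    ∫ z, f (A z) ∂(gaussianPi ι) = ∫ z, f z ∂(gaussianPi ι) := by
  classical
  let e := WithLp.linearEquiv 2 ℝ (ι → ℝ)
  let B : EuclideanSpace ℝ ι →ₗᵢ[ℝ] EuclideanSpace ℝ ι :=
    { toLinearMap := e.symm.toLinearMap ∘ₗ A ∘ₗ e.toLinearMap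
      norm_map' := fun x => by
        rw [EuclideanSpace.norm_eq, EuclideanSpace.norm_eq]
        simpa [e] using congrArg Real.sqrt (hA (WithLp.ofLp x)) }
  have preserving : MeasurePreserving A (gaussianPi ι) (gaussianPi ι) := by
    refine ⟨A.continuous_of_finiteDimensional.measurable, ?_⟩
    have h := congrArg (Measure.map (WithLp.ofLp : EuclideanSpace ℝ ι → ι → ℝ))
      (stdGaussian_map (B.toLinearIsometryEquiv rfl))
    rw [← map_pi_eq_stdGaussian, Measure.map_map (by fun_prop) (by fun_prop),
      Measure.map_map (by fun_prop) (by fun_prop), Measure.map_map (by fun_prop) (by fun_prop)] at h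
    exact h.trans Measure.map_id
  have injective : Function.Injective A := fun x y hxy =>
    e.symm.injective (B.injective (by simp [B, hxy]))
  exact preserving.integral_comp (LinearMap.isClosedEmbedding_of_injective
    (LinearMap.ker_eq_bot.2 injective)).measurableEmbedding f

end Expectation

/-! ### Determinants and triangular matrices -/

section Determinants
open Matrix

section LowerTriangular
variable {R : Type*} [CommRing R] {m k : ℕ}

lemma submatrix_mul_of_isLowerTriangular {β : Type*} (hk : k ≤ m) {T : Matrix (Fin m) (Fin m) R}
    (hT : T.IsLowerTriangular) (N : Matrix (Fin m) β R) :
    (T * N).submatrix (Fin.castLE hk) id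
      = T.submatrix (Fin.castLE hk) (Fin.castLE hk) * N.submatrix (Fin.castLE hk) id := by
  ext a b
  refine (Fintype.sum_of_injective (Fin.castLE hk) (Fin.castLE_injective hk) _ _ (fun j hj => ?_)
    fun _ => rfl).symm
  have : Fin.castLE hk a < j := by
    by_contra! hja
    exact hj ⟨⟨j, (Fin.le_def.1 hja).trans_lt a.2⟩, rfl⟩
  exact mul_eq_zero_of_left (hT this) _

lemma submatrix_mul_mul_transpose_of_isLowerTriangular (hk : k ≤ m)
    {T : Matrix (Fin m) (Fin m) R} (hT : T.IsLowerTriangular) (M : Matrix (Fin m) (Fin m) R) :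
    (T * M * Tᵀ).submatrix (Fin.castLE hk) (Fin.castLE hk)
      = T.submatrix (Fin.castLE hk) (Fin.castLE hk) * M.submatrix (Fin.castLE hk) (Fin.castLE hk)
        * (T.submatrix (Fin.castLE hk) (Fin.castLE hk))ᵀ := by
  have hrows := submatrix_mul_of_isLowerTriangular hk hT (M * Tᵀ)
  have hcols := congrArg transpose (submatrix_mul_of_isLowerTriangular hk hT Mᵀ)
  calc (T * M * Tᵀ).submatrix (Fin.castLE hk) (Fin.castLE hk)
      = ((T * (M * Tᵀ)).submatrix (Fin.castLE hk) id).submatrix id (Fin.castLE hk) := by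
        rw [Matrix.mul_assoc]; rfl
    _ = T.submatrix (Fin.castLE hk) (Fin.castLE hk) *
          ((T * Mᵀ).submatrix (Fin.castLE hk) id)ᵀ.submatrix (Fin.castLE hk) id := by
        rw [hrows, transpose_submatrix, transpose_mul, transpose_transpose]; rfl
    _ = _ := by
        rw [hcols, transpose_mul, ← transpose_submatrix, transpose_transpose, Matrix.mul_assoc]; rfl

lemma leadingMinor_mul_mul_transpose {T : Matrix (Fin m) (Fin m) ℂ} (hT : T.IsLowerTriangular)
    (M : Matrix (Fin m) (Fin m) ℂ) (i : Fin m) :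
    leadingMinor (T * M * Tᵀ) i = leadingMinor (T * Tᵀ) i * leadingMinor M i := by
  have hi := Nat.succ_le_of_lt i.isLt
  have hone := submatrix_mul_mul_transpose_of_isLowerTriangular hi hT 1
  rw [Matrix.mul_one, submatrix_one _ (Fin.castLE_injective _), Matrix.mul_one] at hone
  rw [leadingMinor, leadingMinor, leadingMinor, hone,
    submatrix_mul_mul_transpose_of_isLowerTriangular hi hT M]
  simp only [det_mul, det_transpose]
  ring

lemma generalizedPower_mul_mul_transpose (τ : Fin m → ℕ) {T : Matrix (Fin m) (Fin m) ℂ}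
    (hT : T.IsLowerTriangular) (M : Matrix (Fin m) (Fin m) ℂ) :
    generalizedPower τ (T * M * Tᵀ) = generalizedPower τ (T * Tᵀ) * generalizedPower τ M := by
  simp only [generalizedPower, leadingMinor_mul_mul_transpose hT, mul_pow, Finset.prod_mul_distrib]

lemma exists_isLowerTriangular_mul_orthogonal (L : Matrix (Fin m) (Fin m) ℝ) :
    ∃ T O : Matrix (Fin m) (Fin m) ℝ, T.IsLowerTriangular ∧ O * Oᵀ = 1 ∧ L = T * O := by
  let f : Fin m → EuclideanSpace ℝ (Fin m) := fun i => WithLp.toLp 2 (L i)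
  have hdim : Module.finrank ℝ (EuclideanSpace ℝ (Fin m)) = Fintype.card (Fin m) := by simp
  let b := InnerProductSpace.gramSchmidtOrthonormalBasis hdim f
  refine ⟨of fun i j => inner ℝ (b j) (f i), of fun j k => b j k,
    fun i j hij => InnerProductSpace.gramSchmidtOrthonormalBasis_inv_triangular hdim f hij, ?_, ?_⟩
  · ext i j
    simpa [mul_apply, one_apply, PiLp.inner_apply, eq_comm] using b.inner_eq_ite j i
  · ext i k
    simpa [mul_apply, f] using
      (congrArg (fun v : EuclideanSpace ℝ (Fin m) => v k) (b.sum_repr' (f i))).symm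

end LowerTriangular

section CauchyBinet
variable {n m R : Type*} [Fintype n] [DecidableEq n] [CommRing R]

lemma det_mul_eq_sum [Fintype m] (A : Matrix n m R) (B : Matrix m n R) :
    (A * B).det = ∑ f : n → m, (∏ k, A k (f k)) * (B.submatrix f id).det := by
  have hrows : A * B = fun k => ∑ j, A k j • B j := by
    ext k l; simp [mul_apply]
  calc (A * B).det = detRowAlternating fun k => ∑ j, A k j • B j := by rw [← hrows]; rfl
    _ = ∑ f : n → m, detRowAlternating fun k => A k (f k) • B (f k) :=
      (detRowAlternating (n := n) (R := R)).toMultilinearMap.map_sum _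
    _ = _ := Finset.sum_congr rfl fun f _ =>
      (detRowAlternating (n := n) (R := R)).toMultilinearMap.map_smul_univ _ _

/-- The Cauchy–Binet formula. Summing over all families of columns instead of over the increasing
ones counts every term `(card n)!` times. -/
lemma factorial_mul_det_mul [Fintype m] (A : Matrix n m R) (B : Matrix m n R) :
    ((Fintype.card n).factorial : R) * (A * B).det
      = ∑ f : n → m, (A.submatrix id f).det * (B.submatrix f id).det := by
  have hperm (σ : Equiv.Perm n) : (A * B).det = ∑ f : n → m,
      ((σ.sign : ℤ) : R) * (∏ k, A (σ k) (f k)) * (B.submatrix f id).det := by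
    rw [det_mul_eq_sum, ← (σ.arrowCongr (Equiv.refl m)).sum_comp]
    refine Finset.sum_congr rfl fun f _ => ?_
    have hprod : ∏ k, A k (σ.arrowCongr (Equiv.refl m) f k) = ∏ k, A (σ k) (f k) := by
      rw [← Equiv.prod_comp σ]; simp
    have hdet : (B.submatrix (σ.arrowCongr (Equiv.refl m) f) id).det
        = (σ.sign : ℤ) * (B.submatrix f id).det := by
      rw [← Equiv.Perm.sign_inv, ← det_permute]
      rfl
    rw [hprod, hdet]
    ring
  rw [← Fintype.card_perm, ← nsmul_eq_mul, ← Finset.card_univ, ← Finset.sum_const,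
    Finset.sum_congr rfl fun σ _ => hperm σ, Finset.sum_comm]
  refine Finset.sum_congr rfl fun f _ => ?_
  rw [det_apply' (A.submatrix id f), Finset.sum_mul]
  rfl

lemma factorial_mul_det_mul_diagonal_mul_transpose [Fintype m] [DecidableEq m] (A : Matrix n m R)
    (x : m → R) :
    ((Fintype.card n).factorial : R) * (A * diagonal x * Aᵀ).det
      = ∑ f : n → m, (A.submatrix id f).det ^ 2 * ∏ k, x (f k) := by
  rw [factorial_mul_det_mul]
  refine Finset.sum_congr rfl fun f _ => ?_
  have hcols : (A * diagonal x).submatrix id f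
      = A.submatrix id f * diagonal fun k => x (f k) := by
    ext i j; simp [mul_diagonal]
  rw [hcols, det_mul, det_diagonal, ← transpose_submatrix, det_transpose]
  ring

end CauchyBinet

section Bordered
variable {n R : Type*} [Fintype n] [DecidableEq n] [CommRing R]

lemma det_fromBlocks_of_isRegular (A : Matrix n n R) (hA : IsRegular A.det) (u : Matrix n Unit R)
    (v : Matrix Unit n R) (d : Matrix Unit Unit R) :
    (fromBlocks A u v d).det = A.det * d.det - (v * A.adjugate * u).det := by
  have hmul : fromBlocks A u v d * fromBlocks A.adjugate (-(A.adjugate * u)) 0 (A.det • 1)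
      = fromBlocks (A.det • 1) 0 (v * A.adjugate) (A.det • d - v * A.adjugate * u) := by
    rw [fromBlocks_multiply]
    congr 1
    · simp [mul_adjugate]
    · simp [← Matrix.mul_assoc, mul_adjugate]
    · simp
    · rw [Matrix.mul_neg, Matrix.mul_smul, Matrix.mul_one, ← Matrix.mul_assoc, neg_add_eq_sub]
  have hdet := congrArg det hmul
  have hadj : A.adjugate.det * A.det = A.det ^ Fintype.card n := by
    rw [← det_mul, adjugate_mul, det_smul, det_one, mul_one]
  rw [det_mul, det_fromBlocks_zero₂₁, det_fromBlocks_zero₁₂] at hdet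
  simp only [det_unique, Matrix.smul_apply, one_apply_eq, Matrix.sub_apply, smul_eq_mul, det_smul,
    det_one, mul_one] at hdet ⊢
  rw [hadj, mul_comm] at hdet
  exact (hA.pow _).left hdet

/-- The regular case applies to the generic translate `A + X • 1`, whose determinant is monic. -/
lemma det_fromBlocks_unit (A : Matrix n n R) (u : Matrix n Unit R) (v : Matrix Unit n R)
    (d : Matrix Unit Unit R) :
    (fromBlocks A u v d).det = A.det * d.det - (v * A.adjugate * u).det := by
  let A' : Matrix n n (Polynomial R) := A.map Polynomial.C + (Polynomial.X : Polynomial R) • 1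
  have hA' : IsRegular A'.det := by
    refine Polynomial.Monic.isRegular ?_
    simp only [A', Polynomial.Monic.def, ← Polynomial.leadingCoeff_det_X_one_add_C A, add_comm]
  let φ := Polynomial.evalRingHom (0 : R)
  have h := congrArg φ (det_fromBlocks_of_isRegular A' hA' (u.map Polynomial.C)
    (v.map Polynomial.C) (d.map Polynomial.C))
  have hA : φ.mapMatrix A' = A := by ext; simp [A', φ]
  have hu : (u.map Polynomial.C).map φ = u := by ext; simp [φ]
  have hv : (v.map Polynomial.C).map φ = v := by ext; simp [φ]
  have hd : φ.mapMatrix (d.map Polynomial.C) = d := by ext; simp [φ]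
  have hblocks : φ.mapMatrix (fromBlocks A' (u.map Polynomial.C) (v.map Polynomial.C)
      (d.map Polynomial.C)) = fromBlocks A u v d := by
    rw [RingHom.mapMatrix_apply, fromBlocks_map, hu, hv]
    exact congrArg₂ (fromBlocks · u v ·) hA hd
  have hcross : φ.mapMatrix (v.map Polynomial.C * A'.adjugate * u.map Polynomial.C)
      = v * A.adjugate * u := by
    rw [RingHom.mapMatrix_apply, Matrix.map_mul, Matrix.map_mul, hu, hv, ← RingHom.mapMatrix_apply,
      RingHom.map_adjugate, hA]
  simpa only [map_sub, map_mul, RingHom.map_det, hblocks, hA, hd, hcross] using h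

lemma det_eq_bordered {r : ℕ} (M : Matrix (Fin (r + 1)) (Fin (r + 1)) R) :
    M.det = (M.submatrix Fin.castSucc Fin.castSucc).det * M (Fin.last r) (Fin.last r)
      - ∑ a, ∑ b, M (Fin.last r) (Fin.castSucc a)
        * (M.submatrix Fin.castSucc Fin.castSucc).adjugate a b
        * M (Fin.castSucc b) (Fin.last r) := by
  let e : Fin r ⊕ Unit ≃ Fin (r + 1) :=
    (finSuccEquivLast.trans (Equiv.optionEquivSumPUnit (Fin r))).symm
  have hinl (a) : e (Sum.inl a) = Fin.castSucc a := by simp [e]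
  have hinr (a) : e (Sum.inr a) = Fin.last r := by simp [e]
  have hblocks : M.submatrix e e = fromBlocks (M.submatrix Fin.castSucc Fin.castSucc)
      (of fun a _ => M (Fin.castSucc a) (Fin.last r))
      (of fun _ a => M (Fin.last r) (Fin.castSucc a))
      (of fun _ _ => M (Fin.last r) (Fin.last r)) := by
    ext i j
    rcases i with i | i <;> rcases j with j | j <;> simp [hinl, hinr]
  rw [← det_submatrix_equiv_self e M, hblocks, det_fromBlocks_unit, Finset.sum_comm]
  simp only [det_unique, of_apply, mul_apply, Finset.sum_mul]

end Bordered
end Determinants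

/-! ### Means of functions of a Gaussian matrix -/

section MeanPower
variable {k m n : ℕ}

/-- The complex matrix with prescribed real entries; the entries are the integration variables. -/
def entryMatrix (z : Fin m × Fin n → ℝ) : Matrix (Fin m) (Fin n) ℂ :=
  Matrix.of fun i j => (z (i, j) : ℂ)

/-- The congruence `X ↦ Z X Zᵀ` of symmetric matrices by a rectangular matrix. -/
def symCong (Z : Matrix (Fin m) (Fin n) ℂ) (X : SymMat n) : SymMat m :=
  ⟨Z * (X : Matrix (Fin n) (Fin n) ℂ) * Zᵀ, by
    have hX : (X : Matrix (Fin n) (Fin n) ℂ)ᵀ = X := X.2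
    change (Z * (X : Matrix (Fin n) (Fin n) ℂ) * Zᵀ)ᵀ = _
    rw [Matrix.transpose_mul, Matrix.transpose_mul, Matrix.transpose_transpose, hX,
      Matrix.mul_assoc]⟩

lemma coe_symCong (Z : Matrix (Fin m) (Fin n) ℂ) (X : SymMat n) :
    (symCong Z X : Matrix (Fin m) (Fin m) ℂ) = Z * (X : Matrix (Fin n) (Fin n) ℂ) * Zᵀ := rfl

lemma symCong_mul (Y : Matrix (Fin k) (Fin m) ℂ) (Z : Matrix (Fin m) (Fin n) ℂ)
    (X : SymMat n) : symCong (Y * Z) X = symCong Y (symCong Z X) := by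
  apply Subtype.ext
  simp only [coe_symCong, Matrix.transpose_mul, Matrix.mul_assoc]

/-- Diagonal matrices as symmetric matrices. -/
def symDiag (x : Fin m → ℂ) : SymMat m :=
  ⟨Matrix.diagonal x, Matrix.diagonal_transpose x⟩

lemma coe_symDiag (x : Fin m → ℂ) :
    (symDiag x : Matrix (Fin m) (Fin m) ℂ) = Matrix.diagonal x := rfl

lemma coe_symDiag_one : (symDiag 1 : SymMat m) = (1 : Matrix (Fin m) (Fin m) ℂ) :=
  Matrix.diagonal_one

/-- The entries of a symmetric matrix. -/
def symCoord (m : ℕ) : Fin m × Fin m → SymMat m → ℂ :=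
  fun ij X => (X : Matrix (Fin m) (Fin m) ℂ) ij.1 ij.2

lemma mem_polyFunctions_of_mem_zonalSpace {τ : Fin m → ℕ} {f : SymMat m → ℂ}
    (hf : f ∈ zonalSpace τ) : f ∈ polyFunctions (symCoord m) := by
  suffices zonalSpace τ ≤ Subalgebra.toSubmodule (polyFunctions (symCoord m)) from this hf
  refine Submodule.span_le.2 ?_
  rintro _ ⟨L, rfl⟩
  exact fun_generalizedPower_mem _ τ (fun_matrix_mul_mem _ (fun_matrix_mul_mem _
    (fun _ _ => fun_const_mem _ _) fun i j => coord_mem_polyFunctions (symCoord m) (i, j))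
    fun _ _ => fun_const_mem _ _)

lemma fun_comp_mem {Ω : Type*} (A : Subalgebra ℂ (Ω → ℂ)) {f : SymMat m → ℂ}
    (hf : f ∈ polyFunctions (symCoord m)) {Y : Ω → SymMat m}
    (hY : ∀ i j, (fun ω => (Y ω : Matrix (Fin m) (Fin m) ℂ) i j) ∈ A) :
    (fun ω => f (Y ω)) ∈ A := by
  let compY : (SymMat m → ℂ) →ₐ[ℂ] (Ω → ℂ) :=
    { toFun := fun f ω => f (Y ω)
      map_one' := rfl
      map_mul' := fun _ _ => rfl
      map_zero' := rfl
      map_add' := fun _ _ => rfl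
      commutes' := fun _ => rfl }
  suffices f ∈ A.comap compY from this
  refine Algebra.adjoin_le ?_ hf
  rintro _ ⟨ij, rfl⟩
  exact hY ij.1 ij.2

lemma entryMatrix_mem (i : Fin m) (j : Fin n) :
    (fun z => entryMatrix z i j) ∈
      polyFunctions fun (ij : Fin m × Fin n) (z : Fin m × Fin n → ℝ) => (z ij : ℂ) :=
  coord_mem_polyFunctions (fun ij (z : Fin m × Fin n → ℝ) => (z ij : ℂ)) (i, j)

lemma symCong_mem {Ω : Type*} (A : Subalgebra ℂ (Ω → ℂ)) {Z : Ω → Matrix (Fin m) (Fin n) ℂ}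
    {Y : Ω → SymMat n} (hZ : ∀ i j, (fun ω => Z ω i j) ∈ A)
    (hY : ∀ i j, (fun ω => (Y ω : Matrix (Fin n) (Fin n) ℂ) i j) ∈ A) (i j : Fin m) :
    (fun ω => (symCong (Z ω) (Y ω) : Matrix (Fin m) (Fin m) ℂ) i j) ∈ A :=
  fun_matrix_mul_mem A (N := fun ω => (Z ω)ᵀ) (fun_matrix_mul_mem A hZ hY) (fun i j => hZ j i) i j

lemma symCong_entryMatrix_mem (N : SymMat n) (i j : Fin m) :
    (fun z => (symCong (entryMatrix z) N : Matrix (Fin m) (Fin m) ℂ) i j) ∈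
      polyFunctions fun (ij : Fin m × Fin n) (z : Fin m × Fin n → ℝ) => (z ij : ℂ) :=
  symCong_mem _ entryMatrix_mem (fun _ _ => fun_const_mem _ _) i j

lemma integrable_comp_symCong {f : SymMat k → ℂ} (hf : f ∈ polyFunctions (symCoord k))
    (L : Matrix (Fin k) (Fin m) ℂ) (N : SymMat n) :
    Integrable (fun z : Fin m × Fin n → ℝ => f (symCong L (symCong (entryMatrix z) N)))
      (gaussianPi (Fin m × Fin n)) :=
  integrable_of_mem_polyFunctions (fun_comp_mem _ hf
    (symCong_mem _ (fun _ _ => fun_const_mem _ _) (symCong_entryMatrix_mem N)))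

/-- The mean of `Δ_τ(Z N Zᵀ)` for a Gaussian matrix `Z`. -/
def meanPower (τ : Fin m → ℕ) (N : SymMat n) : ℂ :=
  ∫ z, generalizedPower τ (symCong (entryMatrix z) N : Matrix (Fin m) (Fin m) ℂ)
    ∂(gaussianPi (Fin m × Fin n))

lemma sum_sq_orthogonal_mul {O : Matrix (Fin m) (Fin m) ℝ} (hO : O * Oᵀ = 1)
    (Z : Matrix (Fin m) (Fin n) ℝ) :
    ∑ ij : Fin m × Fin n, (O * Z) ij.1 ij.2 ^ 2 = ∑ ij : Fin m × Fin n, Z ij.1 ij.2 ^ 2 := by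
  have sum_sq_eq_trace (M : Matrix (Fin m) (Fin n) ℝ) :
      ∑ ij : Fin m × Fin n, M ij.1 ij.2 ^ 2 = (Mᵀ * M).trace := by
    rw [Fintype.sum_prod_type, Finset.sum_comm]
    simp [Matrix.trace, Matrix.mul_apply, sq]
  rw [sum_sq_eq_trace, sum_sq_eq_trace, Matrix.transpose_mul, Matrix.mul_assoc,
    ← Matrix.mul_assoc Oᵀ, mul_eq_one_comm.1 hO, Matrix.one_mul]

lemma integral_orthogonal_mul {O : Matrix (Fin m) (Fin m) ℝ} (hO : O * Oᵀ = 1)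
    (F : Matrix (Fin m) (Fin n) ℂ → ℂ) :
    ∫ z, F (O.map Complex.ofReal * entryMatrix z) ∂(gaussianPi (Fin m × Fin n))
      = ∫ z, F (entryMatrix z) ∂(gaussianPi (Fin m × Fin n)) := by
  let A : (Fin m × Fin n → ℝ) →ₗ[ℝ] (Fin m × Fin n → ℝ) :=
    { toFun := fun z ij => (O * Matrix.of fun i j => z (i, j)) ij.1 ij.2
      map_add' := fun x y => by
        ext ij; simp [Matrix.mul_apply, mul_add, Finset.sum_add_distrib]
      map_smul' := fun c x => by
        ext ij; simp [Matrix.mul_apply, Finset.mul_sum, mul_left_comm] }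
  rw [← integral_comp_of_sum_sq_eq A (fun z => sum_sq_orthogonal_mul hO _)
    fun z => F (entryMatrix z)]
  refine integral_congr_ae (ae_of_all _ fun z => congrArg F ?_)
  ext i j
  simp [entryMatrix, A, Matrix.mul_apply]

lemma integral_transpose (F : Matrix (Fin m) (Fin n) ℂ → ℂ) :
    ∫ z, F (entryMatrix z)ᵀ ∂(gaussianPi (Fin n × Fin m))
      = ∫ z, F (entryMatrix z) ∂(gaussianPi (Fin m × Fin n)) := by
  have preserving := measurePreserving_piCongrLeft (fun _ : Fin m × Fin n => gaussianReal 0 1)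
    (Equiv.prodComm (Fin n) (Fin m))
  rw [gaussianPi, gaussianPi, ← preserving.integral_comp' fun z => F (entryMatrix z)]
  refine integral_congr_ae (ae_of_all _ fun z => congrArg F ?_)
  ext i j
  exact congrArg Complex.ofReal (Equiv.piCongrLeft_apply_apply (fun _ => ℝ)
    (Equiv.prodComm (Fin n) (Fin m)) z (j, i)).symm

lemma integral_mul_orthogonal {O : Matrix (Fin n) (Fin n) ℝ} (hO : O * Oᵀ = 1)
    (F : Matrix (Fin m) (Fin n) ℂ → ℂ) :
    ∫ z, F (entryMatrix z * O.map Complex.ofReal) ∂(gaussianPi (Fin m × Fin n))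
      = ∫ z, F (entryMatrix z) ∂(gaussianPi (Fin m × Fin n)) := by
  have hO' : Oᵀ * Oᵀᵀ = 1 := by rw [Matrix.transpose_transpose]; exact mul_eq_one_comm.1 hO
  rw [← integral_transpose F, ← integral_transpose fun Z => F (Z * O.map Complex.ofReal),
    ← integral_orthogonal_mul hO' fun Z => F Zᵀ]
  refine integral_congr_ae (ae_of_all _ fun z => congrArg F ?_)
  rw [Matrix.transpose_mul, Matrix.transpose_map, Matrix.transpose_transpose]

lemma map_ofReal_mul (K : Matrix (Fin k) (Fin m) ℝ) (L : Matrix (Fin m) (Fin n) ℝ) :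
    (K * L).map Complex.ofReal = K.map Complex.ofReal * L.map Complex.ofReal :=
  Matrix.map_mul (f := Complex.ofRealHom)

lemma map_ofReal_mul_transpose_eq_one {O : Matrix (Fin m) (Fin m) ℝ} (hO : O * Oᵀ = 1) :
    O.map Complex.ofReal * (O.map Complex.ofReal)ᵀ = 1 := by
  rw [← Matrix.transpose_map, ← map_ofReal_mul, hO]
  simp

/-- Write `L = T O` with `T` lower triangular and `O` orthogonal: `O` is absorbed by the Gaussian
measure, and `Δ_τ` is multiplicative under congruence by `T`. -/
lemma integral_generalizedPower_mul_mul_transpose (τ : Fin m → ℕ) (L : Matrix (Fin m) (Fin m) ℝ)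
    (N : SymMat n) :
    ∫ z, generalizedPower τ (L.map Complex.ofReal *
        (symCong (entryMatrix z) N : Matrix (Fin m) (Fin m) ℂ) * (L.map Complex.ofReal)ᵀ)
        ∂(gaussianPi (Fin m × Fin n))
      = generalizedPower τ (L.map Complex.ofReal * (L.map Complex.ofReal)ᵀ) * meanPower τ N := by
  obtain ⟨T, O, hT, hO, rfl⟩ := exists_isLowerTriangular_mul_orthogonal L
  have hT' : (T.map Complex.ofReal).IsLowerTriangular := fun i j hij => by simp [hT hij]
  have gram_eq : (T * O).map Complex.ofReal * ((T * O).map Complex.ofReal)ᵀ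
      = T.map Complex.ofReal * (T.map Complex.ofReal)ᵀ := by
    rw [map_ofReal_mul, Matrix.transpose_mul, Matrix.mul_assoc,
      ← Matrix.mul_assoc _ _ (T.map Complex.ofReal)ᵀ, map_ofReal_mul_transpose_eq_one hO,
      Matrix.one_mul]
  rw [gram_eq, meanPower,
    ← integral_orthogonal_mul hO fun Z => generalizedPower τ (symCong Z N), ← integral_const_mul]
  refine integral_congr_ae (ae_of_all _ fun z => ?_)
  simp only
  rw [← generalizedPower_mul_mul_transpose τ hT', map_ofReal_mul]
  simp only [coe_symCong, Matrix.transpose_mul, Matrix.mul_assoc]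

section ZonalSpace
variable {τ : Fin m → ℕ} {f : SymMat m → ℂ}

lemma integral_of_mem_zonalSpace (hf : f ∈ zonalSpace τ) (N : SymMat n) :
    ∫ z, f (symCong (entryMatrix z) N) ∂(gaussianPi (Fin m × Fin n))
      = f (symDiag 1) * meanPower τ N := by
  have integrable {f} (hf : f ∈ zonalSpace τ) :
      Integrable (fun z : Fin m × Fin n → ℝ => f (symCong (entryMatrix z) N))
        (gaussianPi (Fin m × Fin n)) :=
    integrable_of_mem_polyFunctions (fun_comp_mem _ (mem_polyFunctions_of_mem_zonalSpace hf)
      (symCong_entryMatrix_mem N))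
  induction hf using Submodule.span_induction with
  | mem f hf =>
    obtain ⟨L, rfl⟩ := hf
    simp only [congruence]
    rw [integral_generalizedPower_mul_mul_transpose, coe_symDiag_one, Matrix.mul_one]
  | zero => simp
  | add f g hf hg ihf ihg =>
    simp only [Pi.add_apply]
    rw [integral_add (integrable hf) (integrable hg), ihf, ihg, add_mul]
  | smul c f _ ih =>
    simp only [Pi.smul_apply, smul_eq_mul]
    rw [integral_const_mul, ih, mul_assoc]

lemma comp_symCong_mem_zonalSpace (hf : f ∈ zonalSpace τ) (L : GL (Fin m) ℝ) :
    (fun X => f (symCong (L.1.map Complex.ofReal) X)) ∈ zonalSpace τ := by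
  induction hf using Submodule.span_induction with
  | mem f hf =>
    obtain ⟨K, rfl⟩ := hf
    refine Submodule.subset_span ⟨K * L, funext fun X => ?_⟩
    simp only [congruence, coe_symCong, Units.val_mul, map_ofReal_mul, Matrix.transpose_mul,
      Matrix.mul_assoc]
  | zero => exact Submodule.zero_mem _
  | add f g _ _ ihf ihg => exact Submodule.add_mem _ ihf ihg
  | smul c f _ ih => exact Submodule.smul_mem _ c ih

lemma integral_symCong_of_mem_zonalSpace (hf : f ∈ zonalSpace τ) (L : GL (Fin m) ℝ)
    (N : SymMat n) :
    ∫ z, f (symCong (L.1.map Complex.ofReal) (symCong (entryMatrix z) N))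
        ∂(gaussianPi (Fin m × Fin n))
      = f (symCong (L.1.map Complex.ofReal) (symDiag 1)) * meanPower τ N :=
  integral_of_mem_zonalSpace (comp_symCong_mem_zonalSpace hf L) N

end ZonalSpace
end MeanPower

/-! ### Gram determinants of Gaussian rows -/

section GramMinors
variable (m n : ℕ)

/-- The entries of the generic `m × n` matrix, extended by zero rows. -/
def genericEntry (a : ℕ) (j : Fin n) : MvPolynomial (Fin m × Fin n) ℂ :=
  if h : a < m then X (⟨a, h⟩, j) else 0

/-- The first `r` rows of the generic matrix. -/
def genericRows (r : ℕ) : Matrix (Fin r) (Fin n) (MvPolynomial (Fin m × Fin n) ℂ) :=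
  Matrix.of fun a j => genericEntry m n a j

/-- The Gram determinant of the first `r` rows of the generic matrix. -/
def gramMinor (r : ℕ) : MvPolynomial (Fin m × Fin n) ℂ :=
  (genericRows m n r * (genericRows m n r)ᵀ).det

/-- The subalgebra of polynomials in the first `r` rows of the generic matrix. -/
def rowSubalgebra (r : ℕ) : Subalgebra ℂ (MvPolynomial (Fin m × Fin n) ℂ) :=
  Algebra.adjoin ℂ {p | ∃ a < r, ∃ j, p = genericEntry m n a j}

/-- The quadratic form in the row of index `r` whose value is the Gram determinant of the first
`r + 1` rows: `gramMinor r` times the projection orthogonal to the preceding rows. -/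
def gramForm (r : ℕ) : Matrix (Fin n) (Fin n) (MvPolynomial (Fin m × Fin n) ℂ) :=
  gramMinor m n r • 1 - (genericRows m n r)ᵀ *
    (genericRows m n r * (genericRows m n r)ᵀ).adjugate * genericRows m n r

variable {m n} {r : ℕ}

lemma genericEntry_mem_rowSubalgebra {a : ℕ} (ha : a < r) (j : Fin n) :
    genericEntry m n a j ∈ rowSubalgebra m n r :=
  Algebra.subset_adjoin ⟨a, ha, j, rfl⟩

lemma rowSubalgebra_mono {s : ℕ} (h : r ≤ s) : rowSubalgebra m n r ≤ rowSubalgebra m n s :=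
  Algebra.adjoin_mono fun _ ⟨a, ha, j, hp⟩ => ⟨a, ha.trans_le h, j, hp⟩

lemma exists_mapMatrix_eq_genericRows_mul_transpose (r : ℕ) :
    ∃ A : Matrix (Fin r) (Fin r) (rowSubalgebra m n r),
      (rowSubalgebra m n r).val.toRingHom.mapMatrix A
        = genericRows m n r * (genericRows m n r)ᵀ := by
  let W : Matrix (Fin r) (Fin n) (rowSubalgebra m n r) :=
    Matrix.of fun a j => ⟨genericEntry m n a j, genericEntry_mem_rowSubalgebra a.2 j⟩
  refine ⟨W * Wᵀ, ?_⟩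
  ext1 a b
  simp [Matrix.mul_apply, W, genericRows]

lemma gramMinor_mem_rowSubalgebra (r : ℕ) : gramMinor m n r ∈ rowSubalgebra m n r := by
  obtain ⟨A, hA⟩ := exists_mapMatrix_eq_genericRows_mul_transpose (m := m) (n := n) r
  rw [gramMinor, ← hA, ← RingHom.map_det]
  exact A.det.2

lemma gramForm_mem_rowSubalgebra (r : ℕ) (j l : Fin n) :
    gramForm m n r j l ∈ rowSubalgebra m n r := by
  obtain ⟨A, hA⟩ := exists_mapMatrix_eq_genericRows_mul_transpose (m := m) (n := n) r
  have hadj (a b) :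
      (genericRows m n r * (genericRows m n r)ᵀ).adjugate a b ∈ rowSubalgebra m n r := by
    rw [← hA, ← RingHom.map_adjugate]
    exact (A.adjugate a b).2
  rw [gramForm, Matrix.sub_apply, Matrix.smul_apply]
  refine Subalgebra.sub_mem _ (Subalgebra.mul_mem _ (gramMinor_mem_rowSubalgebra r) ?_) ?_
  · rw [Matrix.one_apply]
    split_ifs
    exacts [Subalgebra.one_mem _, Subalgebra.zero_mem _]
  · simp only [Matrix.mul_apply, Matrix.transpose_apply]
    exact Subalgebra.sum_mem _ fun b _ => Subalgebra.mul_mem _ (Subalgebra.sum_mem _ fun a _ =>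
      Subalgebra.mul_mem _ (genericEntry_mem_rowSubalgebra a.2 j) (hadj a b))
      (genericEntry_mem_rowSubalgebra b.2 l)

lemma gramForm_transpose (r : ℕ) : (gramForm m n r)ᵀ = gramForm m n r := by
  have hadj : ((genericRows m n r * (genericRows m n r)ᵀ).adjugate)ᵀ
      = (genericRows m n r * (genericRows m n r)ᵀ).adjugate := by
    rw [Matrix.adjugate_transpose, Matrix.transpose_mul, Matrix.transpose_transpose]
  rw [gramForm, Matrix.transpose_sub, Matrix.transpose_smul, Matrix.transpose_one,
    Matrix.transpose_mul, Matrix.transpose_mul, Matrix.transpose_transpose, hadj, Matrix.mul_assoc]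

lemma gramForm_mul_self (r : ℕ) :
    gramForm m n r * gramForm m n r = gramMinor m n r • gramForm m n r := by
  have hadj : genericRows m n r * (genericRows m n r)ᵀ *
      (genericRows m n r * (genericRows m n r)ᵀ).adjugate = gramMinor m n r • 1 :=
    Matrix.mul_adjugate _
  rw [gramForm]
  generalize (genericRows m n r * (genericRows m n r)ᵀ).adjugate = B at hadj ⊢
  have hsq : (genericRows m n r)ᵀ * B * genericRows m n r *
      ((genericRows m n r)ᵀ * B * genericRows m n r)
      = gramMinor m n r • ((genericRows m n r)ᵀ * B * genericRows m n r) :=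
    calc _ = (genericRows m n r)ᵀ * B * (genericRows m n r * (genericRows m n r)ᵀ * B) *
          genericRows m n r := by simp only [Matrix.mul_assoc]
      _ = _ := by rw [hadj]; simp [Matrix.mul_assoc]
  rw [sub_mul, mul_sub, mul_sub, hsq]
  simp [smul_sub]

lemma trace_gramForm (r : ℕ) :
    (gramForm m n r).trace = ((n : ℂ) - r) • gramMinor m n r := by
  rw [gramForm, Matrix.trace_sub, Matrix.trace_smul, Matrix.trace_one, Matrix.mul_assoc,
    Matrix.trace_mul_comm, Matrix.mul_assoc, Matrix.adjugate_mul, Matrix.trace_smul,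
    Matrix.trace_one, gramMinor]
  simp only [Fintype.card_fin, smul_eq_mul, smul_eq_C_mul, map_sub, map_natCast]
  ring

lemma gramMinor_succ (r : ℕ) :
    gramMinor m n (r + 1) = genericEntry m n r ⬝ᵥ (gramForm m n r *ᵥ genericEntry m n r) := by
  set W := genericRows m n r with hW
  set v := genericEntry m n r with hv
  have hsub : (genericRows m n (r + 1) * (genericRows m n (r + 1))ᵀ).submatrix
      Fin.castSucc Fin.castSucc = W * Wᵀ := by
    ext1 a b; simp [Matrix.mul_apply, genericRows, hW]
  have hrow (a : Fin r) : (genericRows m n (r + 1) * (genericRows m n (r + 1))ᵀ) (Fin.last r)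
      (Fin.castSucc a) = (W *ᵥ v) a := by
    simp [Matrix.mul_apply, genericRows, hW, hv, Matrix.mulVec, dotProduct, mul_comm]
  have hcol (a : Fin r) : (genericRows m n (r + 1) * (genericRows m n (r + 1))ᵀ) (Fin.castSucc a)
      (Fin.last r) = (W *ᵥ v) a := by
    simp [Matrix.mul_apply, genericRows, hW, hv, Matrix.mulVec, dotProduct]
  have hcorner : (genericRows m n (r + 1) * (genericRows m n (r + 1))ᵀ) (Fin.last r) (Fin.last r)
      = v ⬝ᵥ v := by
    simp [Matrix.mul_apply, genericRows, hv, dotProduct]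
  have hcross (B : Matrix (Fin r) (Fin r) (MvPolynomial (Fin m × Fin n) ℂ)) :
      ∑ a, ∑ b, (W *ᵥ v) a * B a b * (W *ᵥ v) b = v ⬝ᵥ ((Wᵀ * B * W) *ᵥ v) := by
    rw [← Matrix.mulVec_mulVec, ← Matrix.mulVec_mulVec, Matrix.dotProduct_mulVec,
      Matrix.vecMul_transpose]
    simp [dotProduct, Matrix.mulVec, Finset.mul_sum, mul_assoc]
  rw [gramMinor, det_eq_bordered, hsub]
  simp only [hrow, hcol, hcorner]
  rw [hcross, gramForm, gramMinor, ← hW, Matrix.sub_mulVec, dotProduct_sub, Matrix.smul_mulVec,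
    Matrix.one_mulVec, dotProduct_smul, smul_eq_mul]

lemma gramForm_mulVec_dotProduct_self (r : ℕ) :
    (gramForm m n r *ᵥ genericEntry m n r) ⬝ᵥ (gramForm m n r *ᵥ genericEntry m n r)
      = gramMinor m n r * gramMinor m n (r + 1) := by
  rw [gramMinor_succ, Matrix.dotProduct_mulVec, ← Matrix.mulVec_transpose, gramForm_transpose,
    Matrix.mulVec_mulVec, gramForm_mul_self, dotProduct_comm, Matrix.smul_mulVec, dotProduct_smul,
    smul_eq_mul]

section Derivative
variable (hr : r < m)
include hr

lemma pderiv_eq_zero_of_mem_rowSubalgebra (j : Fin n) {p : MvPolynomial (Fin m × Fin n) ℂ}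
    (hp : p ∈ rowSubalgebra m n r) : pderiv (⟨r, hr⟩, j) p = 0 := by
  suffices Set.EqOn (pderiv (R := ℂ) ((⟨r, hr⟩ : Fin m), j))
      (0 : Derivation ℂ (MvPolynomial (Fin m × Fin n) ℂ) (MvPolynomial (Fin m × Fin n) ℂ))
      (rowSubalgebra m n r) from this hp
  refine Derivation.eqOn_adjoin ?_
  rintro _ ⟨a, ha, l, rfl⟩
  rw [genericEntry, dif_pos (ha.trans hr), pderiv_X_of_ne]
  · rfl
  · intro h
    simp only [Prod.mk.injEq, Fin.mk.injEq] at h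
    exact ha.ne h.1

lemma pderiv_genericEntry (j l : Fin n) :
    pderiv (⟨r, hr⟩, j) (genericEntry m n r l) = if j = l then 1 else 0 := by
  rw [genericEntry, dif_pos hr, pderiv_X]
  simp [Pi.single_apply, eq_comm]

lemma pderiv_gramForm_mulVec (j a : Fin n) :
    pderiv (⟨r, hr⟩, j) ((gramForm m n r *ᵥ genericEntry m n r) a) = gramForm m n r a j := by
  simp [Matrix.mulVec, dotProduct, pderiv_genericEntry hr,
    pderiv_eq_zero_of_mem_rowSubalgebra hr j (gramForm_mem_rowSubalgebra r _ _)]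

lemma pderiv_gramMinor_succ (j : Fin n) :
    pderiv (⟨r, hr⟩, j) (gramMinor m n (r + 1))
      = 2 * (gramForm m n r *ᵥ genericEntry m n r) j := by
  have hsymm : ∑ a, genericEntry m n r a * gramForm m n r a j
      = (gramForm m n r *ᵥ genericEntry m n r) j := by
    conv_rhs => rw [← gramForm_transpose r, Matrix.mulVec_transpose]
    rfl
  simp only [gramMinor_succ, dotProduct, map_sum, Derivation.leibniz, pderiv_gramForm_mulVec hr,
    pderiv_genericEntry hr, smul_eq_mul, Finset.sum_add_distrib, hsymm]
  simp [two_mul]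

end Derivative

lemma derivation_mul_pow_mul {S R : Type*} [CommRing S] [CommRing R] [Algebra S R]
    (D : Derivation S R R) {A q h : R} (k : ℕ) (hq : D q = 2 * A) (hh : D h = 0) :
    D (A * (q ^ k * h)) = D A * (q ^ k * h) + 2 * k * (A * A * (q ^ (k - 1) * h)) := by
  rw [Derivation.leibniz, Derivation.leibniz, Derivation.leibniz_pow, hq, hh]
  simp only [nsmul_eq_mul, smul_eq_mul]
  ring

/-- Gaussian integration by parts in the row following the first `r` rows. -/
lemma gaussianExpect_gramMinor_pow_succ (hr : r < m) (k : ℕ)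
    {h : MvPolynomial (Fin m × Fin n) ℂ} (hh : h ∈ rowSubalgebra m n r) :
    gaussianExpect _ (gramMinor m n (r + 1) ^ (k + 1) * h)
      = ((n : ℂ) - r + 2 * k) *
        gaussianExpect _ (gramMinor m n (r + 1) ^ k * (gramMinor m n r * h)) := by
  set q := gramMinor m n (r + 1) with hq
  set v := genericEntry m n r with hv
  set Q := gramForm m n r with hQ
  have by_parts (j : Fin n) : gaussianExpect _ (v j * ((Q *ᵥ v) j * (q ^ k * h)))
      = gaussianExpect _ (Q j j * (q ^ k * h)
        + 2 * (k : MvPolynomial _ ℂ) * ((Q *ᵥ v) j * (Q *ᵥ v) j * (q ^ (k - 1) * h))) := by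
    rw [show v j = X (⟨r, hr⟩, j) from dif_pos hr, gaussianExpect_X_mul, derivation_mul_pow_mul _ k
      (pderiv_gramMinor_succ hr j) (pderiv_eq_zero_of_mem_rowSubalgebra hr j hh),
      pderiv_gramForm_mulVec hr]
  have hpow : 2 * (k : MvPolynomial _ ℂ) * (gramMinor m n r * q * (q ^ (k - 1) * h))
      = 2 * (k : MvPolynomial _ ℂ) * (q ^ k * (gramMinor m n r * h)) := by
    rcases k with _ | k
    · simp
    · rw [Nat.add_sub_cancel, pow_succ]; ring
  calc gaussianExpect _ (q ^ (k + 1) * h)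
      = ∑ j, gaussianExpect _ (v j * ((Q *ᵥ v) j * (q ^ k * h))) := by
        rw [← map_sum, pow_succ']
        conv_lhs => enter [2, 1, 1]; rw [hq, gramMinor_succ]
        rw [mul_assoc, dotProduct, Finset.sum_mul]
        simp only [mul_assoc, ← hv, ← hQ]
    _ = gaussianExpect _ (Q.trace * (q ^ k * h)
          + 2 * (k : MvPolynomial _ ℂ) * ((Q *ᵥ v) ⬝ᵥ (Q *ᵥ v) * (q ^ (k - 1) * h))) := by
        simp only [by_parts, ← map_sum, Finset.sum_add_distrib, ← Finset.sum_mul, ← Finset.mul_sum]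
        rfl
    _ = gaussianExpect _ (((n : ℂ) - r + 2 * k) • (q ^ k * (gramMinor m n r * h))) := by
        rw [trace_gramForm, gramForm_mulVec_dotProduct_self, hpow]
        congr 1
        simp only [smul_eq_C_mul, map_add, map_mul, map_sub, map_natCast, map_ofNat]
        ring
    _ = _ := by rw [map_smul, smul_eq_mul]

lemma gaussianExpect_gramMinor_pow (hr : r < m) (k : ℕ) {h : MvPolynomial (Fin m × Fin n) ℂ}
    (hh : h ∈ rowSubalgebra m n r) :
    gaussianExpect _ (gramMinor m n (r + 1) ^ k * h)
      = (∏ j ∈ Finset.range k, ((n : ℂ) - r + 2 * j)) *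
        gaussianExpect _ (gramMinor m n r ^ k * h) := by
  induction k generalizing h with
  | zero => simp
  | succ k ih =>
    rw [gaussianExpect_gramMinor_pow_succ hr k hh,
      ih (Subalgebra.mul_mem _ (gramMinor_mem_rowSubalgebra r) hh), Finset.prod_range_succ,
      pow_succ]
    simp only [mul_assoc, mul_left_comm]

lemma gaussianExpect_prod_gramMinor {t : ℕ → ℕ} (ht : Antitone t) (hr : r ≤ m) :
    gaussianExpect _
        (gramMinor m n r ^ t r * ∏ i ∈ Finset.range r, gramMinor m n (i + 1) ^ (t i - t (i + 1)))
      = ∏ i ∈ Finset.range r, ∏ j ∈ Finset.range (t i), ((n : ℂ) - i + 2 * j) := by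
  induction r with
  | zero => simp [gramMinor, gaussianExpect_apply]
  | succ r ih =>
    rw [Finset.prod_range_succ, ← mul_assoc, mul_right_comm, ← pow_add,
      Nat.add_sub_cancel' (ht (Nat.le_succ r)), gaussianExpect_gramMinor_pow hr,
      ih (Nat.le_of_succ_le hr), Finset.prod_range_succ, mul_comm]
    exact Subalgebra.prod_mem _ fun i hi => Subalgebra.pow_mem _
      (rowSubalgebra_mono (Finset.mem_range.1 hi) (gramMinor_mem_rowSubalgebra (i + 1))) _

lemma eval_gramMinor (z : Fin m × Fin n → ℝ) (i : Fin m) :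
    eval (fun ij => (z ij : ℂ)) (gramMinor m n (i + 1))
      = leadingMinor (symCong (entryMatrix z) (symDiag 1) : Matrix (Fin m) (Fin m) ℂ) i := by
  rw [leadingMinor, gramMinor, RingHom.map_det]
  congr 1
  ext a b
  have hlt (a : Fin (i + 1)) : (a : ℕ) < m := a.2.trans_le i.2
  simp [coe_symCong, coe_symDiag_one, Matrix.mul_apply, genericRows, genericEntry, entryMatrix, hlt,
    Fin.castLE]

end GramMinors

section MeanPowerOne
variable {m : ℕ} {τ : Fin m → ℕ}

/-- A partition as a sequence, extended by zeros. -/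
def extendPart (τ : Fin m → ℕ) (i : ℕ) : ℕ := if h : i < m then τ ⟨i, h⟩ else 0

lemma extendPart_coe (τ : Fin m → ℕ) (i : Fin m) : extendPart τ i = τ i := dif_pos i.2

lemma antitone_extendPart (hτ : Antitone τ) : Antitone (extendPart τ) := by
  intro i j hij
  unfold extendPart
  split_ifs with hj hi
  · exact hτ (by simpa using hij)
  · exact absurd (hij.trans_lt hj) hi
  · exact Nat.zero_le _
  · exact le_rfl

lemma two_pow_mul_rising (β : ℂ) (k : ℕ) :
    2 ^ k * rising (β / 2) k = ∏ j ∈ Finset.range k, (β + 2 * j) := by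
  conv_lhs => rw [rising, ← Finset.card_range k, ← Finset.prod_const, Finset.card_range,
    ← Finset.prod_mul_distrib]
  exact Finset.prod_congr rfl fun j _ => by ring

lemma meanPower_one (n : ℕ) (hτ : Antitone τ) :
    meanPower τ (symDiag 1 : SymMat n) = 2 ^ (∑ i, τ i) * risingPartition ((n : ℂ) / 2) τ := by
  have moments := gaussianExpect_prod_gramMinor (n := n) (antitone_extendPart hτ) (le_refl m)
  rw [show extendPart τ m = 0 from dif_neg (lt_irrefl m), pow_zero, one_mul,
    gaussianExpect_apply] at moments
  calc meanPower τ (symDiag 1 : SymMat n)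
      = ∏ i ∈ Finset.range m, ∏ j ∈ Finset.range (extendPart τ i), ((n : ℂ) - i + 2 * j) := by
        rw [← moments]
        refine integral_congr_ae (ae_of_all _ fun z => ?_)
        simp only [generalizedPower, map_prod, map_pow, Finset.prod_range, extendPart_coe,
          eval_gramMinor]
        rfl
    _ = ∏ i : Fin m, 2 ^ τ i * rising ((n : ℂ) / 2 - ((i : ℕ) : ℂ) / 2) (τ i) := by
        rw [Finset.prod_range]
        refine Finset.prod_congr rfl fun i _ => ?_
        rw [← sub_div, two_pow_mul_rising, extendPart_coe]
    _ = _ := by rw [risingPartition, ← Finset.prod_pow_eq_pow_sum, ← Finset.prod_mul_distrib]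

end MeanPowerOne

/-! ### Polynomial functions on symmetric matrices -/

lemma mvPolynomial_ext_of_pos {σ : Type*} {p q : MvPolynomial σ ℂ}
    (h : ∀ z : σ → ℝ, (∀ i, 0 < z i) → eval (fun i => (z i : ℂ)) p = eval (fun i => (z i : ℂ)) q) :
    p = q := by
  refine funext_set (fun _ => Complex.ofReal '' Set.Ioi (0 : ℝ))
    (fun _ => (Set.Ioi_infinite 0).image Complex.ofReal_injective.injOn) fun x hx => ?_
  choose z hz hzx using fun i => hx i (Set.mem_univ i)
  obtain rfl : (fun i => (z i : ℂ)) = x := _root_.funext hzx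
  exact h z hz

lemma mvPolynomial_ext_ofReal {σ : Type*} {p q : MvPolynomial σ ℂ}
    (h : ∀ z : σ → ℝ, eval (fun i => (z i : ℂ)) p = eval (fun i => (z i : ℂ)) q) : p = q :=
  mvPolynomial_ext_of_pos fun z _ => h z

lemma exists_eq_orthogonal_mul_diagonal_mul_transpose {n : Type*} [Fintype n] [DecidableEq n]
    {Y : Matrix n n ℝ} (hY : Y.IsSymm) :
    ∃ (O : Matrix n n ℝ) (μ : n → ℝ), O * Oᵀ = 1 ∧ Y = O * Matrix.diagonal μ * Oᵀ := by
  have hermitian : Y.IsHermitian := hY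
  refine ⟨hermitian.eigenvectorUnitary, hermitian.eigenvalues, ?_, ?_⟩
  · simpa [Matrix.star_eq_conjTranspose] using
      Unitary.coe_mul_star_self hermitian.eigenvectorUnitary
  · conv_lhs => rw [hermitian.spectral_theorem, Unitary.conjStarAlgAut_apply]
    simp [Matrix.star_eq_conjTranspose]

section SymMat
variable {m : ℕ}

lemma symDiag_mem {Ω : Type*} (A : Subalgebra ℂ (Ω → ℂ)) {x : Ω → Fin m → ℂ}
    (hx : ∀ i, (fun ω => x ω i) ∈ A) (i j : Fin m) :
    (fun ω => (symDiag (x ω) : Matrix (Fin m) (Fin m) ℂ) i j) ∈ A := by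
  simp only [coe_symDiag]
  rcases eq_or_ne i j with rfl | hij
  · simpa only [Matrix.diagonal_apply_eq] using hx i
  · simpa only [Matrix.diagonal_apply_ne _ hij] using fun_const_mem A 0

lemma coe_symCong_symDiag_ofReal (O : Matrix (Fin m) (Fin m) ℝ) (μ : Fin m → ℝ) :
    (symCong (O.map Complex.ofReal) (symDiag fun i => (μ i : ℂ)) : Matrix (Fin m) (Fin m) ℂ)
      = (O * Matrix.diagonal μ * Oᵀ).map Complex.ofReal := by
  rw [coe_symCong, coe_symDiag, map_ofReal_mul, map_ofReal_mul,
    Matrix.diagonal_map Complex.ofReal_zero, Matrix.transpose_map]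

/-- The entries on and above the diagonal of a symmetric matrix are independent variables. -/
lemma eq_zero_of_eq_zero_on_ofReal {f : SymMat m → ℂ} (hf : f ∈ polyFunctions (symCoord m))
    (h : ∀ (Y : Matrix (Fin m) (Fin m) ℝ) (X : SymMat m), Y.IsSymm →
      (X : Matrix (Fin m) (Fin m) ℂ) = Y.map Complex.ofReal → f X = 0) : f = 0 := by
  obtain ⟨p, hp⟩ := mem_polyFunctions.1 hf
  let sort (ij : Fin m × Fin m) : Fin m × Fin m := (min ij.1 ij.2, max ij.1 ij.2)
  have rename_eq_zero : rename sort p = 0 := by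
    refine mvPolynomial_ext_ofReal fun z => ?_
    let Y : Matrix (Fin m) (Fin m) ℝ := Matrix.of fun i j => z (sort (i, j))
    have hY : Y.IsSymm := by
      ext i j
      simp [Y, sort, min_comm, max_comm]
    let X : SymMat m := ⟨Y.map Complex.ofReal, (hY.map Complex.ofReal :)⟩
    rw [map_zero, eval_rename, ← h Y X hY rfl, hp]
    rfl
  ext X
  have coord_sort (ij : Fin m × Fin m) : symCoord m (sort ij) X = symCoord m ij X := by
    simp only [sort]
    rcases le_total ij.1 ij.2 with hij | hij
    · rw [min_eq_left hij, max_eq_right hij]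
    · rw [min_eq_right hij, max_eq_left hij]
      exact congrFun (congrFun X.2 ij.1) ij.2
  have := congrArg (eval fun ij => symCoord m ij X) rename_eq_zero
  simpa only [eval_rename, map_zero, Function.comp_def, coord_sort, ← hp, Pi.zero_apply] using this

lemma eq_zero_of_eq_zero_on_posDef {f : SymMat m → ℂ} (hf : f ∈ polyFunctions (symCoord m))
    (h : ∀ O : Matrix (Fin m) (Fin m) ℝ, O * Oᵀ = 1 → ∀ μ : Fin m → ℝ, (∀ i, 0 < μ i) →
      f (symCong (O.map Complex.ofReal) (symDiag fun i => (μ i : ℂ))) = 0) : f = 0 := by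
  refine eq_zero_of_eq_zero_on_ofReal hf fun Y X hY hX => ?_
  obtain ⟨O, μ, hO, rfl⟩ := exists_eq_orthogonal_mul_diagonal_mul_transpose hY
  have hmem : (fun x : Fin m → ℂ => f (symCong (O.map Complex.ofReal) (symDiag x))) ∈
      polyFunctions fun i x => x i :=
    fun_comp_mem _ hf (symCong_mem _ (fun _ _ => fun_const_mem _ _)
      (symDiag_mem _ (coord_mem_polyFunctions fun i (x : Fin m → ℂ) => x i)))
  obtain ⟨p, hp⟩ := mem_polyFunctions.1 hmem
  have hp0 : p = 0 := mvPolynomial_ext_of_pos fun z hz => by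
    rw [map_zero, ← h O hO z hz, hp]
  rw [show X = symCong (O.map Complex.ofReal) (symDiag fun i => (μ i : ℂ)) from
    Subtype.ext (hX.trans (coe_symCong_symDiag_ofReal O μ).symm), hp, hp0, map_zero]

/-- Take `L = O √μ`. -/
lemma exists_symCong_one_eq {O : Matrix (Fin m) (Fin m) ℝ} (hO : O * Oᵀ = 1)
    {μ : Fin m → ℝ} (hμ : ∀ i, 0 < μ i) :
    ∃ L : GL (Fin m) ℝ, symCong (L.1.map Complex.ofReal) (symDiag 1)
      = symCong (O.map Complex.ofReal) (symDiag fun i => (μ i : ℂ)) := by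
  have hdet : (O * Matrix.diagonal fun i => √(μ i)).det ≠ 0 := by
    rw [Matrix.det_mul, Matrix.det_diagonal]
    exact mul_ne_zero (Matrix.det_ne_zero_of_right_inverse hO)
      (Finset.prod_ne_zero_iff.2 fun i _ => (Real.sqrt_pos.2 (hμ i)).ne')
  refine ⟨Matrix.GeneralLinearGroup.mkOfDetNeZero _ hdet, Subtype.ext ?_⟩
  rw [coe_symCong_symDiag_ofReal, coe_symCong, coe_symDiag_one, Matrix.mul_one,
    ← Matrix.transpose_map, ← map_ofReal_mul]
  congr 1
  change (O * Matrix.diagonal fun i => √(μ i)) * (O * Matrix.diagonal fun i => √(μ i))ᵀ = _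
  rw [Matrix.transpose_mul, Matrix.diagonal_transpose, Matrix.mul_assoc, ← Matrix.mul_assoc _ _ Oᵀ,
    Matrix.diagonal_mul_diagonal, Matrix.mul_assoc]
  simp only [Real.mul_self_sqrt (hμ _).le]

/-! ### The orthogonally invariant element of `V_τ` -/

lemma generalizedPower_symCong_entryMatrix_mem {n : ℕ} (τ : Fin m → ℕ) :
    (fun ω : (Fin m × Fin n → ℝ) × SymMat n =>
      generalizedPower τ (symCong (entryMatrix ω.1) ω.2 : Matrix (Fin m) (Fin m) ℂ)) ∈
    polyFunctions (Sum.elim (fun i ω => (ω.1 i : ℂ)) (fun j ω => symCoord n j ω.2) :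
      (Fin m × Fin n) ⊕ (Fin n × Fin n) → (Fin m × Fin n → ℝ) × SymMat n → ℂ) :=
  fun_generalizedPower_mem _ τ (symCong_mem _
    (fun i j => coord_mem_polyFunctions _ (Sum.inl (i, j)))
    fun i j => coord_mem_polyFunctions _ (Sum.inr (i, j)))

lemma exists_meanPower_eq_sum {n : ℕ} (τ : Fin m → ℕ) :
    ∃ (K : Type) (s : Finset K) (u : K → (Fin m × Fin n → ℝ) → ℂ) (w : K → SymMat n → ℂ),
      (∀ k, u k ∈ polyFunctions fun i z => (z i : ℂ)) ∧ (∀ k, w k ∈ polyFunctions (symCoord n)) ∧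
      (∀ z X, generalizedPower τ (symCong (entryMatrix z) X : Matrix (Fin m) (Fin m) ℂ)
        = ∑ k ∈ s, u k z * w k X) ∧
      ∀ X, meanPower τ X = ∑ k ∈ s, (∫ z, u k z ∂(gaussianPi (Fin m × Fin n))) * w k X := by
  obtain ⟨s, u, w, hu, hw, h⟩ := exists_eq_sum_mul_of_mem_polyFunctions
    (v := fun ij (z : Fin m × Fin n → ℝ) => (z ij : ℂ)) (v' := symCoord n)
    (generalizedPower_symCong_entryMatrix_mem (n := n) τ)
  have expansion (z X) :
      generalizedPower τ (symCong (entryMatrix z) X : Matrix (Fin m) (Fin m) ℂ)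
        = ∑ k ∈ s, u k z * w k X := h z X
  refine ⟨_, s, u, w, hu, hw, expansion, fun X => ?_⟩
  simp only [meanPower, expansion]
  rw [integral_finsetSum _ fun k _ => (integrable_of_mem_polyFunctions (hu k)).mul_const _]
  exact Finset.sum_congr rfl fun k _ => integral_mul_const _ _

lemma meanPower_mem_polyFunctions {n : ℕ} (τ : Fin m → ℕ) :
    (fun X : SymMat n => meanPower τ X) ∈ polyFunctions (symCoord n) := by
  obtain ⟨K, s, u, w, -, hw, -, h⟩ := exists_meanPower_eq_sum (n := n) τ
  simp only [h]
  exact fun_sum_mem _ _ fun k _ => Subalgebra.mul_mem _ (fun_const_mem _ _) (hw k)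

/-- The orthogonally invariant element of `V_τ` obtained by Gaussian averaging. -/
def zonalMean (τ : Fin m → ℕ) (X : SymMat m) : ℂ := meanPower τ X

lemma exists_integral_eq_map_zonalMean (τ : Fin m → ℕ) (φ : (SymMat m → ℂ) →ₗ[ℂ] ℂ) :
    ∃ P ∈ polyFunctions (fun (ij : Fin m × Fin m) (z : Fin m × Fin m → ℝ) => (z ij : ℂ)),
      (∀ z, P z = φ fun X => generalizedPower τ (symCong (entryMatrix z) X)) ∧
      ∫ z, P z ∂(gaussianPi (Fin m × Fin m)) = φ (zonalMean τ) := by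
  obtain ⟨K, s, u, w, hu, -, expansion, mean_eq⟩ := exists_meanPower_eq_sum (n := m) τ
  refine ⟨fun z => ∑ k ∈ s, u k z * φ (w k),
    fun_sum_mem _ _ fun k _ => Subalgebra.mul_mem _ (hu k) (fun_const_mem _ _), fun z => ?_, ?_⟩
  · rw [show (fun X => generalizedPower τ (symCong (entryMatrix z) X : Matrix (Fin m) (Fin m) ℂ))
      = ∑ k ∈ s, u k z • w k by ext X; simp [expansion], map_sum]
    simp only [map_smul, smul_eq_mul]
  · rw [show zonalMean τ = ∑ k ∈ s, (∫ z, u k z ∂(gaussianPi (Fin m × Fin m))) • w k by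
      ext X; simp [zonalMean, mean_eq], map_sum,
      integral_finsetSum _ fun k _ => (integrable_of_mem_polyFunctions (hu k)).mul_const _]
    simp only [integral_mul_const, map_smul, smul_eq_mul]

lemma eq_zero_of_eq_zero_of_det_ne_zero {P : (Fin m × Fin m → ℝ) → ℂ}
    (hP : P ∈ polyFunctions fun ij z => (z ij : ℂ)) (h : ∀ z, (entryMatrix z).det ≠ 0 → P z = 0) :
    P = 0 := by
  obtain ⟨p, hp⟩ := mem_polyFunctions.1 hP
  obtain ⟨q, hq⟩ := mem_polyFunctions.1 (fun_det_mem _ (entryMatrix_mem (m := m) (n := m)))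
  have hqp : q * p = 0 := mvPolynomial_ext_ofReal fun z => by
    rw [map_mul, map_zero, ← hp, ← hq, mul_eq_zero]
    exact or_iff_not_imp_left.2 (h z)
  have hq0 : q ≠ 0 := by
    rintro rfl
    have h1 : entryMatrix (fun ij : Fin m × Fin m => (1 : Matrix _ _ ℝ) ij.1 ij.2) = 1 := by
      ext i j
      simp [entryMatrix, Matrix.one_apply, apply_ite Complex.ofReal]
    simpa [h1] using hq fun ij => (1 : Matrix _ _ ℝ) ij.1 ij.2
  ext z
  rw [hp, (mul_eq_zero.1 hqp).resolve_left hq0, map_zero, Pi.zero_apply]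

/-- A linear functional vanishing on `V_τ` kills `X ↦ Δ_τ(Z X Zᵀ)` for invertible `Z`, hence, by
polynomiality in `Z`, for all `Z`, and so it kills the mean. -/
lemma zonalMean_mem_zonalSpace (τ : Fin m → ℕ) : zonalMean τ ∈ zonalSpace τ := by
  by_contra hcon
  obtain ⟨φ, hφ, hker⟩ := Submodule.exists_le_ker_of_notMem hcon
  obtain ⟨P, hP, hPφ, hint⟩ := exists_integral_eq_map_zonalMean τ φ
  refine hφ (hint.symm.trans ?_)
  rw [eq_zero_of_eq_zero_of_det_ne_zero hP fun z hz => ?_]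
  · exact integral_zero _ _
  let A : Matrix (Fin m) (Fin m) ℝ := Matrix.of fun i j => z (i, j)
  have hA : A.det ≠ 0 := fun hA => hz <| by
    rw [show entryMatrix z = Complex.ofRealHom.mapMatrix A from rfl, ← RingHom.map_det, hA,
      map_zero]
  rw [hPφ]
  exact hker (Submodule.subset_span ⟨Matrix.GeneralLinearGroup.mkOfDetNeZero A hA, rfl⟩)

lemma zonalMean_symCong_orthogonal (τ : Fin m → ℕ) {O : Matrix (Fin m) (Fin m) ℝ}
    (hO : O * Oᵀ = 1) (X : SymMat m) :
    zonalMean τ (symCong (O.map Complex.ofReal) X) = zonalMean τ X := by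
  rw [zonalMean, zonalMean, meanPower, meanPower,
    ← integral_mul_orthogonal hO fun Z : Matrix (Fin m) (Fin m) ℂ =>
      generalizedPower τ (symCong Z X : Matrix (Fin m) (Fin m) ℂ)]
  simp only [symCong_mul]

lemma exists_eval_eq_zonalMean (τ : Fin m → ℕ) :
    ∃ p : MvPolynomial (Fin m) ℂ, ∀ x, eval x p = zonalMean τ (symDiag x) := by
  have hmem : (fun x : Fin m → ℂ => zonalMean τ (symDiag x)) ∈ polyFunctions fun i x => x i :=
    fun_comp_mem _ (meanPower_mem_polyFunctions τ)
      (symDiag_mem _ (coord_mem_polyFunctions fun i (x : Fin m → ℂ) => x i))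
  obtain ⟨p, hp⟩ := mem_polyFunctions.1 hmem
  exact ⟨p, fun x => (hp x).symm⟩

/-- The symmetric polynomial giving `zonalMean τ` on diagonal matrices. -/
def zonalPoly (τ : Fin m → ℕ) : MvPolynomial (Fin m) ℂ := (exists_eval_eq_zonalMean τ).choose

lemma eval_zonalPoly (τ : Fin m → ℕ) (x : Fin m → ℂ) :
    eval x (zonalPoly τ) = zonalMean τ (symDiag x) :=
  (exists_eval_eq_zonalMean τ).choose_spec x

lemma zonalPoly_isSymmetric (τ : Fin m → ℕ) : (zonalPoly τ).IsSymmetric := by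
  intro π
  refine MvPolynomial.funext fun x => ?_
  let O : Matrix (Fin m) (Fin m) ℝ := π.permMatrix ℝ
  have hO : O * Oᵀ = 1 := by
    rw [Matrix.transpose_permMatrix, ← Matrix.permMatrix_mul, inv_mul_cancel, Matrix.permMatrix_one]
  rw [eval_rename, eval_zonalPoly, eval_zonalPoly, ← zonalMean_symCong_orthogonal τ hO (symDiag x)]
  refine congrArg (zonalMean τ) (Subtype.ext ?_)
  have hO_map : O.map Complex.ofReal = π.permMatrix ℂ :=
    PEquiv.map_toMatrix Complex.ofRealHom π.toPEquiv
  rw [coe_symCong, coe_symDiag, coe_symDiag, hO_map, Matrix.transpose_permMatrix,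
    PEquiv.toMatrix_toPEquiv_mul, PEquiv.mul_toMatrix_toPEquiv, Matrix.submatrix_submatrix]
  exact (Matrix.submatrix_diagonal_equiv x π).symm

/-! ### Homogeneity -/

lemma prod_range_prod_pow_sub {M : Type*} [CommMonoid M] {t : ℕ → ℕ} (ht : Antitone t) (x : ℕ → M)
    (r : ℕ) : (∏ k ∈ Finset.range r, x k) ^ t r *
      ∏ i ∈ Finset.range r, (∏ k ∈ Finset.range (i + 1), x k) ^ (t i - t (i + 1))
      = ∏ i ∈ Finset.range r, x i ^ t i := by
  induction r with
  | zero => simp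
  | succ r ih =>
    rw [Finset.prod_range_succ (fun i => (∏ k ∈ Finset.range (i + 1), x k) ^ (t i - t (i + 1))),
      mul_comm (∏ i ∈ Finset.range r, _), ← mul_assoc, ← pow_add,
      Nat.add_sub_cancel' (ht (Nat.le_succ r)), Finset.prod_range_succ, mul_pow, mul_right_comm, ih,
      Finset.prod_range_succ]

lemma prod_prod_castLE_pow {M : Type*} [CommMonoid M] {τ : Fin m → ℕ} (hτ : Antitone τ)
    (x : Fin m → M) :
    ∏ i : Fin m, (∏ k : Fin (i + 1), x (Fin.castLE (Nat.succ_le_of_lt i.isLt) k)) ^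
      (τ i - nextPart τ i) = ∏ i, x i ^ τ i := by
  let y (i : ℕ) : M := if h : i < m then x ⟨i, h⟩ else 1
  have y_coe (i : Fin m) : y i = x i := dif_pos i.2
  have telescope := prod_range_prod_pow_sub (antitone_extendPart hτ) y m
  rw [show extendPart τ m = 0 from dif_neg (lt_irrefl m), pow_zero, one_mul, Finset.prod_range,
    Finset.prod_range] at telescope
  convert telescope using 2 with i _ i _
  · rw [Finset.prod_range, extendPart_coe]
    congr 1
    exact Finset.prod_congr rfl fun k _ => (y_coe (Fin.castLE _ k)).symm
  · rw [extendPart_coe, y_coe]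

lemma generalizedPower_smul {τ : Fin m → ℕ} (hτ : Antitone τ) (c : ℂ)
    (M : Matrix (Fin m) (Fin m) ℂ) :
    generalizedPower τ (c • M) = c ^ (∑ i, τ i) * generalizedPower τ M := by
  rw [← Finset.prod_pow_eq_pow_sum, ← prod_prod_castLE_pow hτ, generalizedPower, generalizedPower,
    ← Finset.prod_mul_distrib]
  refine Finset.prod_congr rfl fun i _ => ?_
  rw [← mul_pow, leadingMinor, leadingMinor, Matrix.submatrix_smul, Pi.smul_apply, Pi.smul_apply,
    Matrix.det_smul, Finset.prod_const, Finset.card_univ]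

lemma zonalMean_smul {τ : Fin m → ℕ} (hτ : Antitone τ) (c : ℂ) (X : SymMat m) :
    zonalMean τ (c • X) = c ^ (∑ i, τ i) * zonalMean τ X := by
  rw [zonalMean, zonalMean, meanPower, meanPower, ← integral_const_mul]
  simp only [← generalizedPower_smul hτ, coe_symCong, Submodule.coe_smul, Matrix.mul_smul,
    Matrix.smul_mul]

lemma coeff_bind₁_C_mul_X {σ R : Type*} [CommSemiring R] (c : R) (p : MvPolynomial σ R)
    (α : σ →₀ ℕ) : (bind₁ (fun i => C c * X i) p).coeff α = c ^ α.degree * p.coeff α := by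
  classical
  induction p using MvPolynomial.induction_on' with
  | monomial β a =>
    have bind₁_eq : bind₁ (fun i => C c * X i) (monomial β a)
        = C (c ^ β.degree) * monomial β a := by
      rw [bind₁_monomial, monomial_eq (s := β) (a := a)]
      simp only [mul_pow, Finset.prod_mul_distrib, Finset.prod_pow_eq_pow_sum, map_pow,
        Finsupp.prod, Finsupp.degree_apply]
      ring
    rw [bind₁_eq, coeff_C_mul, coeff_monomial]
    split_ifs with h
    · rw [h]
    · simp
  | add p q hp hq => simp [hp, hq, mul_add]

lemma isHomogeneous_of_eval_two_mul {σ : Type*} {p : MvPolynomial σ ℂ} {t : ℕ}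
    (h : ∀ x : σ → ℂ, eval (fun i => 2 * x i) p = 2 ^ t * eval x p) : p.IsHomogeneous t := by
  have bind₁_eq : bind₁ (fun i => C 2 * X i) p = C (2 ^ t) * p := by
    refine MvPolynomial.funext fun x => ?_
    rw [map_mul, eval_C, ← h]
    simp only [eval, eval₂Hom_bind₁]
    simp
  intro α hα
  have coeff_eq := congrArg (coeff α) bind₁_eq
  rw [coeff_bind₁_C_mul_X, coeff_C_mul] at coeff_eq
  have pow_eq : (2 : ℕ) ^ α.degree = 2 ^ t := by exact_mod_cast mul_right_cancel₀ hα coeff_eq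
  rw [← Nat.pow_right_injective le_rfl pow_eq, Finsupp.degree_eq_weight_one]
  rfl

lemma zonalPoly_isHomogeneous {τ : Fin m → ℕ} (hτ : Antitone τ) :
    (zonalPoly τ).IsHomogeneous (∑ i, τ i) := by
  refine isHomogeneous_of_eval_two_mul fun x => ?_
  rw [eval_zonalPoly, eval_zonalPoly, ← zonalMean_smul hτ]
  refine congrArg (zonalMean τ) (Subtype.ext ?_)
  rw [coe_symDiag, Submodule.coe_smul, coe_symDiag, ← Matrix.diagonal_smul]
  rfl

/-! ### Functions of the eigenvalues -/

lemma card_roots_charpoly (X : Matrix (Fin m) (Fin m) ℂ) : X.charpoly.roots.card = m := by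
  rw [Polynomial.splits_iff_card_roots.1 (IsAlgClosed.splits _), Matrix.charpoly_natDegree_eq_dim,
    Fintype.card_fin]

lemma exists_roots_charpoly_eq_map (X : Matrix (Fin m) (Fin m) ℂ) :
    ∃ ev : Fin m → ℂ, X.charpoly.roots = Finset.univ.val.map ev := by
  obtain ⟨l, hl⟩ := Quot.exists_rep X.charpoly.roots
  obtain rfl : l.length = m := by
    rw [← card_roots_charpoly X, ← hl]
    rfl
  refine ⟨l.get, ?_⟩
  rw [← hl]
  simp

lemma roots_charpoly_diagonal (x : Fin m → ℂ) :
    (Matrix.diagonal x).charpoly.roots = Finset.univ.val.map x := by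
  rw [Matrix.charpoly_diagonal, Polynomial.roots_prod _ _
    (Finset.prod_ne_zero_iff.2 fun i _ => Polynomial.X_sub_C_ne_zero _)]
  simp

lemma charpoly_symCong_orthogonal {O : Matrix (Fin m) (Fin m) ℝ} (hO : O * Oᵀ = 1)
    (X : SymMat m) :
    (symCong (O.map Complex.ofReal) X : Matrix (Fin m) (Fin m) ℂ).charpoly
      = (X : Matrix (Fin m) (Fin m) ℂ).charpoly := by
  rw [coe_symCong, Matrix.charpoly_mul_comm, ← Matrix.mul_assoc,
    mul_eq_one_comm.1 (map_ofReal_mul_transpose_eq_one hO), Matrix.one_mul]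

/-- The `i`-th elementary symmetric polynomial of the eigenvalues (counted from `1`), read off the
characteristic polynomial. -/
def charpolyEsymm (X : SymMat m) (i : Fin m) : ℂ :=
  (-1) ^ ((i : ℕ) + 1) * (X : Matrix (Fin m) (Fin m) ℂ).charpoly.coeff (m - (i + 1))

lemma eval_esymm_eq_charpolyEsymm {X : SymMat m} {ev : Fin m → ℂ}
    (hev : (X : Matrix (Fin m) (Fin m) ℂ).charpoly.roots = Finset.univ.val.map ev) (i : Fin m) :
    eval ev (esymm (Fin m) ℂ (i + 1)) = charpolyEsymm X i := by
  have hdeg : (X : Matrix (Fin m) (Fin m) ℂ).charpoly.natDegree = m := by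
    rw [Matrix.charpoly_natDegree_eq_dim, Fintype.card_fin]
  have vieta := Polynomial.coeff_eq_esymm_roots_of_splits
    (IsAlgClosed.splits (X : Matrix (Fin m) (Fin m) ℂ).charpoly) (k := m - (i + 1))
    (by rw [hdeg]; omega)
  rw [hdeg, (Matrix.charpoly_monic _).leadingCoeff, one_mul,
    show m - (m - ((i : ℕ) + 1)) = i + 1 by omega, hev] at vieta
  rw [charpolyEsymm, vieta, ← mul_assoc, ← mul_pow, neg_one_mul, neg_neg, one_pow, one_mul]
  exact aeval_esymm_eq_multiset_esymm (Fin m) ℂ ((i : ℕ) + 1) ev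

lemma charpolyEsymm_mem_polyFunctions (i : Fin m) :
    (fun X => charpolyEsymm X i) ∈ polyFunctions (symCoord m) := by
  refine Subalgebra.mul_mem _ (fun_const_mem _ _) (mem_polyFunctions.2
    ⟨(Matrix.charpoly.univ ℂ (Fin m)).coeff (m - (i + 1)), fun X => ?_⟩)
  exact (Matrix.charpoly.univ_coeff_eval₂Hom (Fin m) (RingHom.id ℂ)
    (fun ij => symCoord m ij X) (m - (i + 1))).symm

lemma eval_comp_mem {σ Ω R : Type*} [CommSemiring R] (A : Subalgebra R (Ω → R))
    {y : Ω → σ → R} (hy : ∀ i, (fun ω => y ω i) ∈ A) (q : MvPolynomial σ R) :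
    (fun ω => eval (y ω) q) ∈ A := by
  simp only [eval_eq]
  exact fun_sum_mem A _ fun α _ => A.mul_mem (fun_const_mem A _)
    (fun_prod_mem A _ fun i _ => A.pow_mem (hy i) _)

lemma exists_eval_eq_eval_charpolyEsymm {p : MvPolynomial (Fin m) ℂ} (hp : p.IsSymmetric) :
    ∃ q : MvPolynomial (Fin m) ℂ, ∀ (X : SymMat m) (ev : Fin m → ℂ),
      (X : Matrix (Fin m) (Fin m) ℂ).charpoly.roots = Finset.univ.val.map ev →
      eval ev p = eval (charpolyEsymm X) q := by
  obtain ⟨q, hq⟩ := esymmAlgHom_surjective ℂ (σ := Fin m) (n := m) (by simp) ⟨p, hp⟩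
  have hpq : p = aeval (fun i : Fin m => esymm (Fin m) ℂ (i + 1)) q := by
    have := congrArg (symmetricSubalgebra (Fin m) ℂ).val hq
    rw [esymmAlgHom, ← AlgHom.comp_apply, comp_aeval] at this
    exact this.symm
  refine ⟨q, fun X ev hev => ?_⟩
  rw [hpq]
  clear hq hpq
  induction q using MvPolynomial.induction_on with
  | C a => simp
  | add q q' hq hq' => rw [map_add, map_add, map_add, hq, hq']
  | mul_X q i hq =>
    rw [map_mul, map_mul, map_mul, hq, aeval_X, eval_X, eval_esymm_eq_charpolyEsymm hev]

/-- Both sides are polynomial functions of `X`, so it suffices to compare them for real positive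
definite `X`, which are diagonalized by orthogonal matrices. -/
lemma eq_eval_eigenvalues {f : SymMat m → ℂ} (hf : f ∈ polyFunctions (symCoord m))
    (hinv : ∀ O : Matrix (Fin m) (Fin m) ℝ, O * Oᵀ = 1 → ∀ X,
      f (symCong (O.map Complex.ofReal) X) = f X)
    {p : MvPolynomial (Fin m) ℂ} (hp : p.IsSymmetric)
    (hfp : ∀ x, eval x p = f (symDiag x)) (X : SymMat m) {ev : Fin m → ℂ}
    (hev : (X : Matrix (Fin m) (Fin m) ℂ).charpoly.roots = Finset.univ.val.map ev) :
    f X = eval ev p := by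
  obtain ⟨q, hq⟩ := exists_eval_eq_eval_charpolyEsymm hp
  have difference_eq_zero : (fun X => f X - eval (charpolyEsymm X) q) = 0 := by
    refine eq_zero_of_eq_zero_on_posDef (Subalgebra.sub_mem _ hf
      (eval_comp_mem _ charpolyEsymm_mem_polyFunctions q)) fun O hO μ _ => ?_
    rw [hinv O hO, ← hfp, ← hq _ (fun i => (μ i : ℂ)), sub_self]
    rw [charpoly_symCong_orthogonal hO, coe_symDiag, roots_charpoly_diagonal]
  rw [hq X ev hev]
  exact sub_eq_zero.1 (congrFun difference_eq_zero X)

lemma zonalMean_eq_eval (τ : Fin m → ℕ) (X : SymMat m) {ev : Fin m → ℂ}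
    (hev : (X : Matrix (Fin m) (Fin m) ℂ).charpoly.roots = Finset.univ.val.map ev) :
    zonalMean τ X = eval ev (zonalPoly τ) :=
  eq_eval_eigenvalues (meanPower_mem_polyFunctions τ)
    (fun _ hO X => zonalMean_symCong_orthogonal τ hO X) (zonalPoly_isSymmetric τ)
    (eval_zonalPoly τ) X hev

end SymMat

/-! ### Dominance bounds and linear independence -/

section RealMean
variable {m : ℕ}

/-- The Cauchy–Binet weight of the columns `f` in the leading minor of index `i` of
`Z diag(x) Zᵀ`. The sum runs over all maps `f`, not only the increasing ones, whence the
factorial. -/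
def minorWeight (z : Fin m × Fin m → ℝ) (i : Fin m) (f : Fin (i + 1) → Fin m) : ℝ :=
  (Matrix.of fun a b => z (Fin.castLE (Nat.succ_le_of_lt i.isLt) a, f b) :
    Matrix (Fin (i + 1)) (Fin (i + 1)) ℝ).det ^ 2 / ((i : ℕ) + 1).factorial

lemma minorWeight_nonneg (z : Fin m × Fin m → ℝ) (i : Fin m) (f : Fin (i + 1) → Fin m) :
    0 ≤ minorWeight z i f := by
  unfold minorWeight; positivity

lemma minorWeight_eq_zero (z : Fin m × Fin m → ℝ) (i : Fin m) {f : Fin (i + 1) → Fin m}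
    (hf : ¬Function.Injective f) : minorWeight z i f = 0 := by
  simp only [Function.Injective, not_forall] at hf
  obtain ⟨a, b, hab, hne⟩ := hf
  rw [minorWeight, Matrix.det_zero_of_column_eq hne fun k => by simp [hab]]
  simp

lemma leadingMinor_eq_sum (z : Fin m × Fin m → ℝ) (x : Fin m → ℂ) (i : Fin m) :
    leadingMinor (symCong (entryMatrix z) (symDiag x) : Matrix (Fin m) (Fin m) ℂ) i
      = ∑ f : Fin (i + 1) → Fin m, (minorWeight z i f : ℂ) * ∏ k, x (f k) := by
  let A : Matrix (Fin (i + 1)) (Fin m) ℂ :=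
    (entryMatrix z).submatrix (Fin.castLE (Nat.succ_le_of_lt i.isLt)) id
  have minor_eq : leadingMinor (symCong (entryMatrix z) (symDiag x) : Matrix (Fin m) (Fin m) ℂ) i
      = (A * Matrix.diagonal x * Aᵀ).det := by
    rw [leadingMinor, coe_symCong, coe_symDiag]
    congr 1
  have cauchy_binet := factorial_mul_det_mul_diagonal_mul_transpose A x
  rw [Fintype.card_fin] at cauchy_binet
  have factorial_ne : ((((i : ℕ) + 1).factorial : ℕ) : ℂ) ≠ 0 :=
    Nat.cast_ne_zero.2 (Nat.factorial_ne_zero _)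
  rw [minor_eq, ← mul_right_inj' factorial_ne, cauchy_binet, Finset.mul_sum]
  refine Finset.sum_congr rfl fun f _ => ?_
  have det_eq : (A.submatrix id f).det = (((Matrix.of fun a b =>
      z (Fin.castLE (Nat.succ_le_of_lt i.isLt) a, f b) :
      Matrix (Fin (i + 1)) (Fin (i + 1)) ℝ).det : ℝ) : ℂ) :=
    (RingHom.map_det Complex.ofRealHom (Matrix.of fun a b =>
      z (Fin.castLE (Nat.succ_le_of_lt i.isLt) a, f b))).symm
  rw [det_eq, minorWeight]
  push_cast
  field_simp

/-- The real number `Δ_τ(Z diag(x) Zᵀ)` for real `x`, expanded by the Cauchy–Binet formula. -/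
def realPower (τ : Fin m → ℕ) (z : Fin m × Fin m → ℝ) (x : Fin m → ℝ) : ℝ :=
  ∏ i : Fin m, (∑ f : Fin (i + 1) → Fin m, minorWeight z i f * ∏ k, x (f k)) ^
    (τ i - nextPart τ i)

lemma generalizedPower_eq_realPower (τ : Fin m → ℕ) (z : Fin m × Fin m → ℝ) (x : Fin m → ℝ) :
    generalizedPower τ
        (symCong (entryMatrix z) (symDiag fun i => (x i : ℂ)) : Matrix (Fin m) (Fin m) ℂ)
      = (realPower τ z x : ℂ) := by
  simp only [generalizedPower, leadingMinor_eq_sum, realPower]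
  push_cast
  rfl

lemma norm_generalizedPower_le (τ : Fin m → ℕ) (z : Fin m × Fin m → ℝ) (x : Fin m → ℂ) :
    ‖generalizedPower τ (symCong (entryMatrix z) (symDiag x) : Matrix (Fin m) (Fin m) ℂ)‖
      ≤ realPower τ z fun i => ‖x i‖ := by
  simp only [generalizedPower, leadingMinor_eq_sum, realPower, norm_prod, norm_pow]
  refine Finset.prod_le_prod (fun i _ => by positivity) fun i _ => ?_
  refine pow_le_pow_left₀ (norm_nonneg _) ?_ _
  refine (norm_sum_le _ _).trans (Finset.sum_le_sum fun f _ => ?_)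
  rw [norm_mul, norm_prod, Complex.norm_real, Real.norm_of_nonneg (minorWeight_nonneg z i f)]

lemma minorWeight_mul_prod_nonneg (z : Fin m × Fin m → ℝ) {x : Fin m → ℝ} (hx : ∀ i, 0 ≤ x i)
    (i : Fin m) (f : Fin (i + 1) → Fin m) : 0 ≤ minorWeight z i f * ∏ k, x (f k) :=
  mul_nonneg (minorWeight_nonneg z i f) (Finset.prod_nonneg fun _ _ => hx _)

lemma realPower_nonneg (τ : Fin m → ℕ) (z : Fin m × Fin m → ℝ) {x : Fin m → ℝ}
    (hx : ∀ i, 0 ≤ x i) : 0 ≤ realPower τ z x :=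
  Finset.prod_nonneg fun i _ =>
    pow_nonneg (Finset.sum_nonneg fun f _ => minorWeight_mul_prod_nonneg z hx i f) _

lemma integrable_realPower (τ : Fin m → ℕ) (x : Fin m → ℝ) :
    Integrable (fun z => realPower τ z x) (gaussianPi (Fin m × Fin m)) := by
  have integrable_ofReal : Integrable (fun z : Fin m × Fin m → ℝ => generalizedPower τ
      (symCong (entryMatrix z) (symDiag fun i => (x i : ℂ)) : Matrix (Fin m) (Fin m) ℂ))
      (gaussianPi (Fin m × Fin m)) :=
    integrable_of_mem_polyFunctions (fun_generalizedPower_mem _ τ (symCong_entryMatrix_mem _))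
  simp only [generalizedPower_eq_realPower] at integrable_ofReal
  simpa using integrable_ofReal.re

/-- The value of `zonalMean τ` at the real diagonal matrix with diagonal `x`. -/
def realMean (τ : Fin m → ℕ) (x : Fin m → ℝ) : ℝ :=
  ∫ z, realPower τ z x ∂(gaussianPi (Fin m × Fin m))

lemma zonalMean_ofReal (τ : Fin m → ℕ) (x : Fin m → ℝ) :
    zonalMean τ (symDiag fun i => (x i : ℂ)) = (realMean τ x : ℂ) := by
  rw [zonalMean, meanPower, realMean, ← integral_complex_ofReal]
  simp only [generalizedPower_eq_realPower]

lemma norm_zonalMean_le (τ : Fin m → ℕ) (x : Fin m → ℂ) :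
    ‖zonalMean τ (symDiag x)‖ ≤ realMean τ fun i => ‖x i‖ := by
  rw [zonalMean, meanPower, realMean]
  exact norm_integral_le_of_norm_le (integrable_realPower τ _)
    (ae_of_all _ fun z => norm_generalizedPower_le τ z x)

lemma eval_zonalPoly_ofReal (τ : Fin m → ℕ) (x : Fin m → ℝ) :
    eval (fun i => (x i : ℂ)) (zonalPoly τ) = (realMean τ x : ℂ) := by
  rw [eval_zonalPoly, zonalMean_ofReal]

lemma realMean_nonneg (τ : Fin m → ℕ) {x : Fin m → ℝ} (hx : ∀ i, 0 ≤ x i) : 0 ≤ realMean τ x :=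
  integral_nonneg fun z => realPower_nonneg τ z hx

lemma coe_le_coe_of_strictMono {r : ℕ} {e : Fin r → Fin m} (he : StrictMono e) (k : Fin r) :
    (k : ℕ) ≤ e k := by
  have card_le := Finset.card_le_card_of_injOn (s := Finset.Iio k) (t := Finset.Iio (e k)) e
    (fun j hj => by simpa using he (by simpa using hj)) he.injective.injOn
  simpa using card_le

lemma prod_le_prod_castLE {r : ℕ} (hr : r ≤ m) {x : Fin m → ℝ} (hx : Antitone x)
    (hx0 : ∀ i, 0 ≤ x i) {f : Fin r → Fin m} (hf : Function.Injective f) :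
    ∏ k, x (f k) ≤ ∏ k, x (Fin.castLE hr k) := by
  classical
  let s : Finset (Fin m) := Finset.univ.image f
  have card_s : s.card = r := by rw [Finset.card_image_of_injective _ hf]; simp
  calc ∏ k, x (f k) = ∏ j ∈ s, x j := (Finset.prod_image fun a _ b _ h => hf h).symm
    _ = ∏ k, x (s.orderEmbOfFin card_s k) := by
      conv_lhs => rw [← Finset.image_orderEmbOfFin_univ s card_s]
      exact Finset.prod_image fun a _ b _ h => (s.orderEmbOfFin card_s).injective h
    _ ≤ ∏ k, x (Fin.castLE hr k) := Finset.prod_le_prod (fun k _ => hx0 _) fun k _ =>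
      hx (coe_le_coe_of_strictMono (s.orderEmbOfFin card_s).strictMono k)

lemma realPower_le {τ : Fin m → ℕ} (hτ : Antitone τ) (z : Fin m × Fin m → ℝ) {x : Fin m → ℝ}
    (hx : Antitone x) (hx0 : ∀ i, 0 ≤ x i) :
    realPower τ z x ≤ realPower τ z (fun _ => 1) * ∏ i, x i ^ τ i := by
  rw [← prod_prod_castLE_pow hτ, realPower, realPower, ← Finset.prod_mul_distrib]
  have sum_nonneg (i : Fin m) :
      0 ≤ ∑ f : Fin (i + 1) → Fin m, minorWeight z i f * ∏ k, x (f k) :=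
    Finset.sum_nonneg fun f _ => minorWeight_mul_prod_nonneg z hx0 i f
  refine Finset.prod_le_prod (fun i _ => pow_nonneg (sum_nonneg i) _) fun i _ => ?_
  rw [← mul_pow]
  refine pow_le_pow_left₀ (sum_nonneg i) ?_ _
  rw [Finset.sum_mul]
  refine Finset.sum_le_sum fun f _ => ?_
  rw [Finset.prod_const_one, mul_one]
  by_cases hf : Function.Injective f
  · exact mul_le_mul_of_nonneg_left (prod_le_prod_castLE _ hx hx0 hf) (minorWeight_nonneg z i f)
  · simp [minorWeight_eq_zero z i hf]

/-- The coefficient of the dominant monomial `∏ xᵢ ^ τᵢ` in `realPower τ z x`. -/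
def leadPower (τ : Fin m → ℕ) (z : Fin m × Fin m → ℝ) : ℝ :=
  ∏ i : Fin m, minorWeight z i (Fin.castLE (Nat.succ_le_of_lt i.isLt)) ^ (τ i - nextPart τ i)

lemma leadPower_nonneg (τ : Fin m → ℕ) (z : Fin m × Fin m → ℝ) : 0 ≤ leadPower τ z :=
  Finset.prod_nonneg fun i _ => pow_nonneg (minorWeight_nonneg z i _) _

lemma leadPower_mul_le_realPower {τ : Fin m → ℕ} (hτ : Antitone τ) (z : Fin m × Fin m → ℝ)
    {x : Fin m → ℝ} (hx : ∀ i, 0 ≤ x i) :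
    leadPower τ z * ∏ i, x i ^ τ i ≤ realPower τ z x := by
  rw [← prod_prod_castLE_pow hτ, realPower, leadPower, ← Finset.prod_mul_distrib]
  refine Finset.prod_le_prod (fun i _ => ?_) fun i _ => ?_
  · rw [← mul_pow]
    exact pow_nonneg (minorWeight_mul_prod_nonneg z hx i _) _
  rw [← mul_pow]
  refine pow_le_pow_left₀ (minorWeight_mul_prod_nonneg z hx i _) ?_ _
  exact Finset.single_le_sum (f := fun f => minorWeight z i f * ∏ k, x (f k))
    (fun f _ => minorWeight_mul_prod_nonneg z hx i f)
    (Finset.mem_univ (Fin.castLE (Nat.succ_le_of_lt i.isLt)))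

lemma continuous_leadPower (τ : Fin m → ℕ) : Continuous (leadPower τ) := by
  unfold leadPower minorWeight
  refine continuous_finsetProd _ fun i _ => ((Continuous.pow ?_ _).div_const _).pow _
  exact Continuous.matrix_det (continuous_matrix fun a b => continuous_apply _)

lemma integrable_leadPower {τ : Fin m → ℕ} (hτ : Antitone τ) :
    Integrable (leadPower τ) (gaussianPi (Fin m × Fin m)) := by
  refine (integrable_realPower τ fun _ => 1).mono'
    (continuous_leadPower τ).aestronglyMeasurable (ae_of_all _ fun z => ?_)
  rw [Real.norm_of_nonneg (leadPower_nonneg τ z)]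
  simpa using leadPower_mul_le_realPower hτ z (x := fun _ => 1) fun _ => zero_le_one

lemma integral_leadPower_pos {τ : Fin m → ℕ} (hτ : Antitone τ) :
    0 < ∫ z, leadPower τ z ∂(gaussianPi (Fin m × Fin m)) := by
  refine integral_pos_of_integrable_nonneg_nonzero (continuous_leadPower τ)
    (integrable_leadPower hτ) (leadPower_nonneg τ) (x := fun ij => if ij.1 = ij.2 then 1 else 0) ?_
  refine Finset.prod_ne_zero_iff.2 fun i _ => pow_ne_zero _ ?_
  have block_eq_one : (Matrix.of fun a b => if Fin.castLE (Nat.succ_le_of_lt i.isLt) a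
      = Fin.castLE (Nat.succ_le_of_lt i.isLt) b then (1 : ℝ) else 0 :
      Matrix (Fin (i + 1)) (Fin (i + 1)) ℝ) = 1 := by
    ext a b
    simp [Matrix.one_apply]
  rw [minorWeight, block_eq_one, Matrix.det_one]
  positivity

lemma realMean_le {τ : Fin m → ℕ} (hτ : Antitone τ) {x : Fin m → ℝ} (hx : Antitone x)
    (hx0 : ∀ i, 0 ≤ x i) : realMean τ x ≤ realMean τ (fun _ => 1) * ∏ i, x i ^ τ i := by
  rw [realMean, realMean, ← integral_mul_const]
  exact integral_mono (integrable_realPower τ x) ((integrable_realPower τ _).mul_const _)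
    fun z => realPower_le hτ z hx hx0

lemma integral_leadPower_mul_le_realMean {τ : Fin m → ℕ} (hτ : Antitone τ) {x : Fin m → ℝ}
    (hx : ∀ i, 0 ≤ x i) :
    (∫ z, leadPower τ z ∂(gaussianPi (Fin m × Fin m))) * ∏ i, x i ^ τ i ≤ realMean τ x := by
  rw [realMean, ← integral_mul_const]
  exact integral_mono ((integrable_leadPower hτ).mul_const _) (integrable_realPower τ x)
    fun z => leadPower_mul_le_realPower hτ z hx

end RealMean

section LexWeight
open Asymptotics Filter
variable {m t : ℕ} {τ σ : Fin m → ℕ}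

lemma mem_partitions : τ ∈ partitions m t ↔ ∑ i, τ i = t ∧ Antitone τ := by
  classical
  simp [partitions]

/-- The number with digits `τ 0, τ 1, …` in base `t + 1`, most significant digit first: it orders
the partitions of `t` lexicographically. -/
def lexWeight (t : ℕ) (τ : Fin m → ℕ) : ℕ := ∑ i, τ i * (t + 1) ^ (i.rev : ℕ)

lemma lexWeight_injOn (m t : ℕ) : Set.InjOn (lexWeight t) (partitions m t : Set (Fin m → ℕ)) := by
  intro τ hτ σ hσ h
  have digit_lt {τ : Fin m → ℕ} (hτ : τ ∈ partitions m t) (i : Fin m) : τ i < t + 1 := by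
    rw [← (mem_partitions.1 hτ).1]
    exact Nat.lt_succ_of_le (Finset.single_le_sum (fun _ _ => Nat.zero_le _) (Finset.mem_univ i))
  have lexWeight_eq {τ : Fin m → ℕ} (hτ : τ ∈ partitions m t) : lexWeight t τ
      = (finFunctionFinEquiv fun j : Fin m => (⟨τ j.rev, digit_lt hτ _⟩ : Fin (t + 1)) : ℕ) := by
    rw [finFunctionFinEquiv_apply, lexWeight, ← Equiv.sum_comp Fin.revPerm]
    simp
  have digits_eq := finFunctionFinEquiv.injective
    (Fin.ext ((lexWeight_eq hτ).symm.trans (h.trans (lexWeight_eq hσ))))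
  ext i
  simpa using congrArg Fin.val (congrFun digits_eq i.rev)

/-- The point at which the monomial of exponent `τ` takes the value `s ^ lexWeight t τ`. -/
def lexPoint (t : ℕ) (s : ℝ) (i : Fin m) : ℝ := s ^ ((t + 1) ^ (i.rev : ℕ))

lemma lexPoint_pos {s : ℝ} (hs : 0 < s) (i : Fin m) : 0 < lexPoint t s i := pow_pos hs _

lemma antitone_lexPoint {s : ℝ} (hs : 1 ≤ s) : Antitone (lexPoint (m := m) t s) := fun _ _ hij =>
  pow_le_pow_right₀ hs (Nat.pow_le_pow_right (Nat.succ_pos t) (Fin.rev_le_rev.2 hij))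

lemma prod_lexPoint_pow (t : ℕ) (s : ℝ) (τ : Fin m → ℕ) :
    ∏ i, lexPoint t s i ^ τ i = s ^ lexWeight t τ := by
  rw [lexWeight, ← Finset.prod_pow_eq_pow_sum]
  exact Finset.prod_congr rfl fun i _ => by rw [lexPoint, ← pow_mul, mul_comm]

lemma realMean_lexPoint_isBigO (hτ : Antitone τ) :
    (fun s => realMean τ (lexPoint t s)) =O[atTop] fun s => s ^ lexWeight t τ := by
  refine IsBigO.of_bound (realMean τ fun _ => 1) ?_
  filter_upwards [eventually_ge_atTop 1] with s hs
  have hs0 : 0 < s := zero_lt_one.trans_le hs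
  rw [Real.norm_of_nonneg (realMean_nonneg τ fun i => (lexPoint_pos hs0 i).le),
    Real.norm_of_nonneg (pow_nonneg hs0.le _), ← prod_lexPoint_pow]
  exact realMean_le hτ (antitone_lexPoint hs) fun i => (lexPoint_pos hs0 i).le

lemma isBigO_realMean_lexPoint (hτ : Antitone τ) :
    (fun s => s ^ lexWeight t τ) =O[atTop] fun s => realMean τ (lexPoint t s) := by
  refine IsBigO.of_bound (∫ z, leadPower τ z ∂(gaussianPi (Fin m × Fin m)))⁻¹ ?_
  filter_upwards [eventually_gt_atTop 0] with s hs
  rw [Real.norm_of_nonneg (realMean_nonneg τ fun i => (lexPoint_pos hs i).le),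
    Real.norm_of_nonneg (pow_nonneg hs.le _), ← prod_lexPoint_pow,
    le_inv_mul_iff₀ (integral_leadPower_pos hτ)]
  exact integral_leadPower_mul_le_realMean hτ fun i => (lexPoint_pos hs i).le

lemma realMean_lexPoint_isLittleO (hσ : Antitone σ) (hτ : Antitone τ)
    (h : lexWeight t σ < lexWeight t τ) :
    (fun s => realMean σ (lexPoint t s)) =o[atTop] fun s => realMean τ (lexPoint t s) :=
  ((realMean_lexPoint_isBigO hσ).trans_isLittleO (isLittleO_pow_pow_atTop_of_lt h)).trans_isBigO
    (isBigO_realMean_lexPoint hτ)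

/-- Along `lexPoint`, the term of largest weight would dominate all the others. -/
lemma eq_zero_of_sum_realMean (k : (Fin m → ℕ) → ℂ)
    (h : ∀ x : Fin m → ℝ, (∀ i, 0 < x i) → ∑ τ ∈ partitions m t, k τ * (realMean τ x : ℂ) = 0) :
    ∀ τ ∈ partitions m t, k τ = 0 := by
  classical
  by_contra! hk
  obtain ⟨τ₀, hτ₀, hkτ₀⟩ := hk
  obtain ⟨τ, hτ_mem, hmax⟩ := Finset.exists_max_image ((partitions m t).filter fun τ => k τ ≠ 0)
    (lexWeight t) ⟨τ₀, Finset.mem_filter.2 ⟨hτ₀, hkτ₀⟩⟩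
  obtain ⟨hτ, hkτ⟩ := Finset.mem_filter.1 hτ_mem
  have antitone_of_mem {σ : Fin m → ℕ} (hσ : σ ∈ partitions m t) : Antitone σ :=
    (mem_partitions.1 hσ).2
  have others_isLittleO : (fun s => ∑ σ ∈ (partitions m t).erase τ,
      k σ * (realMean σ (lexPoint t s) : ℂ)) =o[atTop] fun s => realMean τ (lexPoint t s) := by
    refine IsLittleO.fun_sum fun σ hσ => ?_
    obtain ⟨hne, hσ⟩ := Finset.mem_erase.1 hσ
    by_cases hkσ : k σ = 0
    · simp [hkσ]
    have weight_lt : lexWeight t σ < lexWeight t τ :=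
      (hmax σ (Finset.mem_filter.2 ⟨hσ, hkσ⟩)).lt_of_ne fun heq =>
        hne (lexWeight_injOn m t hσ hτ heq)
    exact (Complex.isLittleO_ofReal_left.2 (realMean_lexPoint_isLittleO (antitone_of_mem hσ)
      (antitone_of_mem hτ) weight_lt)).const_mul_left _
  have term_isLittleO : (fun s => k τ * (realMean τ (lexPoint t s) : ℂ))
      =o[atTop] fun s => realMean τ (lexPoint t s) := by
    refine others_isLittleO.neg_left.congr' ?_ .rfl
    filter_upwards [eventually_gt_atTop 0] with s hs
    have sum_eq := h _ (lexPoint_pos (t := t) hs)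
    rw [← Finset.add_sum_erase _ _ hτ] at sum_eq
    exact (eq_neg_of_add_eq_zero_left sum_eq).symm
  rw [isLittleO_const_mul_left_iff hkτ, Complex.isLittleO_ofReal_left] at term_isLittleO
  refine isLittleO_irrefl (Eventually.frequently ?_) term_isLittleO
  filter_upwards [eventually_gt_atTop 0] with s hs
  refine ne_of_gt (lt_of_lt_of_le ?_ (integral_leadPower_mul_le_realMean (antitone_of_mem hτ)
    fun i => (lexPoint_pos hs i).le))
  exact mul_pos (integral_leadPower_pos (antitone_of_mem hτ))
    (Finset.prod_pos fun i _ => pow_pos (lexPoint_pos hs i) _)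

end LexWeight

/-! ### Zonal polynomials as Gaussian means -/

section Basis
variable {m t : ℕ}

lemma linearIndepOn_zonalPoly (m t : ℕ) :
    LinearIndepOn ℂ (zonalPoly (m := m)) (partitions m t : Set (Fin m → ℕ)) := by
  refine linearIndepOn_finset_iff.2 fun k hk => eq_zero_of_sum_realMean k fun x _ => ?_
  simpa [smul_eval, eval_zonalPoly_ofReal] using congrArg (eval fun i => (x i : ℂ)) hk

/-- The space of symmetric polynomials in `m` variables that are homogeneous of degree `t`. -/
def symmetricHomogeneous (m t : ℕ) : Submodule ℂ (MvPolynomial (Fin m) ℂ) :=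
  Subalgebra.toSubmodule (symmetricSubalgebra (Fin m) ℂ) ⊓ homogeneousSubmodule (Fin m) ℂ t

lemma mem_symmetricHomogeneous {p : MvPolynomial (Fin m) ℂ} :
    p ∈ symmetricHomogeneous m t ↔ p.IsSymmetric ∧ p.IsHomogeneous t := Iff.rfl

lemma zonalPoly_mem_symmetricHomogeneous {τ : Fin m → ℕ} (hτ : τ ∈ partitions m t) :
    zonalPoly τ ∈ symmetricHomogeneous m t := by
  obtain ⟨rfl, hanti⟩ := mem_partitions.1 hτ
  exact mem_symmetricHomogeneous.2 ⟨zonalPoly_isSymmetric τ, zonalPoly_isHomogeneous hanti⟩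

lemma eq_zero_of_coeff_partitions {p : MvPolynomial (Fin m) ℂ} (hp : p ∈ symmetricHomogeneous m t)
    (h : ∀ τ ∈ partitions m t, p.coeff (Finsupp.equivFunOnFinite.symm τ) = 0) : p = 0 := by
  obtain ⟨hsymm, hhom⟩ := mem_symmetricHomogeneous.1 hp
  ext α
  rw [coeff_zero]
  by_contra hα
  have degree_eq : ∑ i, α i = t := by
    rw [← hhom hα]
    simp [Finsupp.weight_apply, Finsupp.sum_fintype]
  let π : Equiv.Perm (Fin m) := Fin.revPerm.trans (Tuple.sort α)
  have hanti : Antitone (fun i => α (π i)) := fun i j hij =>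
    Tuple.monotone_sort α (Fin.rev_le_rev.2 hij)
  have hmem : (fun i => α (π i)) ∈ partitions m t :=
    mem_partitions.2 ⟨degree_eq ▸ Equiv.sum_comp π α, hanti⟩
  have coeff_sort := coeff_rename_mapDomain π.symm π.symm.injective p α
  have mapDomain_eq : Finsupp.mapDomain π.symm α
      = Finsupp.equivFunOnFinite.symm fun i => α (π i) := by
    ext i
    rw [Finsupp.mapDomain_equiv_apply]
    rfl
  rw [hsymm π.symm, mapDomain_eq, h _ hmem] at coeff_sort
  exact hα coeff_sort.symm

/-- A symmetric polynomial is determined by its coefficients at partitions, so there is no room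
for more than the `zonalPoly τ`. -/
lemma exists_eq_sum_zonalPoly {p : MvPolynomial (Fin m) ℂ} (hp : p ∈ symmetricHomogeneous m t) :
    ∃ k : (Fin m → ℕ) → ℂ, p = ∑ τ ∈ partitions m t, k τ • zonalPoly τ := by
  classical
  let coeffs : symmetricHomogeneous m t →ₗ[ℂ] (partitions m t → ℂ) :=
    (LinearMap.pi fun τ => lcoeff ℂ (Finsupp.equivFunOnFinite.symm τ.1)).comp
      (symmetricHomogeneous m t).subtype
  have coeffs_injective : Function.Injective coeffs := by
    refine (injective_iff_map_eq_zero _).2 fun q hq => Subtype.ext ?_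
    exact eq_zero_of_coeff_partitions q.2 fun τ hτ => congrFun hq ⟨τ, hτ⟩
  have := Module.Finite.of_injective coeffs coeffs_injective
  let basis (τ : partitions m t) : symmetricHomogeneous m t :=
    ⟨zonalPoly τ.1, zonalPoly_mem_symmetricHomogeneous τ.2⟩
  have basis_indep : LinearIndependent ℂ basis :=
    .of_comp (symmetricHomogeneous m t).subtype (linearIndepOn_zonalPoly m t)
  have card_eq : Fintype.card (partitions m t) = Module.finrank ℂ (symmetricHomogeneous m t) :=
    basis_indep.fintype_card_le_finrank.antisymm
      (by simpa using LinearMap.finrank_le_finrank_of_injective coeffs_injective)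
  have hspan : (⟨p, hp⟩ : symmetricHomogeneous m t) ∈ Submodule.span ℂ (Set.range basis) := by
    rw [basis_indep.span_eq_top_of_card_eq_finrank' card_eq]
    exact Submodule.mem_top
  obtain ⟨k, hk⟩ := (Submodule.mem_span_range_iff_exists_fun ℂ).1 hspan
  refine ⟨fun τ => if h : τ ∈ partitions m t then k ⟨τ, h⟩ else 0, ?_⟩
  have p_eq : p = ∑ τ, k τ • zonalPoly τ.1 := by
    simpa [basis] using (congrArg (symmetricHomogeneous m t).subtype hk).symm
  rw [← Finset.sum_coe_sort, p_eq]
  refine Finset.sum_congr rfl fun τ _ => ?_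
  simp only [dif_pos τ.2]

lemma psum_one_isHomogeneous (m : ℕ) : (psum (Fin m) ℂ 1).IsHomogeneous 1 := by
  rw [psum_one]
  exact .sum _ _ _ fun i _ => isHomogeneous_X ℂ i

lemma psum_one_pow_mem_symmetricHomogeneous (m t : ℕ) :
    psum (Fin m) ℂ 1 ^ t ∈ symmetricHomogeneous m t :=
  mem_symmetricHomogeneous.2
    ⟨Subalgebra.pow_mem (symmetricSubalgebra (Fin m) ℂ) (psum_isSymmetric _ _ 1) t,
      by simpa using (psum_one_isHomogeneous m).pow t⟩

lemma eval_psum_one (x : Fin m → ℂ) : eval x (psum (Fin m) ℂ 1) = ∑ i, x i := by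
  simp [psum_one]

/-- The coefficients of `(x₁ + ⋯ + x_m) ^ t` in the basis `zonalPoly`. -/
def traceCoeff (m t : ℕ) : (Fin m → ℕ) → ℂ :=
  (exists_eq_sum_zonalPoly (psum_one_pow_mem_symmetricHomogeneous m t)).choose

lemma psum_one_pow_eq_sum (m t : ℕ) : psum (Fin m) ℂ 1 ^ t
    = ∑ τ ∈ partitions m t, traceCoeff m t τ • zonalPoly τ :=
  (exists_eq_sum_zonalPoly (psum_one_pow_mem_symmetricHomogeneous m t)).choose_spec

lemma trace_eq_sum_eigenvalues {X : Matrix (Fin m) (Fin m) ℂ} {ev : Fin m → ℂ}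
    (hev : X.charpoly.roots = Finset.univ.val.map ev) : X.trace = ∑ i, ev i := by
  rw [Matrix.trace_eq_sum_roots_charpoly_of_splits (IsAlgClosed.splits _), hev]
  rfl

lemma sum_traceCoeff_mul_zonalMean (t : ℕ) (X : SymMat m) :
    ∑ τ ∈ partitions m t, traceCoeff m t τ * zonalMean τ X
      = (X : Matrix (Fin m) (Fin m) ℂ).trace ^ t := by
  obtain ⟨ev, hev⟩ := exists_roots_charpoly_eq_map (X : Matrix (Fin m) (Fin m) ℂ)
  rw [trace_eq_sum_eigenvalues hev, ← eval_psum_one, ← map_pow, psum_one_pow_eq_sum, map_sum]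
  refine Finset.sum_congr rfl fun τ _ => ?_
  rw [smul_eval, zonalMean_eq_eval τ X hev]

lemma isZonalDecomposition_traceCoeff (m t : ℕ) :
    IsZonalDecomposition m t fun τ X => traceCoeff m t τ * zonalMean τ X :=
  ⟨fun τ _ => Submodule.smul_mem _ _ (zonalMean_mem_zonalSpace τ),
    fun X => sum_traceCoeff_mul_zonalMean t X⟩

/-- Gaussian averaging acts on `V_τ` as multiplication by `realMean τ x`, and these multipliers are
linearly independent functions of `x`. -/
lemma eq_zero_of_sum_zonalSpace {D : (Fin m → ℕ) → SymMat m → ℂ}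
    (hD : ∀ τ ∈ partitions m t, D τ ∈ zonalSpace τ)
    (h : ∀ X, ∑ τ ∈ partitions m t, D τ X = 0) : ∀ τ ∈ partitions m t, D τ = 0 := by
  intro τ hτ
  refine eq_zero_of_eq_zero_on_posDef (mem_polyFunctions_of_mem_zonalSpace (hD τ hτ))
    fun O hO μ hμ => ?_
  obtain ⟨L, hL⟩ := exists_symCong_one_eq hO hμ
  rw [← hL]
  refine eq_zero_of_sum_realMean (t := t)
    (fun τ => D τ (symCong (L.1.map Complex.ofReal) (symDiag 1))) (fun x _ => ?_) τ hτ
  have averaged (σ) (hσ : σ ∈ partitions m t) :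
      D σ (symCong (L.1.map Complex.ofReal) (symDiag 1)) * (realMean σ x : ℂ)
        = ∫ z, D σ (symCong (L.1.map Complex.ofReal)
            (symCong (entryMatrix z) (symDiag fun i => (x i : ℂ))))
          ∂(gaussianPi (Fin m × Fin m)) := by
    rw [integral_symCong_of_mem_zonalSpace (hD σ hσ), ← zonalMean_ofReal]
    rfl
  rw [Finset.sum_congr rfl averaged, ← integral_finsetSum _ fun σ hσ =>
    integrable_comp_symCong (mem_polyFunctions_of_mem_zonalSpace (hD σ hσ)) _ _]
  simp only [h, integral_zero]

lemma isZonalDecomposition_unique {C C' : (Fin m → ℕ) → SymMat m → ℂ}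
    (hC : IsZonalDecomposition m t C) (hC' : IsZonalDecomposition m t C') :
    ∀ τ ∈ partitions m t, C τ = C' τ := fun τ hτ =>
  sub_eq_zero.1 (eq_zero_of_sum_zonalSpace (D := fun τ => C τ - C' τ)
    (fun τ hτ => Submodule.sub_mem _ (hC.1 τ hτ) (hC'.1 τ hτ))
    (fun X => by simp [Finset.sum_sub_distrib, hC.2 X, hC'.2 X]) τ hτ)

lemma zonal_eq_traceCoeff_mul_zonalMean {τ : Fin m → ℕ} (hτ : τ ∈ partitions m t) (X : SymMat m) :
    zonal τ X = traceCoeff m t τ * zonalMean τ X := by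
  obtain ⟨rfl, -⟩ := mem_partitions.1 hτ
  have hex : ∃ C, IsZonalDecomposition m (∑ i, τ i) C := ⟨_, isZonalDecomposition_traceCoeff m _⟩
  rw [zonal, dif_pos hex]
  exact congrFun (isZonalDecomposition_unique hex.choose_spec
    (isZonalDecomposition_traceCoeff m _) τ hτ) X

end Basis

section Positivity
variable {m t : ℕ}

/-- The mean of a product of entries of `Z diag(x) Zᵀ`, the positions of the entries being
listed by `w`. -/
def entryMean (w : Fin t → Fin m × Fin m) (x : Fin m → ℝ) : ℝ :=
  ∫ z : Fin m × Fin m → ℝ, ∏ s, ∑ k, z ((w s).1, k) * x k * z ((w s).2, k)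
    ∂(gaussianPi (Fin m × Fin m))

lemma integral_prod_symCong_entryMatrix (w : Fin t → Fin m × Fin m) (x : Fin m → ℝ) :
    ∫ z, ∏ s, (symCong (entryMatrix z) (symDiag fun i => (x i : ℂ)) : Matrix (Fin m) (Fin m) ℂ)
      (w s).1 (w s).2 ∂(gaussianPi (Fin m × Fin m)) = (entryMean w x : ℂ) := by
  rw [entryMean, ← integral_complex_ofReal]
  refine integral_congr_ae (ae_of_all _ fun z => ?_)
  simp [coe_symCong, coe_symDiag, Matrix.mul_apply, entryMatrix, Matrix.diagonal_apply]

lemma trace_symCong_symCong (L Z : Matrix (Fin m) (Fin m) ℂ) (M N : SymMat m)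
    (hM : (M : Matrix (Fin m) (Fin m) ℂ) = Lᵀ * L) :
    (symCong L (symCong Z N) : Matrix (Fin m) (Fin m) ℂ).trace
      = ∑ ij : Fin m × Fin m, (symCong Zᵀ M : Matrix (Fin m) (Fin m) ℂ) ij.1 ij.2 *
        (N : Matrix (Fin m) (Fin m) ℂ) ij.1 ij.2 := by
  have hN : (N : Matrix (Fin m) (Fin m) ℂ)ᵀ = N := N.2
  calc (symCong L (symCong Z N) : Matrix (Fin m) (Fin m) ℂ).trace
      = ((symCong Zᵀ M : Matrix (Fin m) (Fin m) ℂ) * (N : Matrix (Fin m) (Fin m) ℂ)ᵀ).trace := by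
        simp only [coe_symCong, hM, hN, Matrix.transpose_transpose]
        rw [Matrix.trace_mul_comm, ← Matrix.mul_assoc, ← Matrix.mul_assoc, ← Matrix.mul_assoc,
          Matrix.trace_mul_comm]
        simp only [Matrix.mul_assoc]
    _ = _ := by
        rw [← Matrix.sum_hadamard_eq, Fintype.sum_prod_type]
        rfl

lemma exists_GL_eq_sqrt_diagonal {x : Fin m → ℝ} (hx : ∀ i, 0 < x i) :
    ∃ L : GL (Fin m) ℝ, (symDiag fun i => (x i : ℂ) : Matrix (Fin m) (Fin m) ℂ)
        = (L.1.map Complex.ofReal)ᵀ * L.1.map Complex.ofReal ∧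
      symCong (L.1.map Complex.ofReal) (symDiag 1) = symDiag fun i => (x i : ℂ) := by
  have det_ne : (Matrix.diagonal fun i => √(x i)).det ≠ 0 := by
    rw [Matrix.det_diagonal]
    exact Finset.prod_ne_zero_iff.2 fun i _ => (Real.sqrt_pos.2 (hx i)).ne'
  have sqrt_mul_sqrt (i) : ((√(x i) : ℝ) : ℂ) * ((√(x i) : ℝ) : ℂ) = x i := by
    rw [← Complex.ofReal_mul, Real.mul_self_sqrt (hx i).le]
  have map_eq : (Matrix.diagonal fun i => √(x i)).map Complex.ofReal
      = Matrix.diagonal fun i => ((√(x i) : ℝ) : ℂ) := Matrix.diagonal_map Complex.ofReal_zero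
  refine ⟨Matrix.GeneralLinearGroup.mkOfDetNeZero _ det_ne, ?_, Subtype.ext ?_⟩ <;>
  simp [Matrix.GeneralLinearGroup.mkOfDetNeZero, coe_symCong, coe_symDiag,
    map_eq, sqrt_mul_sqrt]

/-- Both sides are the mean of `(tr (L Z N Zᵀ Lᵀ)) ^ t`, where `L Lᵀ = diag(x)`. -/
lemma sum_traceCoeff_mul_realMean_mul_zonalMean {x : Fin m → ℝ} (hx : ∀ i, 0 < x i)
    (N : SymMat m) :
    ∑ τ ∈ partitions m t, traceCoeff m t τ * ((realMean τ x : ℂ) * zonalMean τ N)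
      = ∑ w : Fin t → Fin m × Fin m, (entryMean w x : ℂ) *
        ∏ s, (N : Matrix (Fin m) (Fin m) ℂ) (w s).1 (w s).2 := by
  obtain ⟨L, diag_eq, symCong_eq⟩ := exists_GL_eq_sqrt_diagonal hx
  have term_eq (τ : Fin m → ℕ) : traceCoeff m t τ * ((realMean τ x : ℂ) * zonalMean τ N)
      = ∫ z, traceCoeff m t τ * zonalMean τ (symCong (L.1.map Complex.ofReal)
        (symCong (entryMatrix z) N)) ∂(gaussianPi (Fin m × Fin m)) := by
    rw [integral_const_mul, integral_symCong_of_mem_zonalSpace (zonalMean_mem_zonalSpace τ),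
      symCong_eq, zonalMean_ofReal]
    rfl
  rw [Finset.sum_congr rfl fun τ _ => term_eq τ, ← integral_finsetSum _ fun τ _ =>
    (integrable_comp_symCong (mem_polyFunctions_of_mem_zonalSpace
      (zonalMean_mem_zonalSpace τ)) _ _).const_mul _]
  simp only [sum_traceCoeff_mul_zonalMean, trace_symCong_symCong _ _ _ N diag_eq, Fintype.sum_pow,
    Finset.prod_mul_distrib]
  rw [integral_finsetSum]
  · refine Finset.sum_congr rfl fun w _ => ?_
    rw [integral_mul_const, integral_transpose (n := m) fun Z : Matrix (Fin m) (Fin m) ℂ =>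
      ∏ s, (symCong Z (symDiag fun i => (x i : ℂ)) : Matrix (Fin m) (Fin m) ℂ) (w s).1 (w s).2,
      integral_prod_symCong_entryMatrix]
  · intro w _
    refine Integrable.mul_const (integrable_of_mem_polyFunctions (fun_prod_mem _ _ fun s _ => ?_)) _
    exact symCong_mem _ (fun i j => entryMatrix_mem j i) (fun _ _ => fun_const_mem _ _) _ _

lemma integral_zonalMean_symCong_symDiag (τ : Fin m → ℕ) (y : Fin m → ℝ) :
    ∫ z, zonalMean τ (symCong (entryMatrix z) (symDiag fun i => (y i : ℂ)))
      ∂(gaussianPi (Fin m × Fin m)) = (realMean τ (fun _ => 1) : ℂ) * (realMean τ y : ℂ) := by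
  rw [integral_of_mem_zonalSpace (zonalMean_mem_zonalSpace τ), ← zonalMean_ofReal τ y,
    ← zonalMean_ofReal]
  simp only [Complex.ofReal_one]
  rfl

/-- The right-hand side makes the kernel on the left positive semidefinite. -/
lemma sum_traceCoeff_mul_realMean_mul_realMean {x : Fin m → ℝ} (hx : ∀ i, 0 < x i)
    (y : Fin m → ℝ) :
    ∑ τ ∈ partitions m t, traceCoeff m t τ * (realMean τ (fun _ => 1) : ℂ) *
        ((realMean τ x : ℂ) * (realMean τ y : ℂ))
      = ∑ w : Fin t → Fin m × Fin m, (entryMean w x : ℂ) * (entryMean w y : ℂ) := by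
  let Y (z : Fin m × Fin m → ℝ) : SymMat m :=
    symCong (entryMatrix z) (symDiag fun i => (y i : ℂ))
  have term_eq (τ : Fin m → ℕ) : traceCoeff m t τ * (realMean τ (fun _ => 1) : ℂ) *
        ((realMean τ x : ℂ) * (realMean τ y : ℂ))
      = ∫ z, traceCoeff m t τ * ((realMean τ x : ℂ) * zonalMean τ (Y z))
        ∂(gaussianPi (Fin m × Fin m)) := by
    rw [integral_const_mul, integral_const_mul, integral_zonalMean_symCong_symDiag]
    ring
  have integrable_zonalMean (τ : Fin m → ℕ) :
      Integrable (fun z => zonalMean τ (Y z)) (gaussianPi (Fin m × Fin m)) :=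
    integrable_of_mem_polyFunctions (fun_comp_mem _ (meanPower_mem_polyFunctions τ)
      (symCong_entryMatrix_mem _))
  rw [Finset.sum_congr rfl fun τ _ => term_eq τ, ← integral_finsetSum _ fun τ _ =>
    ((integrable_zonalMean τ).const_mul _).const_mul _]
  simp only [sum_traceCoeff_mul_realMean_mul_zonalMean hx]
  rw [integral_finsetSum]
  · refine Finset.sum_congr rfl fun w _ => ?_
    rw [integral_const_mul, integral_prod_symCong_entryMatrix]
  · exact fun w _ => Integrable.const_mul (integrable_of_mem_polyFunctions
      (fun_prod_mem _ _ fun s _ => symCong_entryMatrix_mem _ _ _)) _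

lemma span_realMean_eq_top (m t : ℕ) :
    Submodule.span ℝ (Set.range fun (x : {x : Fin m → ℝ // ∀ i, 0 < x i}) (σ : partitions m t) =>
      realMean σ.1 x.1) = ⊤ := by
  classical
  by_contra hne
  obtain ⟨φ, hφ, span_le_ker⟩ := Submodule.exists_le_ker_of_lt_top _ (lt_top_iff_ne_top.2 hne)
  let k (σ : Fin m → ℕ) : ℝ := if h : σ ∈ partitions m t then φ (Pi.single ⟨σ, h⟩ 1) else 0
  have k_coe (σ : partitions m t) : k σ = φ (Pi.single σ 1) := dif_pos σ.2
  have sum_eq_zero (x : Fin m → ℝ) (hx : ∀ i, 0 < x i) :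
      ∑ σ ∈ partitions m t, (k σ : ℂ) * (realMean σ x : ℂ) = 0 := by
    have φ_eq_zero : φ (fun σ => realMean σ.1 x) = 0 :=
      span_le_ker (Submodule.subset_span ⟨⟨x, hx⟩, rfl⟩)
    rw [← Finset.univ_sum_single fun σ : partitions m t => realMean σ.1 x, map_sum] at φ_eq_zero
    rw [← Finset.sum_coe_sort]
    norm_cast
    rw [← φ_eq_zero]
    refine Finset.sum_congr rfl fun σ _ => ?_
    rw [k_coe, ← mul_one (realMean σ.1 x), ← smul_eq_mul, ← smul_eq_mul (realMean _ _) (1 : ℝ),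
      Pi.single_smul, map_smul]
    simp [mul_comm]
  refine hφ (LinearMap.pi_ext' fun σ => LinearMap.ext_ring ?_)
  have k_eq_zero := eq_zero_of_sum_realMean (fun σ => (k σ : ℂ)) sum_eq_zero σ σ.2
  rw [Complex.ofReal_eq_zero, k_coe] at k_eq_zero
  simpa using k_eq_zero

lemma exists_sum_mul_realMean_eq_ite {τ : Fin m → ℕ} (hτ : τ ∈ partitions m t) :
    ∃ c : {x : Fin m → ℝ // ∀ i, 0 < x i} →₀ ℝ, ∀ σ ∈ partitions m t,
      ∑ x ∈ c.support, c x * realMean σ x.1 = if σ = τ then 1 else 0 := by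
  classical
  have hspan : (Pi.single ⟨τ, hτ⟩ 1 : partitions m t → ℝ) ∈ Submodule.span ℝ
      (Set.range fun (x : {x : Fin m → ℝ // ∀ i, 0 < x i}) (σ : partitions m t) =>
        realMean σ.1 x.1) := by
    rw [span_realMean_eq_top]
    exact Submodule.mem_top
  obtain ⟨c, hc⟩ := Finsupp.mem_span_range_iff_exists_finsupp.1 hspan
  refine ⟨c, fun σ hσ => ?_⟩
  simpa [Finsupp.sum, Pi.single_apply] using congrFun hc ⟨σ, hσ⟩

lemma sum_sum_mul_sum_mul {α β R : Type*} [CommSemiring R] (s : Finset α) (u : Finset β)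
    (c : α → R) (A : β → R) (f : β → α → R) :
    ∑ x ∈ s, ∑ y ∈ s, c x * c y * ∑ σ ∈ u, A σ * (f σ x * f σ y)
      = ∑ σ ∈ u, A σ * (∑ x ∈ s, c x * f σ x) ^ 2 := by
  simp only [sq, Finset.mul_sum, Finset.sum_mul]
  rw [Finset.sum_congr rfl fun x _ => Finset.sum_comm, Finset.sum_comm]
  refine Finset.sum_congr rfl fun σ _ => ?_
  rw [Finset.sum_comm]
  exact Finset.sum_congr rfl fun y _ => Finset.sum_congr rfl fun x _ => by ring

lemma realMean_one_pos {τ : Fin m → ℕ} (hτ : Antitone τ) : 0 < realMean τ fun _ => 1 :=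
  lt_of_lt_of_le (by simpa using integral_leadPower_pos hτ)
    (integral_leadPower_mul_le_realMean hτ (x := fun _ => 1) fun _ => zero_le_one)

open scoped ComplexOrder in
/-- Pairing the positive semidefinite kernel with weights `c` that isolate `τ` gives a sum of
squares. -/
lemma traceCoeff_nonneg {τ : Fin m → ℕ} (hτ : τ ∈ partitions m t) : 0 ≤ traceCoeff m t τ := by
  obtain ⟨c, hc⟩ := exists_sum_mul_realMean_eq_ite hτ
  have mul_eq_sum_sq : traceCoeff m t τ * (realMean τ (fun _ => 1) : ℂ)
      = ((∑ w : Fin t → Fin m × Fin m, (∑ x ∈ c.support, c x * entryMean w x.1) ^ 2 : ℝ) : ℂ) :=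
    calc traceCoeff m t τ * (realMean τ (fun _ => 1) : ℂ)
        = ∑ σ ∈ partitions m t, traceCoeff m t σ * (realMean σ (fun _ => 1) : ℂ) *
            (∑ x ∈ c.support, (c x : ℂ) * (realMean σ x.1 : ℂ)) ^ 2 := by
          rw [Finset.sum_eq_single_of_mem τ hτ fun σ hσ hne => ?_]
          · norm_cast
            rw [hc τ hτ]
            simp
          · norm_cast
            rw [hc σ hσ, if_neg hne]
            simp
      _ = ∑ x ∈ c.support, ∑ y ∈ c.support, (c x : ℂ) * c y *
            ∑ w : Fin t → Fin m × Fin m, 1 * ((entryMean w x.1 : ℂ) * entryMean w y.1) := by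
          rw [← sum_sum_mul_sum_mul]
          simp only [fun x y : {x : Fin m → ℝ // ∀ i, 0 < x i} =>
            sum_traceCoeff_mul_realMean_mul_realMean (t := t) x.2 y.1, one_mul]
      _ = _ := by
          rw [sum_sum_mul_sum_mul]
          push_cast
          simp only [one_mul]
  have hpos := realMean_one_pos (mem_partitions.1 hτ).2
  rw [eq_div_of_mul_eq (Complex.ofReal_ne_zero.2 hpos.ne') mul_eq_sum_sq, ← Complex.ofReal_div]
  exact Complex.zero_le_real.2 (div_nonneg (Finset.sum_nonneg fun w _ => sq_nonneg _) hpos.le)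

end Positivity

/-! ### The raising operator and the homogeneous Kummer transformation -/

section RowMean
variable {m n : ℕ}

/-- The Gaussian mean of `p (lᵢ zᵢⱼ)` as a polynomial in the row scales `l`. -/
def rowMean (m n : ℕ) : MvPolynomial (Fin m × Fin n) ℂ →ₗ[ℂ] MvPolynomial (Fin m) ℂ :=
  (basisMonomials (Fin m × Fin n) ℂ).constr ℂ fun α =>
    monomial (α.mapDomain Prod.fst) (gaussianMoment α)

lemma rowMean_monomial (α : Fin m × Fin n →₀ ℕ) (c : ℂ) :
    rowMean m n (monomial α c) = monomial (α.mapDomain Prod.fst) (c * gaussianMoment α) := by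
  have on_basis := (basisMonomials (Fin m × Fin n) ℂ).constr_basis ℂ (fun α =>
    (monomial (α.mapDomain Prod.fst) (gaussianMoment α) : MvPolynomial (Fin m) ℂ)) α
  rw [coe_basisMonomials] at on_basis
  rw [← mul_one c, ← smul_eq_mul, ← smul_monomial, map_smul, rowMean, on_basis, smul_monomial,
    smul_eq_mul, smul_eq_mul, mul_one]

lemma eval_rowMean (l : Fin m → ℂ) (p : MvPolynomial (Fin m × Fin n) ℂ) :
    eval l (rowMean m n p) = ∫ z : Fin m × Fin n → ℝ, eval (fun ij => l ij.1 * (z ij : ℂ)) p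
      ∂(gaussianPi (Fin m × Fin n)) := by
  have eval_scale (p : MvPolynomial (Fin m × Fin n) ℂ) (z : Fin m × Fin n → ℝ) :
      eval (fun ij => l ij.1 * (z ij : ℂ)) p
        = eval (fun ij => (z ij : ℂ)) (bind₁ (fun ij => C (l ij.1) * X ij) p) := by
    rw [eval, eval, eval₂Hom_bind₁]
    simp
  induction p using MvPolynomial.induction_on' with
  | monomial α c =>
    have eval_monomial_scale (z : Fin m × Fin n → ℝ) :
        eval (fun ij => l ij.1 * (z ij : ℂ)) (monomial α c)
          = eval (fun ij => (z ij : ℂ)) (monomial α (c * α.prod fun ij k => l ij.1 ^ k)) := by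
      rw [eval_monomial, eval_monomial, mul_assoc, ← Finsupp.prod_mul]
      simp only [mul_pow]
    simp only [eval_monomial_scale]
    rw [← gaussianExpect_apply, gaussianExpect_monomial, rowMean_monomial, eval_monomial,
      Finsupp.prod_mapDomain_index (by simp) (by intros; rw [pow_add])]
    ring
  | add p q hp hq =>
    simp only [map_add, hp, hq]
    rw [integral_add]
    all_goals simp only [eval_scale]; exact integrable_eval_gaussianPi _

lemma rowMean_X_sq_mul_monomial (i : Fin m) (j : Fin n) (α : Fin m × Fin n →₀ ℕ) (c : ℂ) :
    rowMean m n (X (i, j) ^ 2 * monomial α c)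
      = C ((α (i, j) : ℂ) + 1) * (X i ^ 2 * rowMean m n (monomial α c)) := by
  have moment_eq :
      gaussianMoment (α + Finsupp.single (i, j) 1 + Finsupp.single (i, j) 1)
        = ((α (i, j) : ℂ) + 1) * gaussianMoment α := by
    rw [gaussianMoment_add_single]
    simp
  calc rowMean m n (X (i, j) ^ 2 * monomial α c)
      = rowMean m n (monomial (α + Finsupp.single (i, j) 1 + Finsupp.single (i, j) 1) c) := by
        rw [X, sq, monomial_mul, monomial_mul, one_mul, one_mul, add_comm, ← add_assoc]
    _ = _ := by
        rw [rowMean_monomial, rowMean_monomial, moment_eq, Finsupp.mapDomain_add,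
          Finsupp.mapDomain_add, Finsupp.mapDomain_single, X, sq, monomial_mul, monomial_mul,
          C_mul_monomial, one_mul, one_mul, add_assoc, add_comm, mul_left_comm]

lemma mapDomain_fst_apply (α : Fin m × Fin n →₀ ℕ) (i : Fin m) :
    α.mapDomain Prod.fst i = ∑ j, α (i, j) := by
  rw [Finsupp.mapDomain, Finsupp.sum_apply, Finsupp.sum_fintype _ _ (by simp),
    Fintype.sum_prod_type, Finset.sum_eq_single i]
  · simp
  · intro k _ hk
    simp [hk]
  · simp

lemma rowMean_sum_sq_mul (i : Fin m) (p : MvPolynomial (Fin m × Fin n) ℂ) :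
    rowMean m n ((∑ j, X (i, j) ^ 2) * p)
      = X i ^ 2 * (C (n : ℂ) * rowMean m n p + X i * pderiv i (rowMean m n p)) := by
  induction p using MvPolynomial.induction_on' with
  | monomial α c =>
    rw [Finset.sum_mul, map_sum]
    simp only [rowMean_X_sq_mul_monomial]
    rw [← Finset.sum_mul, rowMean_monomial, X_mul_pderiv_monomial, ← map_sum,
      Finset.sum_add_distrib, mapDomain_fst_apply]
    simp only [Finset.sum_const, Finset.card_univ, Fintype.card_fin, nsmul_eq_mul, mul_one,
      map_add, map_natCast, map_sum, Nat.cast_sum]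
    ring
  | add p q hp hq =>
    rw [mul_add, map_add, hp, hq, map_add, map_add]
    ring

end RowMean

section GramPoly
variable {m n t : ℕ}

lemma exists_eval_eq_zonalMean_gram (m n : ℕ) (σ : Fin m → ℕ) :
    ∃ p : MvPolynomial (Fin m × Fin n) ℂ, ∀ w,
      eval w p = zonalMean σ (symCong (Matrix.of fun i j => w (i, j)) (symDiag 1 : SymMat n)) := by
  let v (ij : Fin m × Fin n) (w : Fin m × Fin n → ℂ) : ℂ := w ij
  have gram_mem : (fun w : Fin m × Fin n → ℂ => zonalMean σ
      (symCong (Matrix.of fun i j => w (i, j)) (symDiag 1 : SymMat n))) ∈ polyFunctions v :=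
    fun_comp_mem _ (meanPower_mem_polyFunctions σ) fun i j =>
      symCong_mem _ (fun i j => coord_mem_polyFunctions v (i, j))
        (fun _ _ => fun_const_mem _ _) i j
  obtain ⟨p, hp⟩ := mem_polyFunctions.1 gram_mem
  exact ⟨p, fun w => (hp w).symm⟩

/-- `zonalMean σ (W Wᵀ)` as a polynomial in the entries of `W`. -/
def gramPoly (m n : ℕ) (σ : Fin m → ℕ) : MvPolynomial (Fin m × Fin n) ℂ :=
  (exists_eval_eq_zonalMean_gram m n σ).choose

lemma eval_gramPoly (σ : Fin m → ℕ) (w : Fin m × Fin n → ℂ) :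
    eval w (gramPoly m n σ)
      = zonalMean σ (symCong (Matrix.of fun i j => w (i, j)) (symDiag 1 : SymMat n)) :=
  (exists_eval_eq_zonalMean_gram m n σ).choose_spec w

lemma rowMean_gramPoly {σ : Fin m → ℕ} (hσ : σ ∈ partitions m t) :
    rowMean m n (gramPoly m n σ)
      = C (2 ^ t * risingPartition ((n : ℂ) / 2) σ) * expand 2 (zonalPoly σ) := by
  obtain ⟨rfl, hanti⟩ := mem_partitions.1 hσ
  refine mvPolynomial_ext_of_pos fun l hl => ?_
  let L : GL (Fin m) ℝ := Matrix.GeneralLinearGroup.mkOfDetNeZero (Matrix.diagonal l) (by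
    rw [Matrix.det_diagonal]
    exact Finset.prod_ne_zero_iff.2 fun i _ => (hl i).ne')
  have map_L : L.1.map Complex.ofReal = Matrix.diagonal fun i => (l i : ℂ) :=
    Matrix.diagonal_map Complex.ofReal_zero
  have eval_scaled_rows (z : Fin m × Fin n → ℝ) :
      eval (fun ij => (l ij.1 : ℂ) * (z ij : ℂ)) (gramPoly m n σ)
        = zonalMean σ (symCong (L.1.map Complex.ofReal) (symCong (entryMatrix z) (symDiag 1))) := by
    rw [eval_gramPoly, ← symCong_mul, map_L]
    congr 2
    ext i j
    simp [Matrix.diagonal_mul, entryMatrix]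
  rw [eval_rowMean]
  simp only [eval_scaled_rows]
  rw [integral_symCong_of_mem_zonalSpace (zonalMean_mem_zonalSpace σ), meanPower_one n hanti,
    map_mul, eval_C, eval_expand, eval_zonalPoly, mul_comm]
  congr 2
  apply Subtype.ext
  rw [coe_symCong, map_L]
  simp [coe_symDiag, sq]

lemma sum_sq_mul_gramPoly {τ : Fin m → ℕ} {k : (Fin m → ℕ) → ℂ}
    (hk : psum (Fin m) ℂ 1 * zonalPoly τ = ∑ σ ∈ partitions m t, k σ • zonalPoly σ) :
    (∑ i, ∑ j, X (i, j) ^ 2) * gramPoly m n τ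
      = ∑ σ ∈ partitions m t, k σ • gramPoly m n σ := by
  refine MvPolynomial.funext fun w => ?_
  set Y : SymMat m := symCong (Matrix.of fun i j => w (i, j)) (symDiag 1 : SymMat n) with hY
  obtain ⟨ev, hev⟩ := exists_roots_charpoly_eq_map (Y : Matrix (Fin m) (Fin m) ℂ)
  have eval_sum_sq : eval w (∑ i, ∑ j, X (i, j) ^ 2) = (Y : Matrix (Fin m) (Fin m) ℂ).trace := by
    simp [hY, coe_symCong, coe_symDiag, Matrix.trace, Matrix.mul_apply, sq]
  rw [map_mul, eval_sum_sq, eval_gramPoly, trace_eq_sum_eigenvalues hev, ← eval_psum_one,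
    zonalMean_eq_eval τ Y hev, ← map_mul, hk, map_sum, map_sum]
  refine Finset.sum_congr rfl fun σ _ => ?_
  rw [smul_eval, smul_eval, eval_gramPoly, ← hY, zonalMean_eq_eval σ Y hev]

end GramPoly

section Raise
variable {m t : ℕ}

/-- The derivation `∑ xᵢ² ∂ᵢ`. -/
def sqDeriv (m : ℕ) : Derivation ℂ (MvPolynomial (Fin m) ℂ) (MvPolynomial (Fin m) ℂ) :=
  mkDerivation ℂ fun i => X i ^ 2

lemma sqDeriv_apply (p : MvPolynomial (Fin m) ℂ) :
    sqDeriv m p = ∑ i, X i ^ 2 * pderiv i p := by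
  have sqDeriv_eq : sqDeriv m = ∑ i, (X i ^ 2 : MvPolynomial (Fin m) ℂ) • pderiv i := by
    refine derivation_ext fun j => ?_
    rw [sqDeriv, mkDerivation_X, ← Derivation.coeFnAddMonoidHom_apply, map_sum]
    simp [pderiv_X, Pi.single_apply, Finset.sum_apply]
  rw [sqDeriv_eq, ← Derivation.coeFnAddMonoidHom_apply, map_sum]
  simp

lemma X_mul_pderiv_expand_two {σ R : Type*} [CommSemiring R] (i : σ) (p : MvPolynomial σ R) :
    X i * pderiv i (expand 2 p) = expand 2 (2 * (X i * pderiv i p)) := by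
  induction p using MvPolynomial.induction_on' with
  | monomial α c =>
    rw [expand_monomial, X_mul_pderiv_monomial, X_mul_pderiv_monomial, map_mul, map_nsmul,
      expand_monomial, map_ofNat]
    simp only [Finsupp.smul_apply, nsmul_eq_mul, smul_eq_mul]
    push_cast
    ring
  | add p q hp hq =>
    rw [map_add, map_add, mul_add, hp, hq, ← map_add, map_add (pderiv i)]
    congr 1
    ring

/-- The operator `c (x₁ + ⋯ + x_m) + ∑ xᵢ² ∂ᵢ`, which intertwines with multiplication by
`x₁ + ⋯ + x_m` under `zonalPoly τ ↦ (c)_τ zonalPoly τ`. -/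
def raise (m : ℕ) (c : ℂ) : Module.End ℂ (MvPolynomial (Fin m) ℂ) :=
  LinearMap.mulLeft ℂ (c • psum (Fin m) ℂ 1) + (sqDeriv m : _ →ₗ[ℂ] _)

lemma raise_apply (c : ℂ) (p : MvPolynomial (Fin m) ℂ) :
    raise m c p = c • psum (Fin m) ℂ 1 * p + sqDeriv m p := rfl

lemma two_mul_raise_half (n : ℕ) (p : MvPolynomial (Fin m) ℂ) :
    2 * raise m ((n : ℂ) / 2) p = ∑ i, X i * (C (n : ℂ) * p + 2 * (X i * pderiv i p)) := by
  have C_natCast : (C (n : ℂ) : MvPolynomial (Fin m) ℂ) = 2 * C ((n : ℂ) / 2) := by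
    rw [← map_ofNat C 2, ← map_mul, mul_div_cancel₀ _ two_ne_zero]
  rw [raise_apply, sqDeriv_apply, psum_one, smul_eq_C_mul, Finset.mul_sum, Finset.sum_mul,
    ← Finset.sum_add_distrib, Finset.mul_sum]
  refine Finset.sum_congr rfl fun i _ => ?_
  rw [C_natCast]
  ring

/-- Take row means of `sum_sq_mul_gramPoly`; `rowMean` turns multiplication by the sum of squares
into the raising operator in the squares of the row scales. -/
lemma raise_half_zonalPoly {τ : Fin m → ℕ} (hτ : τ ∈ partitions m t) {k : (Fin m → ℕ) → ℂ}
    (hk : psum (Fin m) ℂ 1 * zonalPoly τ = ∑ σ ∈ partitions m (t + 1), k σ • zonalPoly σ) (n : ℕ) :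
    risingPartition ((n : ℂ) / 2) τ • raise m ((n : ℂ) / 2) (zonalPoly τ)
      = ∑ σ ∈ partitions m (t + 1), (k σ * risingPartition ((n : ℂ) / 2) σ) • zonalPoly σ := by
  have two_pow_ne_zero : (C ((2 : ℂ) ^ (t + 1)) : MvPolynomial (Fin m) ℂ) ≠ 0 :=
    C_eq_zero.not.2 (pow_ne_zero _ two_ne_zero)
  refine mul_left_cancel₀ two_pow_ne_zero (expand_injective two_pos ?_)
  generalize hr : risingPartition ((n : ℂ) / 2) τ = r
  calc expand 2 (C (2 ^ (t + 1)) * r • raise m ((n : ℂ) / 2) (zonalPoly τ))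
      = expand 2 (C (2 ^ t * r) * (2 * raise m ((n : ℂ) / 2) (zonalPoly τ))) := by
        rw [smul_eq_C_mul, pow_succ, map_mul C, map_mul C, map_ofNat]
        congr 1
        ring
    _ = ∑ i, rowMean m n ((∑ j, X (i, j) ^ 2) * gramPoly m n τ) := by
        rw [two_mul_raise_half, Finset.mul_sum, map_sum]
        refine Finset.sum_congr rfl fun i _ => ?_
        rw [rowMean_sum_sq_mul, rowMean_gramPoly hτ, hr, pderiv_C_mul, mul_left_comm (X i),
          X_mul_pderiv_expand_two]
        simp only [map_mul, map_add, expand_C, expand_X]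
        ring
    _ = ∑ σ ∈ partitions m (t + 1), k σ • rowMean m n (gramPoly m n σ) := by
        rw [← map_sum, ← Finset.sum_mul, sum_sq_mul_gramPoly hk, map_sum]
        simp only [map_smul]
    _ = _ := by
        rw [Finset.mul_sum, map_sum]
        refine Finset.sum_congr rfl fun σ hσ => ?_
        rw [rowMean_gramPoly hσ]
        simp only [smul_eq_C_mul, map_mul, expand_C]
        ring

lemma exists_eval_eq_risingPartition (τ : Fin m → ℕ) :
    ∃ P : Polynomial ℂ, ∀ c, P.eval c = risingPartition c τ := by
  refine ⟨∏ i : Fin m, ∏ j ∈ Finset.range (τ i),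
    (Polynomial.X - Polynomial.C (((i : ℕ) : ℂ) / 2) + Polynomial.C (j : ℂ)), fun c => ?_⟩
  simp only [Polynomial.eval_prod, Polynomial.eval_add, Polynomial.eval_sub, Polynomial.eval_X,
    Polynomial.eval_C, risingPartition, rising]

/-- Both sides are polynomial in `c`, so the half-integers suffice. -/
lemma raise_zonalPoly {τ : Fin m → ℕ} (hτ : τ ∈ partitions m t) {k : (Fin m → ℕ) → ℂ}
    (hk : psum (Fin m) ℂ 1 * zonalPoly τ = ∑ σ ∈ partitions m (t + 1), k σ • zonalPoly σ) (c : ℂ) :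
    risingPartition c τ • raise m c (zonalPoly τ)
      = ∑ σ ∈ partitions m (t + 1), (k σ * risingPartition c σ) • zonalPoly σ := by
  refine MvPolynomial.funext fun x => ?_
  choose P hP using fun τ : Fin m → ℕ => exists_eval_eq_risingPartition τ
  let lhs : Polynomial ℂ := P τ * (Polynomial.X * Polynomial.C (eval x (psum (Fin m) ℂ 1) *
    eval x (zonalPoly τ)) + Polynomial.C (eval x (sqDeriv m (zonalPoly τ))))
  let rhs : Polynomial ℂ := ∑ σ ∈ partitions m (t + 1), Polynomial.C (k σ) * P σ *
    Polynomial.C (eval x (zonalPoly σ))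
  have eval_lhs (c) :
      lhs.eval c = eval x (risingPartition c τ • raise m c (zonalPoly τ)) := by
    simp [lhs, hP, raise_apply, mul_add, -psum_one]
  have eval_rhs (c) : rhs.eval c = eval x
      (∑ σ ∈ partitions m (t + 1), (k σ * risingPartition c σ) • zonalPoly σ) := by
    simp [rhs, hP, Polynomial.eval_finsetSum]
  have natCast_half_injective : Function.Injective fun n : ℕ => (n : ℂ) / 2 :=
    fun a b hab => Nat.cast_injective ((div_left_inj' two_ne_zero).1 hab)
  suffices lhs = rhs by rw [← eval_lhs, ← eval_rhs, this]
  refine Polynomial.eq_of_infinite_eval_eq _ _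
    ((Set.infinite_range_of_injective natCast_half_injective).mono ?_)
  rintro _ ⟨n, rfl⟩
  rw [Set.mem_ofPred_eq, eval_lhs, eval_rhs, raise_half_zonalPoly hτ hk]

end Raise

section Kummer
variable {m t : ℕ} {c : ℂ}

/-- `g` arises from the symmetric polynomial `f` of degree `t` by multiplying its component along
`zonalPoly τ` by `(c)_τ`. -/
def RisingImage (m : ℕ) (c : ℂ) (t : ℕ) (f g : MvPolynomial (Fin m) ℂ) : Prop :=
  ∃ k : (Fin m → ℕ) → ℂ, f = ∑ τ ∈ partitions m t, k τ • zonalPoly τ ∧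
    g = ∑ τ ∈ partitions m t, (k τ * risingPartition c τ) • zonalPoly τ

lemma eq_of_sum_smul_zonalPoly_eq {k k' : (Fin m → ℕ) → ℂ}
    (h : ∑ τ ∈ partitions m t, k τ • zonalPoly τ = ∑ τ ∈ partitions m t, k' τ • zonalPoly τ) :
    ∀ τ ∈ partitions m t, k τ = k' τ := fun τ hτ =>
  sub_eq_zero.1 (linearIndepOn_finset_iff.1 (linearIndepOn_zonalPoly m t) (fun τ => k τ - k' τ)
    (by simp only [sub_smul, Finset.sum_sub_distrib, h, sub_self]) τ hτ)

namespace RisingImage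
variable {f g f' g' : MvPolynomial (Fin m) ℂ}

lemma smul (h : RisingImage m c t f g) (z : ℂ) : RisingImage m c t (z • f) (z • g) := by
  obtain ⟨k, rfl, rfl⟩ := h
  exact ⟨fun τ => z * k τ, by simp only [Finset.smul_sum, mul_smul],
    by simp only [Finset.smul_sum, mul_smul]⟩

lemma sum {ι : Type*} (s : Finset ι) {f g : ι → MvPolynomial (Fin m) ℂ}
    (h : ∀ i ∈ s, RisingImage m c t (f i) (g i)) :
    RisingImage m c t (∑ i ∈ s, f i) (∑ i ∈ s, g i) := by
  choose! k hf hg using h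
  refine ⟨fun τ => ∑ i ∈ s, k i τ, ?_, ?_⟩
  · rw [Finset.sum_congr rfl hf, Finset.sum_comm]
    simp only [Finset.sum_smul]
  · rw [Finset.sum_congr rfl hg, Finset.sum_comm]
    simp only [Finset.sum_smul, Finset.sum_mul]

lemma unique (h : RisingImage m c t f g) (h' : RisingImage m c t f g') : g = g' := by
  obtain ⟨k, f_eq, rfl⟩ := h
  obtain ⟨k', f_eq', rfl⟩ := h'
  refine Finset.sum_congr rfl fun τ hτ => ?_
  rw [eq_of_sum_smul_zonalPoly_eq (f_eq.symm.trans f_eq') τ hτ]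

lemma injective (hc : ∀ τ ∈ partitions m t, risingPartition c τ ≠ 0)
    (h : RisingImage m c t f g) (h' : RisingImage m c t f' g) : f = f' := by
  obtain ⟨k, rfl, g_eq⟩ := h
  obtain ⟨k', rfl, g_eq'⟩ := h'
  refine Finset.sum_congr rfl fun τ hτ => ?_
  rw [mul_right_cancel₀ (hc τ hτ) (eq_of_sum_smul_zonalPoly_eq (g_eq.symm.trans g_eq') τ hτ)]

lemma raise (h : RisingImage m c t f g) :
    RisingImage m c (t + 1) (psum (Fin m) ℂ 1 * f) (KummerPearson.raise m c g) := by
  obtain ⟨k, rfl, rfl⟩ := h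
  simp only [Finset.mul_sum, map_sum, map_smul, mul_smul, mul_smul_comm]
  refine sum _ fun τ hτ => smul ?_ (k τ)
  have mul_mem : psum (Fin m) ℂ 1 * zonalPoly τ ∈ symmetricHomogeneous m (t + 1) := by
    obtain ⟨hsymm, hhom⟩ := mem_symmetricHomogeneous.1 (zonalPoly_mem_symmetricHomogeneous hτ)
    rw [add_comm]
    exact mem_symmetricHomogeneous.2 ⟨Subalgebra.mul_mem (symmetricSubalgebra (Fin m) ℂ)
      (psum_isSymmetric _ _ 1) hsymm, (psum_one_isHomogeneous m).mul hhom⟩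
  obtain ⟨k', hk'⟩ := exists_eq_sum_zonalPoly mul_mem
  exact ⟨k', hk', raise_zonalPoly hτ hk' c⟩

lemma raise_pow (h : RisingImage m c t f g) (j : ℕ) :
    RisingImage m c (t + j) (psum (Fin m) ℂ 1 ^ j * f) ((KummerPearson.raise m c ^ j) g) := by
  induction j with
  | zero => simpa using h
  | succ j ih =>
    rw [pow_succ', pow_succ', mul_assoc]
    exact ih.raise

lemma one (m : ℕ) (c : ℂ) : RisingImage m c 0 1 1 := by
  obtain ⟨k, hk⟩ := exists_eq_sum_zonalPoly (psum_one_pow_mem_symmetricHomogeneous m 0)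
  rw [pow_zero] at hk
  refine ⟨k, hk, hk.trans (Finset.sum_congr rfl fun τ hτ => ?_)⟩
  have part_eq_zero (i) : τ i = 0 := Finset.sum_eq_zero_iff.1 (mem_partitions.1 hτ).1 i
    (Finset.mem_univ i)
  simp [risingPartition, rising, part_eq_zero]

end RisingImage

/-- The homogeneous component of degree `t` of `₁F₁(a; c; x)`, times `t!`. -/
def kummerPoly (m : ℕ) (a c : ℂ) (t : ℕ) : MvPolynomial (Fin m) ℂ :=
  ∑ τ ∈ partitions m t,
    (traceCoeff m t τ * (risingPartition a τ / risingPartition c τ)) • zonalPoly τ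

lemma risingImage_kummerPoly (a : ℂ) (hc : ∀ τ ∈ partitions m t, risingPartition c τ ≠ 0) :
    RisingImage m c t (kummerPoly m a c t) ((raise m a ^ t) 1) := by
  refine ⟨_, rfl, ?_⟩
  have raise_pow_one := (RisingImage.one m a).raise_pow t
  rw [zero_add, mul_one] at raise_pow_one
  rw [raise_pow_one.unique ⟨_, psum_one_pow_eq_sum m t, rfl⟩]
  refine Finset.sum_congr rfl fun τ hτ => ?_
  rw [mul_assoc, div_mul_cancel₀ _ (hc τ hτ)]

lemma mulLeft_sub_mulRight_pow_one {R : Type*} [Ring R] [Algebra ℂ R] (x y : R) (t : ℕ) :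
    ((LinearMap.mulLeft ℂ y - LinearMap.mulRight ℂ x) ^ t) 1
      = ∑ k ∈ Finset.range (t + 1), ((-1) ^ k * (t.choose k : ℂ)) • (y ^ (t - k) * x ^ k) := by
  have sub_eq_add : LinearMap.mulLeft ℂ y - LinearMap.mulRight ℂ x
      = LinearMap.mulRight ℂ (-x) + LinearMap.mulLeft ℂ y := by
    ext z
    simp [sub_eq_neg_add]
  rw [sub_eq_add, (LinearMap.commute_mulLeft_right _ _).symm.add_pow, LinearMap.sum_apply]
  refine Finset.sum_congr rfl fun k _ => ?_
  rw [Module.End.mul_apply, Module.End.natCast_apply, map_nsmul, Module.End.mul_apply,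
    LinearMap.pow_mulLeft, LinearMap.mulLeft_apply, mul_one, LinearMap.pow_mulRight,
    ← Nat.cast_smul_eq_nsmul ℂ, mul_comm, mul_smul, LinearMap.mulRight_apply]
  rcases Nat.even_or_odd k with h | h <;> simp [h.neg_one_pow, h.neg_pow]

/-- `raise m c - raise m (c - a)` is multiplication by `a (x₁ + ⋯ + x_m)`, and commuting with
multiplication by `f` produces `sqDeriv m f`. -/
lemma mulLeft_raise_sub_mulRight_raise_pow (a c : ℂ) (t : ℕ) (f : MvPolynomial (Fin m) ℂ) :
    ((LinearMap.mulLeft ℂ (raise m c) - LinearMap.mulRight ℂ (raise m (c - a))) ^ t) 1 f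
      = (raise m a ^ t) 1 * f := by
  induction t generalizing f with
  | zero => simp
  | succ t ih =>
    rw [pow_succ', Module.End.mul_apply, LinearMap.sub_apply, LinearMap.sub_apply,
      LinearMap.mulRight_apply, LinearMap.mulLeft_apply, Module.End.mul_apply,
      Module.End.mul_apply, ih, ih, pow_succ', Module.End.mul_apply, raise_apply, raise_apply,
      raise_apply, Derivation.leibniz]
    simp only [smul_eq_mul, smul_eq_C_mul, map_sub]
    ring

lemma sum_raise_pow (a c : ℂ) (t : ℕ) (f : MvPolynomial (Fin m) ℂ) :
    ∑ k ∈ Finset.range (t + 1), ((-1) ^ k * (t.choose k : ℂ)) •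
      (raise m c ^ (t - k)) ((raise m (c - a) ^ k) f) = (raise m a ^ t) 1 * f := by
  rw [← mulLeft_raise_sub_mulRight_raise_pow a c, mulLeft_sub_mulRight_pow_one,
    LinearMap.sum_apply]
  rfl

lemma kummerPoly_eq_sum (a : ℂ) (hc : ∀ τ : Fin m → ℕ, risingPartition c τ ≠ 0) (t : ℕ) :
    kummerPoly m a c t = ∑ k ∈ Finset.range (t + 1), ((-1) ^ k * (t.choose k : ℂ)) •
      (psum (Fin m) ℂ 1 ^ (t - k) * kummerPoly m (c - a) c k) := by
  have image := risingImage_kummerPoly (t := t) a fun τ _ => hc τ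
  rw [← mul_one ((raise m a ^ t) 1), ← sum_raise_pow a c t 1] at image
  refine RisingImage.injective (fun τ _ => hc τ) image (RisingImage.sum _ fun k hk => ?_)
  have image_k := (risingImage_kummerPoly (t := k) (c - a) fun τ _ => hc τ).raise_pow (t - k)
  rw [Nat.add_sub_cancel' (Nat.lt_succ_iff.1 (Finset.mem_range.1 hk))] at image_k
  exact image_k.smul _

end Kummer

/-! ### Growth of the terms -/

section Growth
variable {m t : ℕ}

lemma rising_succ (b : ℂ) (t : ℕ) : rising b (t + 1) = rising b t * (b + t) :=
  Finset.prod_range_succ _ _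

lemma rising_add (b : ℂ) (k j : ℕ) : rising b (k + j) = rising b k * rising (b + k) j := by
  rw [rising, Finset.prod_range_add]
  simp only [rising, Nat.cast_add, add_assoc]

lemma rising_eq_eval_ascPochhammer (b : ℂ) (t : ℕ) : rising b t = (ascPochhammer ℂ t).eval b := by
  induction t with
  | zero => simp [rising]
  | succ t ih => rw [rising_succ, ih, ascPochhammer_succ_eval]

lemma rising_one (t : ℕ) : rising 1 t = (t.factorial : ℂ) := by
  rw [rising_eq_eval_ascPochhammer, ascPochhammer_eval_one]

/-- The ratio test applies, since `(α + k) / (γ + k)` tends to `1`. -/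
lemma exists_norm_rising_div_le (α γ : ℂ) {r : ℝ} (hr : 1 < r) :
    ∃ K : ℝ, 0 ≤ K ∧ ∀ k, ‖rising α k / rising γ k‖ ≤ K * r ^ k := by
  have r_pos : 0 < r := one_pos.trans hr
  let u (k : ℕ) : ℂ := rising α k / rising γ k / (r : ℂ) ^ k
  have u_succ (k : ℕ) : u (k + 1) = (α + k) / (γ + k) / r * u k := by
    simp only [u, rising_succ, pow_succ, div_eq_mul_inv, mul_inv]
    ring
  have ratio_tendsto : Filter.Tendsto (fun k : ℕ => ‖(α + k) / (γ + k) / (r : ℂ)‖) Filter.atTop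
      (nhds r⁻¹) := by
    have := ((tendsto_add_mul_div_add_mul_atTop_nhds α γ 1 one_ne_zero).div_const (r : ℂ)).norm
    simpa [abs_of_pos r_pos] using this
  obtain ⟨l, r_inv_lt, l_lt_one⟩ := exists_between (inv_lt_one_of_one_lt₀ hr)
  have u_summable : Summable u := by
    refine summable_of_ratio_norm_eventually_le l_lt_one ?_
    filter_upwards [ratio_tendsto.eventually_le_const r_inv_lt] with k hk
    rw [u_succ, norm_mul]
    gcongr
  refine ⟨∑' k, ‖u k‖, tsum_nonneg fun _ => norm_nonneg _, fun k => ?_⟩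
  have u_le := u_summable.norm.le_tsum k fun _ _ => norm_nonneg _
  rwa [norm_div _ ((r : ℂ) ^ k), norm_pow, Complex.norm_of_nonneg r_pos.le,
    div_le_iff₀ (pow_pos r_pos k)] at u_le

lemma exists_norm_rising_div_factorial_le (b : ℂ) {r : ℝ} (hr : 1 < r) :
    ∃ K : ℝ, 0 ≤ K ∧ ∀ k, ‖rising b k / (k.factorial : ℂ)‖ ≤ K * r ^ k := by
  simpa only [rising_one] using exists_norm_rising_div_le b 1 hr

lemma exists_norm_risingPartition_div_le (a c : ℂ) {r : ℝ} (hr : 1 < r) :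
    ∃ K : ℝ, 0 ≤ K ∧ ∀ t, ∀ τ ∈ partitions m t,
      ‖risingPartition a τ / risingPartition c τ‖ ≤ K * r ^ t := by
  choose K K_nonneg hK using fun i : Fin m =>
    exists_norm_rising_div_le (a - ((i : ℕ) : ℂ) / 2) (c - ((i : ℕ) : ℂ) / 2) hr
  refine ⟨∏ i, K i, Finset.prod_nonneg fun i _ => K_nonneg i, fun t τ hτ => ?_⟩
  rw [risingPartition, risingPartition, ← Finset.prod_div_distrib, norm_prod,
    ← (mem_partitions.1 hτ).1, ← Finset.prod_pow_eq_pow_sum, ← Finset.prod_mul_distrib]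
  exact Finset.prod_le_prod (fun i _ => norm_nonneg _) fun i _ => hK i _

lemma sum_norm_traceCoeff_mul_realMean (x : Fin m → ℝ) :
    ∑ τ ∈ partitions m t, ‖traceCoeff m t τ‖ * realMean τ x = (∑ i, x i) ^ t := by
  have eval_psum_pow := congrArg (eval fun i => (x i : ℂ)) (psum_one_pow_eq_sum m t)
  rw [map_pow, eval_psum_one, map_sum] at eval_psum_pow
  rw [← Complex.ofReal_inj]
  push_cast
  rw [eval_psum_pow]
  refine Finset.sum_congr rfl fun τ hτ => ?_
  rw [smul_eval, eval_zonalPoly_ofReal, Complex.norm_of_nonneg' (traceCoeff_nonneg hτ)]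

lemma exists_norm_kummerPoly_le (a c : ℂ) {r : ℝ} (hr : 1 < r) (ev : Fin m → ℂ) :
    ∃ K : ℝ, 0 ≤ K ∧ ∀ t, ‖eval ev (kummerPoly m a c t)‖ ≤ K * (r * ∑ i, ‖ev i‖) ^ t := by
  obtain ⟨K, K_nonneg, hK⟩ := exists_norm_risingPartition_div_le (m := m) a c hr
  refine ⟨K, K_nonneg, fun t => ?_⟩
  have zonalPoly_le (τ : Fin m → ℕ) : ‖eval ev (zonalPoly τ)‖ ≤ realMean τ fun i => ‖ev i‖ := by
    rw [eval_zonalPoly]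
    exact norm_zonalMean_le τ ev
  calc ‖eval ev (kummerPoly m a c t)‖
      ≤ ∑ τ ∈ partitions m t,
          (K * r ^ t) * (‖traceCoeff m t τ‖ * realMean τ fun i => ‖ev i‖) := by
        rw [kummerPoly, map_sum]
        refine norm_sum_le_of_le _ fun τ hτ => ?_
        rw [smul_eval, mul_comm (traceCoeff m t τ), mul_assoc, norm_mul, norm_mul]
        have := hK t τ hτ
        have := zonalPoly_le τ
        gcongr
    _ = K * (r * ∑ i, ‖ev i‖) ^ t := by
        rw [← Finset.mul_sum, sum_norm_traceCoeff_mul_realMean, mul_pow, mul_assoc]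

end Growth

/-! ### Rearrangement for a large argument -/

section Rearrangement

/-- The `t`-th term of the series `∑ₜ (b)_t / t! · Aₜ x ^ (-t)`. -/
def risingTerm (b : ℂ) (A : ℕ → ℂ) (x : ℂ) (t : ℕ) : ℂ :=
  rising b t / (t.factorial : ℂ) * A t * (x ^ t)⁻¹

/-- The binomial transform of the sequence `B`, with parameter `σ`: if `B k = y ^ k`, this is the
sequence of powers of `y + σ`. -/
def binomialTransform (σ : ℂ) (B : ℕ → ℂ) (t : ℕ) : ℂ :=
  ∑ k ∈ Finset.range (t + 1), (t.choose k : ℂ) * σ ^ (t - k) * B k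

/-- The contribution of `B k` to the term of index `k + j` of the series with coefficients
`binomialTransform σ B`, as a function of `(k, j)`. -/
def binomialTerm (b σ : ℂ) (B : ℕ → ℂ) (x : ℂ) (p : ℕ × ℕ) : ℂ :=
  rising b (p.1 + p.2) / ((p.1 + p.2).factorial : ℂ) *
    (((p.1 + p.2).choose p.1 : ℂ) * σ ^ p.2 * B p.1) * (x ^ (p.1 + p.2))⁻¹

variable {b σ x : ℂ} {A B : ℕ → ℂ} {K R Λ : ℝ}

lemma summable_risingTerm (b : ℂ) (hΛ : 0 ≤ Λ) (hx : Λ < ‖x‖)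
    (hA : ∀ r : ℝ, 1 < r → ∃ K : ℝ, 0 ≤ K ∧ ∀ t, ‖A t‖ ≤ K * (r * Λ) ^ t) :
    Summable (risingTerm b A x) := by
  have norm_x_pos : 0 < ‖x‖ := hΛ.trans_lt hx
  obtain ⟨r, r_sq_lt, one_lt_r⟩ : ∃ r : ℝ, r * (r * Λ) < ‖x‖ ∧ 1 < r := by
    have tendsto_one : Filter.Tendsto (fun r : ℝ => r * (r * Λ)) (nhdsWithin 1 (Set.Ioi 1))
        (nhds Λ) := tendsto_nhdsWithin_of_tendsto_nhds <|
      Continuous.tendsto' (by fun_prop) _ _ (by ring)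
    exact ((tendsto_one.eventually_lt_const hx).and self_mem_nhdsWithin).exists
  obtain ⟨K, -, hK⟩ := hA r one_lt_r
  obtain ⟨K', K'_nonneg, hK'⟩ := exists_norm_rising_div_factorial_le b one_lt_r
  have geometric : Summable fun t => K' * K * (r * (r * Λ) / ‖x‖) ^ t :=
    (summable_geometric_of_lt_one (by positivity) ((div_lt_one norm_x_pos).2 r_sq_lt)).mul_left _
  refine geometric.of_norm_bounded fun t => ?_
  calc ‖risingTerm b A x t‖ ≤ K' * r ^ t * (K * (r * Λ) ^ t) * (‖x‖ ^ t)⁻¹ := by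
        rw [risingTerm, norm_mul, norm_mul, norm_inv, norm_pow]
        have := hK t
        have := hK' t
        gcongr
    _ = K' * K * (r * (r * Λ) / ‖x‖) ^ t := by
        rw [div_pow, mul_pow]
        ring

lemma hasSum_rising_div_factorial (β : ℂ) {y : ℂ} (hy : ‖y‖ < 1) :
    HasSum (fun j : ℕ => rising β j / (j.factorial : ℂ) * y ^ j) ((1 - y) ^ (-β)) := by
  have binomial_series :=
    (Complex.one_div_one_sub_cpow_hasFPowerSeriesOnBall_zero β).hasSum (y := y) (by
      rw [mem_eball_zero_iff, ← ofReal_norm]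
      exact ENNReal.ofReal_lt_one.2 hy)
  rw [zero_add, one_div, ← Complex.cpow_neg] at binomial_series
  refine binomial_series.congr_fun fun j => ?_
  have choose_eq : Ring.choose (β + (j : ℂ) - 1) j = rising β j / (j.factorial : ℂ) := by
    rw [eq_div_iff (Nat.cast_ne_zero.2 j.factorial_ne_zero), rising_eq_eval_ascPochhammer,
      ← Polynomial.ascPochhammer_smeval_eq_eval,
      ← Ring.factorial_nsmul_multichoose_eq_ascPochhammer, nsmul_eq_mul, mul_comm, Ring.choose]
    congr 2
    ring
  rw [FormalMultilinearSeries.ofScalars_apply_eq, choose_eq, smul_eq_mul]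

lemma tsum_sum_antidiagonal {E : Type*} [NormedAddCommGroup E] {f : ℕ × ℕ → E}
    (hf : Summable f) : ∑' t, ∑ p ∈ Finset.HasAntidiagonal.antidiagonal t, f p = ∑' p, f p := by
  have summable_sigma := Finset.HasAntidiagonal.sigmaAntidiagonalEquivProd.summable_iff.2 hf
  rw [← Finset.HasAntidiagonal.sigmaAntidiagonalEquivProd.tsum_eq f]
  refine Eq.trans (tsum_congr fun t => ?_)
    (summable_sigma.tsum_sigma' fun t => (hasSum_fintype _).summable).symm
  rw [tsum_fintype, ← Finset.sum_coe_sort]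
  rfl

lemma sum_antidiagonal_binomialTerm (b σ : ℂ) (B : ℕ → ℂ) (x : ℂ) (t : ℕ) :
    ∑ p ∈ Finset.HasAntidiagonal.antidiagonal t, binomialTerm b σ B x p
      = risingTerm b (binomialTransform σ B) x t := by
  rw [Finset.Nat.sum_antidiagonal_eq_sum_range_succ_mk, risingTerm, binomialTransform,
    Finset.mul_sum, Finset.sum_mul]
  refine Finset.sum_congr rfl fun k hk => ?_
  have add_sub_self : k + (t - k) = t := by have := Finset.mem_range.1 hk; omega
  simp only [binomialTerm, add_sub_self]

lemma binomialTerm_eq_mul (b σ : ℂ) (B : ℕ → ℂ) (x : ℂ) (k j : ℕ) :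
    binomialTerm b σ B x (k, j)
      = risingTerm b B x k * (rising (b + k) j / (j.factorial : ℂ) * (σ / x) ^ j) := by
  have factorial_ne_zero : ((k + j).factorial : ℂ) ≠ 0 :=
    Nat.cast_ne_zero.2 (k + j).factorial_ne_zero
  rw [binomialTerm, risingTerm, rising_add, Nat.cast_add_choose]
  simp only [pow_add, div_pow]
  field_simp

lemma norm_binomialTerm_le {K' : ℝ} (hB : ∀ k, ‖B k‖ ≤ K * R ^ k)
    (hK' : ∀ k, ‖rising b k / (k.factorial : ℂ)‖ ≤ K' * 2 ^ k) (k j : ℕ) :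
    ‖binomialTerm b σ B x (k, j)‖
      ≤ K' * K * (4 * R / ‖x‖) ^ k * (4 * ‖σ‖ / ‖x‖) ^ j := by
  have choose_le : ((k + j).choose k : ℝ) ≤ 2 ^ (k + j) := by
    exact_mod_cast Nat.choose_le_two_pow _ _
  have bound_nonneg : 0 ≤ K' * 2 ^ (k + j) := (norm_nonneg _).trans (hK' (k + j))
  calc ‖binomialTerm b σ B x (k, j)‖
      ≤ K' * 2 ^ (k + j) * (2 ^ (k + j) * ‖σ‖ ^ j * (K * R ^ k)) * (‖x‖ ^ (k + j))⁻¹ := by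
        rw [binomialTerm, norm_mul, norm_mul, norm_mul, norm_mul, norm_inv, norm_pow, norm_pow,
          Complex.norm_natCast]
        have := hB k
        have := hK' (k + j)
        gcongr
    _ = K' * K * (4 * R / ‖x‖) ^ k * (4 * ‖σ‖ / ‖x‖) ^ j := by
        rw [show (4 : ℝ) = 2 * 2 by norm_num]
        simp only [div_pow, mul_pow, pow_add, mul_inv]
        ring

lemma summable_binomialTerm (b : ℂ) (hR : 0 ≤ R) (hB : ∀ k, ‖B k‖ ≤ K * R ^ k)
    (hx : 4 * R + 4 * ‖σ‖ < ‖x‖) : Summable (binomialTerm b σ B x) := by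
  obtain ⟨K', K'_nonneg, hK'⟩ := exists_norm_rising_div_factorial_le b one_lt_two
  have K_nonneg : 0 ≤ K := by simpa using (norm_nonneg _).trans (hB 0)
  have norm_σ_nonneg := norm_nonneg σ
  have norm_x_pos : 0 < ‖x‖ := by linarith
  have R_div_lt : 4 * R / ‖x‖ < 1 := by rw [div_lt_one norm_x_pos]; linarith
  have σ_div_lt : 4 * ‖σ‖ / ‖x‖ < 1 := by rw [div_lt_one norm_x_pos]; linarith
  have geometric : Summable fun p : ℕ × ℕ =>
      K' * K * (4 * R / ‖x‖) ^ p.1 * (4 * ‖σ‖ / ‖x‖) ^ p.2 :=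
    Summable.mul_of_nonneg ((summable_geometric_of_lt_one (by positivity) R_div_lt).mul_left _)
      (summable_geometric_of_lt_one (by positivity) σ_div_lt) (fun k => by positivity)
      (fun j => by positivity)
  exact geometric.of_norm_bounded fun ⟨k, j⟩ => norm_binomialTerm_le hB hK' k j

lemma tsum_binomialTerm (b : ℂ) (B : ℕ → ℂ) (hx : x ≠ 0) (hσ : ‖σ / x‖ < 1) (k : ℕ) :
    ∑' j, binomialTerm b σ B x (k, j) = ((x - σ) / x) ^ (-b) * risingTerm b B (x - σ) k := by
  have one_sub_div : 1 - σ / x = (x - σ) / x := by rw [sub_div, div_self hx]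
  have one_sub_ne_zero : 1 - σ / x ≠ 0 := fun h => by
    rw [← sub_eq_zero.1 h, norm_one] at hσ
    exact hσ.false
  simp only [binomialTerm_eq_mul]
  rw [tsum_mul_left, (hasSum_rising_div_factorial (b + k) hσ).tsum_eq, neg_add,
    Complex.cpow_add _ _ one_sub_ne_zero, Complex.cpow_neg _ (k : ℂ), Complex.cpow_natCast,
    one_sub_div, div_pow, risingTerm, risingTerm, inv_div]
  field_simp

lemma tsum_risingTerm_binomialTransform_of_large (b : ℂ) (hR : 0 ≤ R)
    (hB : ∀ k, ‖B k‖ ≤ K * R ^ k) (hx : 4 * R + 4 * ‖σ‖ < ‖x‖) :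
    ∑' t, risingTerm b (binomialTransform σ B) x t
      = ((x - σ) / x) ^ (-b) * ∑' k, risingTerm b B (x - σ) k := by
  have norm_σ_nonneg := norm_nonneg σ
  have norm_x_pos : 0 < ‖x‖ := by linarith
  have norm_div_lt : ‖σ / x‖ < 1 := by rw [norm_div, div_lt_one norm_x_pos]; linarith
  have summable := summable_binomialTerm (σ := σ) b hR hB hx
  simp only [← sum_antidiagonal_binomialTerm]
  rw [tsum_sum_antidiagonal summable, summable.tsum_prod]
  simp only [tsum_binomialTerm b B (norm_pos_iff.1 norm_x_pos) norm_div_lt, tsum_mul_left]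

end Rearrangement

/-! ### Continuation along a ray -/

section InnerProduct
variable {E : Type*} [NormedAddCommGroup E] [InnerProductSpace ℝ E] {x v : E} {r : ℝ}

lemma norm_lt_norm_add_smul (hv : v ≠ 0) (hxv : 0 ≤ inner ℝ x v) (hr : 0 < r) :
    ‖x‖ < ‖x + r • v‖ := by
  rw [← sq_lt_sq₀ (norm_nonneg _) (norm_nonneg _), norm_add_sq_real, inner_smul_right]
  have : 0 < ‖r • v‖ ^ 2 := pow_pos (norm_pos_iff.2 (smul_ne_zero hr.ne' hv)) 2
  have := mul_nonneg hr.le hxv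
  linarith

lemma inner_add_smul_pos (hv : v ≠ 0) (hxv : 0 ≤ inner ℝ x v) (hr : 0 < r) :
    0 < inner ℝ (x + r • v) v := by
  rw [inner_add_left, real_inner_smul_left]
  have := mul_pos hr (real_inner_self_pos.2 hv)
  linarith

lemma inner_bisector_nonneg (x y : E) : 0 ≤ inner ℝ x (‖y‖ • x + ‖x‖ • y) := by
  rw [inner_add_right, inner_smul_right, inner_smul_right, real_inner_self_eq_norm_sq]
  have := mul_le_mul_of_nonneg_left (neg_le_of_abs_le (abs_real_inner_le_norm x y)) (norm_nonneg x)
  linarith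

lemma tendsto_norm_add_smul_atTop (x : E) (hv : v ≠ 0) :
    Filter.Tendsto (fun r : ℝ => ‖x + r • v‖) Filter.atTop Filter.atTop := by
  have linear_tendsto : Filter.Tendsto (fun r : ℝ => r * ‖v‖ - ‖x‖) Filter.atTop Filter.atTop :=
    Filter.tendsto_atTop_add_const_right _ _
      (Filter.tendsto_id.atTop_mul_const (norm_pos_iff.2 hv))
  refine Filter.tendsto_atTop_mono (fun r => ?_) linear_tendsto
  have triangle := norm_sub_norm_le (r • v) (-x)
  rw [norm_neg, sub_neg_eq_add, add_comm (r • v), norm_smul, Real.norm_eq_abs] at triangle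
  have := mul_le_mul_of_nonneg_right (le_abs_self r) (norm_nonneg v)
  linarith

end InnerProduct

section Ray
variable {x y v : ℂ} {α : ℕ → ℂ}

lemma div_mem_slitPlane_iff (hx : x ≠ 0) :
    y / x ∈ Complex.slitPlane ↔ ∀ s : ℝ, s ≤ 0 → y ≠ s • x := by
  refine ⟨?_, fun h => by_contra fun h_div => ?_⟩
  · rintro h s hs rfl
    rw [Complex.real_smul, mul_div_cancel_right₀ _ hx, Complex.ofReal_mem_slitPlane] at h
    exact h.not_ge hs
  · rw [Complex.mem_slitPlane_iff, not_or, not_lt, not_not] at h_div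
    have div_eq_re : ((y / x).re : ℂ) = y / x := Complex.ext rfl h_div.2.symm
    exact h _ h_div.1 (by rw [Complex.real_smul, div_eq_re, div_mul_cancel₀ _ hx])

lemma div_mem_slitPlane (hx : 0 < inner ℝ x v) (hy : 0 < inner ℝ y v) :
    y / x ∈ Complex.slitPlane := by
  have x_ne_zero : x ≠ 0 := by
    rintro rfl
    simp at hx
  refine (div_mem_slitPlane_iff x_ne_zero).2 ?_
  rintro s hs rfl
  rw [real_inner_smul_left] at hy
  exact hy.not_ge (mul_nonpos_of_nonpos_of_nonneg hs hx.le)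

lemma tendsto_add_smul (x v : ℂ) :
    Filter.Tendsto (fun r : ℝ => x + r • v) (nhdsWithin 0 (Set.Ioi 0)) (nhds x) :=
  tendsto_nhdsWithin_of_tendsto_nhds (Continuous.tendsto' (by fun_prop) _ _ (by simp))

/-- On the negative axis the principal power is continuous from above. -/
lemma tendsto_cpow_of_neg {ι : Type*} {l : Filter ι} {f : ι → ℂ} {w : ℂ} (hw : w.re < 0)
    (hw' : w.im = 0) (hf : Filter.Tendsto f l (nhds w)) (hf' : ∀ᶠ i in l, 0 ≤ (f i).im) (b : ℂ) :
    Filter.Tendsto (fun i => f i ^ b) l (nhds (w ^ b)) := by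
  have w_ne_zero : w ≠ 0 := by
    rintro rfl
    simp at hw
  have log_tendsto : Filter.Tendsto (fun i => Complex.log (f i)) l (nhds (Complex.log w)) :=
    (Complex.continuousWithinAt_log_of_re_neg_of_im_zero hw hw').tendsto.comp
      (tendsto_nhdsWithin_iff.2 ⟨hf, hf'⟩)
  rw [Complex.cpow_def_of_ne_zero w_ne_zero]
  refine ((Complex.continuous_exp.tendsto _).comp (log_tendsto.mul_const b)).congr' ?_
  filter_upwards [hf.eventually_ne w_ne_zero] with i hi
  rw [Function.comp_apply, Complex.cpow_def_of_ne_zero hi]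

lemma im_add_mul_I_div_nonneg {s r : ℝ} (hs : s ≤ 0) (hr : 0 ≤ r) :
    0 ≤ (((s : ℂ) + r * Complex.I) / (1 + r * Complex.I)).im := by
  have im_eq : (((s : ℂ) + r * Complex.I) / (1 + r * Complex.I)).im
      = (r - s * r) / Complex.normSq (1 + r * Complex.I) := by
    simp [Complex.div_im, sub_div]
  rw [im_eq]
  exact div_nonneg (by nlinarith) (Complex.normSq_nonneg _)

/-- If `y` is a negative multiple of `x`, move orthogonally to `x`, to the side from which the
principal power is continuous; otherwise along the bisector of `x` and `y`. -/
lemma exists_ray (hx : x ≠ 0) (hy : y ≠ 0) (b : ℂ) :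
    ∃ v : ℂ, v ≠ 0 ∧ 0 ≤ inner ℝ x v ∧ 0 ≤ inner ℝ y v ∧
      Filter.Tendsto (fun r : ℝ => ((y + r • v) / (x + r • v)) ^ b) (nhdsWithin 0 (Set.Ioi 0))
        (nhds ((y / x) ^ b)) := by
  have quotient_tendsto (v : ℂ) : Filter.Tendsto (fun r : ℝ => (y + r • v) / (x + r • v))
      (nhdsWithin 0 (Set.Ioi 0)) (nhds (y / x)) :=
    (tendsto_add_smul y v).div (tendsto_add_smul x v) hx
  by_cases h_slit : y / x ∈ Complex.slitPlane
  · refine ⟨‖y‖ • x + ‖x‖ • y, fun h => ?_, inner_bisector_nonneg x y, ?_,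
      (continuousAt_cpow_const h_slit).tendsto.comp (quotient_tendsto _)⟩
    · refine (div_mem_slitPlane_iff hx).1 h_slit (-(‖x‖⁻¹ * ‖y‖))
        (neg_nonpos.2 (by positivity)) ?_
      rw [neg_smul, mul_smul, ← smul_neg, ← eq_neg_of_add_eq_zero_right h,
        inv_smul_smul₀ (norm_ne_zero_iff.2 hx)]
    · rw [add_comm]
      exact inner_bisector_nonneg y x
  · obtain ⟨s, hs, rfl⟩ : ∃ s : ℝ, s ≤ 0 ∧ y = s • x := by
      simpa only [div_mem_slitPlane_iff hx, not_forall, not_not, exists_prop] using h_slit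
    have s_neg : s < 0 := hs.lt_of_ne fun h => hy (by rw [h, zero_smul])
    have quotient_eq : s • x / x = (s : ℂ) := by
      rw [Complex.real_smul, mul_div_cancel_right₀ _ hx]
    have inner_zero : inner ℝ x (Complex.I * x) = 0 := by
      simp only [Complex.inner, Complex.mul_re, Complex.mul_im, Complex.conj_re,
        Complex.conj_im, Complex.I_re, Complex.I_im]
      ring
    refine ⟨Complex.I * x, mul_ne_zero Complex.I_ne_zero hx, inner_zero.ge, ?_,
      tendsto_cpow_of_neg (by rwa [quotient_eq]) (by rw [quotient_eq, Complex.ofReal_im])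
        (quotient_tendsto _) ?_ b⟩
    · rw [real_inner_smul_left, inner_zero, mul_zero]
    · filter_upwards [self_mem_nhdsWithin] with r hr
      have factor : (s • x + r • (Complex.I * x)) / (x + r • (Complex.I * x))
          = (s + r * Complex.I) / (1 + r * Complex.I) := by
        rw [← mul_div_mul_right (s + r * Complex.I) (1 + r * Complex.I) hx]
        simp only [Complex.real_smul]
        ring
      rw [factor]
      exact im_add_mul_I_div_nonneg hs (le_of_lt hr)

lemma norm_mul_inv_pow_le (hx : x ≠ 0) (hxy : ‖x‖ ≤ ‖y‖) (t : ℕ) :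
    ‖α t * (y ^ t)⁻¹‖ ≤ ‖α t * (x ^ t)⁻¹‖ := by
  simp only [norm_mul, norm_inv, norm_pow]
  gcongr

lemma differentiableOn_tsum_mul_inv_pow (hx : x ≠ 0) (h : Summable fun t => α t * (x ^ t)⁻¹) :
    DifferentiableOn ℂ (fun z : ℂ => ∑' t, α t * (z ^ t)⁻¹) {z | ‖x‖ < ‖z‖} := by
  refine Complex.differentiableOn_tsum_of_summable_norm h.norm (fun t z hz => ?_)
    (isOpen_lt continuous_const continuous_norm)
    fun t z hz => norm_mul_inv_pow_le hx (le_of_lt hz) t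
  have z_ne_zero : z ≠ 0 := norm_pos_iff.1 ((norm_nonneg x).trans_lt hz)
  fun_prop (disch := exact pow_ne_zero t z_ne_zero)

lemma continuousOn_tsum_mul_inv_pow (hx : x ≠ 0) (h : Summable fun t => α t * (x ^ t)⁻¹) :
    ContinuousOn (fun z : ℂ => ∑' t, α t * (z ^ t)⁻¹) {z | ‖x‖ ≤ ‖z‖} := by
  refine continuousOn_tsum (fun t z hz => ?_) h.norm fun t z hz => norm_mul_inv_pow_le hx hz t
  have z_ne_zero : z ≠ 0 := norm_pos_iff.1 ((norm_pos_iff.2 hx).trans_le hz)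
  fun_prop (disch := exact pow_ne_zero t z_ne_zero)

lemma analyticAt_add_smul (x v : ℂ) (r : ℝ) : AnalyticAt ℝ (fun r : ℝ => x + r • v) r := by
  fun_prop

lemma analyticOnNhd_tsum_ray (hx : x ≠ 0) (hv : v ≠ 0) (hxv : 0 ≤ inner ℝ x v)
    (h : Summable fun t => α t * (x ^ t)⁻¹) :
    AnalyticOnNhd ℝ (fun r : ℝ => ∑' t, α t * ((x + r • v) ^ t)⁻¹) (Set.Ioi 0) := by
  intro r hr
  have analyticAt_tsum : AnalyticAt ℂ (fun z : ℂ => ∑' t, α t * (z ^ t)⁻¹) (x + r • v) :=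
    (differentiableOn_tsum_mul_inv_pow hx h).analyticAt
      ((isOpen_lt continuous_const continuous_norm).mem_nhds (norm_lt_norm_add_smul hv hxv hr))
  exact (analyticAt_tsum.restrictScalars (𝕜 := ℝ)).comp_of_eq (analyticAt_add_smul x v r) rfl

lemma tendsto_tsum_ray (hx : x ≠ 0) (hv : v ≠ 0) (hxv : 0 ≤ inner ℝ x v)
    (h : Summable fun t => α t * (x ^ t)⁻¹) :
    Filter.Tendsto (fun r : ℝ => ∑' t, α t * ((x + r • v) ^ t)⁻¹) (nhdsWithin 0 (Set.Ioi 0))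
      (nhds (∑' t, α t * (x ^ t)⁻¹)) := by
  refine (continuousOn_tsum_mul_inv_pow hx h x (le_refl ‖x‖)).tendsto.comp
    (tendsto_nhdsWithin_iff.2 ⟨tendsto_add_smul x v, ?_⟩)
  filter_upwards [self_mem_nhdsWithin] with r hr using (norm_lt_norm_add_smul hv hxv hr).le

lemma analyticOnNhd_cpow_ray (hv : v ≠ 0) (hxv : 0 ≤ inner ℝ x v) (hyv : 0 ≤ inner ℝ y v)
    (b : ℂ) : AnalyticOnNhd ℝ (fun r : ℝ => ((y + r • v) / (x + r • v)) ^ b) (Set.Ioi 0) := by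
  intro r hr
  have ne_zero : x + r • v ≠ 0 :=
    norm_pos_iff.1 ((norm_nonneg x).trans_lt (norm_lt_norm_add_smul hv hxv hr))
  have analyticAt_cpow : AnalyticAt ℂ (fun z : ℂ => z ^ b) ((y + r • v) / (x + r • v)) :=
    analyticAt_id.cpow analyticAt_const
      (div_mem_slitPlane (inner_add_smul_pos hv hxv hr) (inner_add_smul_pos hv hyv hr))
  exact (analyticAt_cpow.restrictScalars (𝕜 := ℝ)).comp_of_eq
    ((analyticAt_add_smul y v r).div (analyticAt_add_smul x v r) ne_zero) rfl

lemma eqOn_Ioi_of_eventuallyEq_atTop {f g : ℝ → ℂ} {a : ℝ} (hf : AnalyticOnNhd ℝ f (Set.Ioi a))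
    (hg : AnalyticOnNhd ℝ g (Set.Ioi a)) (hfg : f =ᶠ[Filter.atTop] g) :
    Set.EqOn f g (Set.Ioi a) := by
  obtain ⟨N, hN⟩ := Filter.eventually_atTop.1 hfg
  have lt_max : max N a < max N a + 1 := lt_add_one _
  refine hf.eqOn_of_preconnected_of_eventuallyEq hg isPreconnected_Ioi (z₀ := max N a + 1)
    ((le_max_right N a).trans_lt lt_max) ?_
  filter_upwards [Ioi_mem_nhds lt_max] with r hr using hN r ((le_max_left N a).trans hr.le)

end Ray

/-- Both sides are analytic along a suitable ray starting at `x` and agree far out on it; they are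
continuous at its origin, by absolute convergence there. -/
theorem tsum_risingTerm_binomialTransform {b σ x : ℂ} {B : ℕ → ℂ} {K R : ℝ} (hR : 0 ≤ R)
    (hB : ∀ k, ‖B k‖ ≤ K * R ^ k) (hx : x ≠ 0) (hxσ : x - σ ≠ 0)
    (h : Summable (risingTerm b (binomialTransform σ B) x))
    (h' : Summable (risingTerm b B (x - σ))) :
    ∑' t, risingTerm b (binomialTransform σ B) x t
      = ((x - σ) / x) ^ (-b) * ∑' k, risingTerm b B (x - σ) k := by
  obtain ⟨v, hv, inner_x, inner_xσ, cpow_tendsto⟩ := exists_ray hx hxσ (-b)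
  let f (r : ℝ) : ℂ := ∑' t, risingTerm b (binomialTransform σ B) (x + r • v) t
  let g (r : ℝ) : ℂ := ((x - σ + r • v) / (x + r • v)) ^ (-b) *
    ∑' k, risingTerm b B (x - σ + r • v) k
  have eventually_eq : f =ᶠ[Filter.atTop] g := by
    filter_upwards [(tendsto_norm_add_smul_atTop x hv).eventually_gt_atTop (4 * R + 4 * ‖σ‖)]
      with r hr
    simp only [f, g, tsum_risingTerm_binomialTransform_of_large b hR hB hr, add_sub_right_comm]
  have eqOn : Set.EqOn f g (Set.Ioi 0) := eqOn_Ioi_of_eventuallyEq_atTop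
    (analyticOnNhd_tsum_ray hx hv inner_x h)
    ((analyticOnNhd_cpow_ray hv inner_x inner_xσ (-b)).mul
      (analyticOnNhd_tsum_ray hxσ hv inner_xσ h')) eventually_eq
  exact tendsto_nhds_unique_of_eventuallyEq (tendsto_tsum_ray hx hv inner_x h)
    (cpow_tendsto.mul (tendsto_tsum_ray hxσ hv inner_xσ h'))
    (eqOn.eventuallyEq_of_mem self_mem_nhdsWithin)

/-! ### The series of a symmetric matrix in terms of its eigenvalues -/

lemma mul_cpow_neg {x y b : ℂ} (hx : x ≠ 0) (hy : y ≠ 0)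
    (h : x.arg + y.arg ∈ Set.Ioc (-Real.pi) Real.pi ∨ ∃ n : ℤ, b = n) :
    x ^ (-b) * y ^ (-b) = (x * y) ^ (-b) := by
  rcases h with harg | ⟨n, rfl⟩
  · rw [Complex.cpow_def_of_ne_zero hx, Complex.cpow_def_of_ne_zero hy,
      Complex.cpow_def_of_ne_zero (mul_ne_zero hx hy), Complex.log_mul hx hy harg,
      ← Complex.exp_add, add_mul]
  · rw [← Int.cast_neg, Complex.cpow_intCast, Complex.cpow_intCast, Complex.cpow_intCast, mul_zpow]

section Eigenvalues
variable {m t : ℕ} {a b c : ℂ} {X : SymMat m} {ev : Fin m → ℂ}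

lemma charpoly_neg {n R : Type*} [Fintype n] [DecidableEq n] [CommRing R] (M : Matrix n n R) :
    (-M).charpoly = (-1 : R) ^ Fintype.card n • M.charpoly.comp (-Polynomial.X) := by
  rw [Matrix.charpoly, Matrix.charpoly, ← Polynomial.coe_compRingHom_apply, RingHom.map_det,
    Polynomial.smul_eq_C_mul, map_pow, map_neg, map_one, ← Matrix.det_neg]
  congr 1
  ext1 i j
  rcases eq_or_ne i j with rfl | hij
  · simp [Matrix.charmatrix_apply_eq, add_comm]
  · simp [Matrix.charmatrix_apply_ne _ _ _ hij]

lemma roots_charpoly_neg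
    (hev : (X : Matrix (Fin m) (Fin m) ℂ).charpoly.roots = Finset.univ.val.map ev) :
    ((-X : SymMat m) : Matrix (Fin m) (Fin m) ℂ).charpoly.roots = Finset.univ.val.map (-ev) := by
  rw [Submodule.coe_neg, charpoly_neg, Polynomial.roots_smul_nonzero _ (by simp),
    Polynomial.roots_comp_neg_X, hev, Multiset.map_map]
  rfl

lemma absEigenvalueSum_eq_sum
    (hev : (X : Matrix (Fin m) (Fin m) ℂ).charpoly.roots = Finset.univ.val.map ev) :
    absEigenvalueSum X = ∑ i, ‖ev i‖ := by
  rw [absEigenvalueSum, hev, Multiset.map_map]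
  rfl

lemma absEigenvalueSum_neg (X : SymMat m) : absEigenvalueSum (-X) = absEigenvalueSum X := by
  obtain ⟨ev, hev⟩ := exists_roots_charpoly_eq_map (X : Matrix (Fin m) (Fin m) ℂ)
  rw [absEigenvalueSum_eq_sum hev, absEigenvalueSum_eq_sum (roots_charpoly_neg hev)]
  simp only [Pi.neg_apply, norm_neg]

lemma oneP1Term_eq_eval (f : ℕ → ℂ) (a c : ℂ) (t : ℕ)
    (hev : (X : Matrix (Fin m) (Fin m) ℂ).charpoly.roots = Finset.univ.val.map ev) :
    oneP1Term f a c X t = f t / (t.factorial : ℂ) * eval ev (kummerPoly m a c t) := by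
  rw [oneP1Term, kummerPoly, map_sum]
  congr 1
  refine Finset.sum_congr rfl fun τ hτ => ?_
  rw [zonal_eq_traceCoeff_mul_zonalMean hτ, zonalMean_eq_eval τ X hev, smul_eval]
  ring

lemma oneP1Term_cpow (a b c : ℂ) {d : ℂ} (hd : d ≠ 0)
    (hev : (X : Matrix (Fin m) (Fin m) ℂ).charpoly.roots = Finset.univ.val.map ev) :
    oneP1Term (fun t => rising b t * d ^ (-b - (t : ℂ))) a c X
      = fun t => d ^ (-b) * risingTerm b (fun t => eval ev (kummerPoly m a c t)) d t := by
  funext t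
  rw [oneP1Term_eq_eval _ a c t hev, risingTerm, Complex.cpow_sub _ _ hd, Complex.cpow_natCast]
  ring

lemma oneP1Term_zpow (a b c z : ℂ)
    (hev : (X : Matrix (Fin m) (Fin m) ℂ).charpoly.roots = Finset.univ.val.map ev) :
    oneP1Term (fun t => rising b t * z ^ (-(t : ℤ))) a c X
      = risingTerm b (fun t => eval ev (kummerPoly m a c t)) z := by
  funext t
  rw [oneP1Term_eq_eval _ a c t hev, risingTerm, zpow_neg, zpow_natCast]
  ring

lemma summable_risingTerm_kummerPoly (a b c : ℂ) {z : ℂ}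
    (hev : (X : Matrix (Fin m) (Fin m) ℂ).charpoly.roots = Finset.univ.val.map ev)
    (hz : absEigenvalueSum X < ‖z‖) :
    Summable (risingTerm b (fun t => eval ev (kummerPoly m a c t)) z) := by
  rw [absEigenvalueSum_eq_sum hev] at hz
  exact summable_risingTerm b (by positivity) hz fun r hr => exists_norm_kummerPoly_le a c hr ev

lemma summable_oneP1Term_cpow (a b c : ℂ) {d : ℂ} (hd : absEigenvalueSum X < ‖d‖) :
    Summable (oneP1Term (fun t => rising b t * d ^ (-b - (t : ℂ))) a c X) := by
  obtain ⟨ev, hev⟩ := exists_roots_charpoly_eq_map (X : Matrix (Fin m) (Fin m) ℂ)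
  have nonneg : 0 ≤ absEigenvalueSum X := by rw [absEigenvalueSum_eq_sum hev]; positivity
  rw [oneP1Term_cpow a b c (norm_pos_iff.1 (nonneg.trans_lt hd)) hev]
  exact (summable_risingTerm_kummerPoly a b c hev hd).mul_left _

lemma summable_oneP1Term_zpow (a b c : ℂ) {z : ℂ} (hz : absEigenvalueSum X < ‖z‖) :
    Summable (oneP1Term (fun t => rising b t * z ^ (-(t : ℤ))) a c X) := by
  obtain ⟨ev, hev⟩ := exists_roots_charpoly_eq_map (X : Matrix (Fin m) (Fin m) ℂ)
  rw [oneP1Term_zpow a b c z hev]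
  exact summable_risingTerm_kummerPoly a b c hev hz

lemma eval_smul_of_isHomogeneous {σ R : Type*} [CommSemiring R] {p : MvPolynomial σ R}
    (hp : p.IsHomogeneous t) (r : R) (x : σ → R) : eval (r • x) p = r ^ t * eval x p := by
  rw [eval_eq, eval_eq, Finset.mul_sum]
  refine Finset.sum_congr rfl fun α hα => ?_
  have degree_eq : ∑ i ∈ α.support, α i = t := by
    rw [← Finsupp.degree_apply, Finsupp.degree_eq_weight_one]
    exact hp (mem_support_iff.1 hα)
  simp only [Pi.smul_apply, smul_eq_mul, mul_pow, Finset.prod_mul_distrib,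
    Finset.prod_pow_eq_pow_sum, degree_eq]
  ring

lemma kummerPoly_isHomogeneous (a c : ℂ) (t : ℕ) : (kummerPoly m a c t).IsHomogeneous t :=
  IsHomogeneous.sum _ _ _ fun τ hτ => by
    obtain ⟨rfl, hanti⟩ := mem_partitions.1 hτ
    exact (homogeneousSubmodule _ ℂ _).smul_mem _ (zonalPoly_isHomogeneous hanti)

lemma risingPartition_ne_zero (hc : ∀ (i : Fin m) (k : ℕ), c - ((i : ℕ) : ℂ) / 2 + k ≠ 0)
    (τ : Fin m → ℕ) : risingPartition c τ ≠ 0 :=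
  Finset.prod_ne_zero_iff.2 fun i _ => Finset.prod_ne_zero_iff.2 fun k _ => hc i k

lemma sub_half_add_natCast_ne_zero (hc : ((m : ℝ) - 1) / 2 < c.re) (i : Fin m) (k : ℕ) :
    c - ((i : ℕ) : ℂ) / 2 + k ≠ 0 := by
  have i_succ_le : ((i : ℕ) : ℝ) + 1 ≤ m := by exact_mod_cast i.2
  have re_eq : (c - ((i : ℕ) : ℂ) / 2 + k).re = c.re - (i : ℕ) / 2 + k := by simp
  have re_pos : 0 < (c - ((i : ℕ) : ℂ) / 2 + k).re := by
    linarith [k.cast_nonneg (α := ℝ)]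
  exact fun h => re_pos.ne' (by rw [h, Complex.zero_re])

lemma eval_kummerPoly_eq_binomialTransform (a : ℂ)
    (hc : ∀ (i : Fin m) (k : ℕ), c - ((i : ℕ) : ℂ) / 2 + k ≠ 0) (ev : Fin m → ℂ) :
    (fun t => eval ev (kummerPoly m a c t))
      = binomialTransform (∑ i, ev i) fun k => eval (-ev) (kummerPoly m (c - a) c k) := by
  funext t
  rw [kummerPoly_eq_sum a (risingPartition_ne_zero hc), map_sum, binomialTransform]
  refine Finset.sum_congr rfl fun k _ => ?_
  rw [smul_eval, map_mul, map_pow, eval_psum_one, ← neg_one_smul ℂ ev,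
    eval_smul_of_isHomogeneous (kummerPoly_isHomogeneous (c - a) c k)]
  ring

theorem oneP1_cpow_eq_mul_oneP1_zpow {d s : ℂ}
    (hc : ∀ (i : Fin m) (k : ℕ), c - ((i : ℕ) : ℂ) / 2 + k ≠ 0)
    (hs : s = (X : Matrix (Fin m) (Fin m) ℂ).trace) (hd : d ≠ 0) (hds : d ≠ s)
    (harg : d.arg + (1 - s / d).arg ∈ Set.Ioc (-Real.pi) Real.pi ∨ ∃ n : ℤ, b = n)
    (h : Summable (oneP1Term (fun t => rising b t * d ^ (-b - (t : ℂ))) a c X))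
    (h' : Summable (oneP1Term (fun t => rising b t * (d - s) ^ (-(t : ℤ))) (c - a) c (-X))) :
    oneP1 (fun t => rising b t * d ^ (-b - (t : ℂ))) a c X
      = (d - s) ^ (-b) * oneP1 (fun t => rising b t * (d - s) ^ (-(t : ℤ))) (c - a) c (-X) := by
  obtain ⟨ev, hev⟩ := exists_roots_charpoly_eq_map (X : Matrix (Fin m) (Fin m) ℂ)
  rw [trace_eq_sum_eigenvalues hev] at hs
  have sub_ne_zero : d - s ≠ 0 := sub_ne_zero.2 hds
  have cpow_ne_zero : d ^ (-b) ≠ 0 := fun h => hd (Complex.cpow_eq_zero_iff _ _ |>.1 h).1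
  have cpow_mul : d ^ (-b) * ((d - s) / d) ^ (-b) = (d - s) ^ (-b) := by
    rw [one_sub_div hd] at harg
    rw [mul_cpow_neg hd (div_ne_zero sub_ne_zero hd) harg, mul_div_cancel₀ _ hd]
  obtain ⟨K, -, hK⟩ := exists_norm_kummerPoly_le (c - a) c one_lt_two (-ev)
  rw [oneP1Term_cpow a b c hd hev, eval_kummerPoly_eq_binomialTransform a hc, ← hs,
    summable_mul_left_iff cpow_ne_zero] at h
  rw [oneP1Term_zpow (c - a) b c (d - s) (roots_charpoly_neg hev)] at h'
  rw [oneP1, oneP1, oneP1Term_cpow a b c hd hev, eval_kummerPoly_eq_binomialTransform a hc, ← hs,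
    oneP1Term_zpow (c - a) b c (d - s) (roots_charpoly_neg hev), tsum_mul_left,
    tsum_risingTerm_binomialTransform (by positivity) hK hd sub_ne_zero h h', ← mul_assoc, cpow_mul]

end Eigenvalues

theorem mainTheorem2_general (m : ℕ) (X : SymMat m) (a c : ℂ)
    (hc : ∀ (i : Fin m) (k : ℕ), c - ((i : ℕ) : ℂ) / 2 + k ≠ 0)
    (b d s : ℂ) (hs : s = (X : Matrix (Fin m) (Fin m) ℂ).trace) :
    (absEigenvalueSum X < ‖d‖ →
      Summable (oneP1Term (fun t => rising b t * d ^ (-b - (t : ℂ))) a c X)) ∧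
    (absEigenvalueSum X < ‖d - s‖ →
      Summable (oneP1Term (fun t => rising b t * (d - s) ^ (-(t : ℤ))) (c - a) c (-X))) ∧
    (d ≠ 0 → d ≠ s →
      (d.arg + (1 - s / d).arg ∈ Set.Ioc (-Real.pi) Real.pi ∨ ∃ n : ℤ, b = n) →
      Summable (oneP1Term (fun t => rising b t * d ^ (-b - (t : ℂ))) a c X) →
      Summable (oneP1Term (fun t => rising b t * (d - s) ^ (-(t : ℤ))) (c - a) c (-X)) →
      oneP1 (fun t => rising b t * d ^ (-b - (t : ℂ))) a c X =
        (d - s) ^ (-b) *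
          oneP1 (fun t => rising b t * (d - s) ^ (-(t : ℤ))) (c - a) c (-X)) :=
  ⟨summable_oneP1Term_cpow a b c,
    fun hz => summable_oneP1Term_zpow (c - a) b c (by rwa [absEigenvalueSum_neg]),
    oneP1_cpow_eq_mul_oneP1_zpow hc hs⟩

end KummerPearson

end

open KummerPearson in
theorem mainTheorem2 (m : ℕ) (X : SymMat m)
    (hX : ((X : Matrix (Fin m) (Fin m) ℂ).map Complex.re).PosDef)
    (a c : ℂ) (ha : ((m : ℝ) - 1) / 2 < a.re) (hc : ((m : ℝ) - 1) / 2 < c.re)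
    (b d s : ℂ) (hs : s = (X : Matrix (Fin m) (Fin m) ℂ).trace) :
    (absEigenvalueSum X < ‖d‖ →
      Summable (oneP1Term (fun t => rising b t * d ^ (-b - (t : ℂ))) a c X)) ∧
    (absEigenvalueSum X < ‖d - s‖ →
      Summable (oneP1Term (fun t => rising b t * (d - s) ^ (-(t : ℤ))) (c - a) c (-X))) ∧
    (d ≠ 0 → d ≠ s →
      (d.arg + (1 - s / d).arg ∈ Set.Ioc (-Real.pi) Real.pi ∨ ∃ n : ℤ, b = n) →
      Summable (oneP1Term (fun t => rising b t * d ^ (-b - (t : ℂ))) a c X) →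
      Summable (oneP1Term (fun t => rising b t * (d - s) ^ (-(t : ℤ))) (c - a) c (-X)) →
      oneP1 (fun t => rising b t * d ^ (-b - (t : ℂ))) a c X =
        (d - s) ^ (-b) *
          oneP1 (fun t => rising b t * (d - s) ^ (-(t : ℤ))) (c - a) c (-X)) :=
  mainTheorem2_general m X a c (sub_half_add_natCast_ne_zero hc) b d s hs
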